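/- All graphs are finite and simple. A *maximal planar graph* is a plane triangulation (every face is a triangle). A *semi-maximal planar graph on $C$*, written $G^C$, is a connected plane graph in which one face is bounded by the cycle $C=v_1v_2\cdots v_nv_1$, $n\ge 4$, and all other faces are triangles ($C$ may have chords). A set $S$ of vertices (or a cycle with vertex set $S$) is *2-colorable* in a graph if some proper 4-coloring of the graph uses exactly two colors on $S$. For even $n$ let $\Gamma(C)$ be the set of vertices outside $C$ adjacent to a vertex of $C$, and $\Gamma^*(C)$ the set of vertices outside $C$ adjacent both to a vertex of $C$ with odd subscript and to one with even subscript; the vertices of $O(C)=\Gamma(C)\setminus\Gamma^*(C)$ are called *opened*. A *fence* is a plane graph every face of which has even degree at least $4$ (the degree counts cut edges twice). **Types.** $C$ is *closed* if the subgraph induced by $V(C)$ is $C$ and $\Gamma(C)=\Gamma^*(C)$; it is *opened* if $\Gamma(C)\ne\Gamma^*(C)$. For the types (4)–(9), a *decomposition* is a partition $V(G^C)=V_1\sqcup V_2$ with $V(C)\subseteq V_1$ such that the induced subgraphs $G_1=G^C[V_1]$ and $G_2=G^C[V_2]$ are both bipartite; $G_s$ denotes the component of $G_1$ that includes $C$.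 "$G_2$ contains 2-colorable even cycles" means that $G_2$ contains an even cycle and all even cycles of $G_2$ are 2-colorable in $G^C-V(G_s)$. 1. *closed cycle-cycle*: $C$ is closed, $G^C[\Gamma^*(C)]$ is a cycle, and it is 2-colorable in $G^C-V(C)$. 2. *closed cycle-tree*: $C$ is closed, $\Gamma^*(C)=V(G^C)\setminus V(C)$, and $G^C[\Gamma^*(C)]$ is a tree. 3. *closed cycle-fence*: $C$ is closed, $\Gamma^*(C)\neq V(G^C)\setminus V(C)$, $G^C[\Gamma^*(C)]$ is a fence, and each of its even cycles is 2-colorable in $G^C-V(C)$. 4. *fence-tree*: $C$ is opened, and for some decomposition $G_1$ is a fence whose only cycle is $C$ and $G_2$ is a tree. 5. *fence-cycle*: $C$ is opened, and for some decomposition $G_s$ is a fence whose only cycle is $C$ and $G_2$ contains 2-colorable even cycles. 6. *scycles-forest*: $C$ is opened, and for some decomposition $G_1$ contains even cycles other than $C$, each of which is joined by a path of $G_1$ to another one of them, or is joined to $C$ by a path of $G_1$ containing an opened vertex, and $G_2$ is a forest. 7. *scycles-scycles*: $C$ is opened, and for some decomposition $G_1$ contains an even cycle other than $C$ and $G_2$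 contains 2-colorable even cycles. 8. *intersected cycles-forest*: $C$ is opened or has a chord, and for some decomposition $G_1=C\cup C_1\cup\cdots\cup C_k$ with $k\ge1$ and even cycles $C_j\ne C$, each having at least two vertices of $C$ and together covering $V(C)$, and $G_2$ is a forest. 9. *intersected cycles-cycles*: $C$ is opened or has a chord, and for some decomposition $G_1$ contains even cycles $C_1,\dots,C_k\neq C$ ($k\ge 1$), each having at least two vertices of $C$ and together covering $V(C)$, and $G_2$ contains 2-colorable even cycles. **The improved Black-White operation on $C$ of $G^C$.** Throughout, $B$, $W$ are the sets of black and white vertices; the other vertices are grey. A *unicolor odd cycle* is an odd cycle in $G^C[B]$ or in $G^C[W]$. *Initial coloring.* Color $V(C)$ black, $\Gamma^*(C)$ white, $\Gamma^{2*}(C)$ black, $\Gamma^{3*}(C)$ white, and so on until $\Gamma^{t*}(C)=\emptyset$. Here $\Gamma^{(k+1)*}(C)$ is, for $k\ge1$, the set of vertices not yet colored that are adjacent to two vertices joined by a walk of odd length in $G^C[\Gamma^{k*}(C)]$. If there is a unicolor odd cycle, make a vertex of such a cycle grey and stop; otherwise, if no vertex is grey, stop. *Notions for the present coloring.* A grey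 vertex $v$ is *bad* in a color if giving $v$ that color makes the set of vertices of that color induce a graph with an odd cycle. It is a *petal-vertex* if it is bad in both colors. The *extension* by a grey vertex $u$ in a color is obtained by giving $u$ that color and then repeatedly, in rounds, coloring all grey neighbors of the vertices colored last (at first, of $u$) that are bad in at least one color: white if they are bad in black, and black otherwise; the vertices colored after $u$ form the *fixed-set* of $u$. Two grey vertices $u\ne v$ form a *petal-pair* if $G^C[B\cup\{u,v\}]$ and $G^C[W\cup\{u,v\}]$ both have an odd cycle through $u$ and $v$; the petal-pairs are the edges of the *petal-graph*. A grey vertex $u$ is a *general petal-vertex* if each of its two extensions has a unicolor odd cycle or a petal-graph with an odd cycle. A grey vertex $u$ that is not a general petal-vertex is *restricted* if exactly one of its two extensions has a unicolor odd cycle; to *force* $u$ is to pass to the other extension. The coloring is *obstructed* if there is a petal-vertex, a general petal-vertex or a unicolor odd cycle. *Steps.* (a) If there are restricted vertices, force one of them. (b) If the coloring is obstructed, stop. (c) If there are restricted vertices, go to (a). (d) If there are no grey vertices, stop. Otherwise choose a grey vertex $v$ with the largest number of non-grey neighbors, and color it black; $v$ becomes a black sign-vertex. (e) If there are restricted vertices,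 force one of them. (f) If there are no grey vertices, stop. Otherwise, if the coloring is obstructed: if there are black sign-vertices, let $w$ be the latest one, make grey again all vertices colored after $w$, color $w$ white (so that it is no longer a black sign-vertex), and go to (e); if there are none, stop. (g) If there are restricted vertices, go to (e); otherwise go to (d). **Theorem.** (i) Let $G^C$ be a semi-maximal planar graph on an even cycle $C$. Then $C$ is 2-colorable in $G^C$ if and only if $G^C$ is of at least one of the types (1)–(9). (ii) Let $G$ be a maximal planar graph with minimum degree $\delta(G)\ge4$, let $C$ be an even cycle of $G$ (of length at least $4$), and let $G^C_1$, $G^C_2$ be the two semi-maximal planar graphs into which $C$ splits $G$ ($C$ together with the part of $G$ on one side of it). Then on each side the improved Black-White operation can be carried out until it stops, and whatever choices are made, $C$ is 2-colorable in $G$ if and only if neither $G^C_1$ nor $G^C_2$ contains grey vertices after the operation has stopped on it. -/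

import Mathlib

open Set SimpleGraph

noncomputable section

/-! ### Plane graphs -/

/-- A planar embedding of a finite connected graph, given combinatorially: `next` is the face
permutation of the darts (oriented edges), so that its orbits are the boundary walks of the faces;
the induced rotation `d ↦ next d.symm` runs through all darts leaving a vertex, and Euler's formula
says that the surface carrying the embedding is the sphere. -/
structure PlaneEmbedding {V : Type*} [Fintype V] (G : SimpleGraph V) where
  next : Equiv.Perm G.Dart
  next_fst : ∀ d : G.Dart, (next d).fst = d.snd
  rotation_transitive : ∀ d e : G.Dart, d.fst = e.fst →
    Equiv.Perm.SameCycle ((Equiv.mk Dart.symm Dart.symm Dart.symm_symm Dart.symm_symm).trans next) d e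
  connected : G.Connected
  euler : Nat.card V + Nat.card (Quotient (Equiv.Perm.SameCycle.setoid next))
    = Nat.card G.edgeSet + 2

/-- A maximal planar graph, that is, a triangulation: every face is bounded by three edges. -/
def PlaneEmbedding.IsTriangulation {V : Type*} [Fintype V] {G : SimpleGraph V}
    (E : PlaneEmbedding G) : Prop :=
  ∀ d : G.Dart, E.next (E.next (E.next d)) = d

/-- `c` lists the successive vertices of a cycle of `G` of length `n ≥ 4`. -/
structure IsLongCycle {V : Type*} (G : SimpleGraph V) {n : ℕ} (c : ZMod n → V) : Prop where
  four_le : 4 ≤ n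
  injective : Function.Injective c
  adj : ∀ i, G.Adj (c i) (c (i + 1))

/-- A semi-maximal planar graph on the cycle `c`: one face is bounded by the cycle `c`, all other
faces are triangles. -/
structure PlaneEmbedding.IsSemiMaximal {V : Type*} [Fintype V] {G : SimpleGraph V}
    (E : PlaneEmbedding G) {n : ℕ} (c : ZMod n → V) : Prop where
  isCycle : IsLongCycle G c
  outer : ∀ (d : G.Dart) (i : ZMod n), d.toProd = (c i, c (i + 1)) →
    (E.next d).toProd = (c (i + 1), c (i + 1 + 1))
  triangle : ∀ d : G.Dart, (∀ i, d.toProd ≠ (c i, c (i + 1))) →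
    E.next (E.next (E.next d)) = d

/-- Two darts have the same face of the plane subgraph with edge set `K` on their left: the faces
of that subgraph arise from the faces of `G` by merging along the edges that are not in `K`. -/
def PlaneEmbedding.SameFace {V : Type*} [Fintype V] {G : SimpleGraph V}
    (E : PlaneEmbedding G) (K : Set (Sym2 V)) : G.Dart → G.Dart → Prop :=
  Relation.EqvGen fun d e => e = E.next d ∨ (e = d.symm ∧ d.edge ∉ K)

/-- The plane graph `G[S]` is a fence: the degree of every face is even and at least `4` (cut edges
are counted twice). -/
def PlaneEmbedding.IsFence {V : Type*} [Fintype V] {G : SimpleGraph V}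
    (E : PlaneEmbedding G) (S : Set V) : Prop :=
  ∀ d : G.Dart,
    Even {e : G.Dart | E.SameFace {a | ∀ x ∈ a, x ∈ S} d e ∧ e.fst ∈ S ∧ e.snd ∈ S}.ncard ∧
    4 ≤ {e : G.Dart | E.SameFace {a | ∀ x ∈ a, x ∈ S} d e ∧ e.fst ∈ S ∧ e.snd ∈ S}.ncard

/-! ### Colorings and cycles -/

/-- The vertices in `S` are colored with exactly two colors in some proper `4`-coloring of `G`. -/
def TwoColorable {V : Type*} (G : SimpleGraph V) (S : Set V) : Prop :=
  ∃ f : G.Coloring (Fin 4), (f '' S).ncard = 2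

/-- The set `S` of vertices is `2`-colorable in the graph `G - X`. -/
def TwoColorableOff {V : Type*} (G : SimpleGraph V) (X S : Set V) : Prop :=
  TwoColorable (G.induce Xᶜ) (Subtype.val ⁻¹' S)

/-- The subgraph `D` is a cycle. -/
def IsCyc {V : Type*} {G : SimpleGraph V} (D : G.Subgraph) : Prop :=
  ∃ (v : V) (p : G.Walk v v), p.IsCycle ∧ p.toSubgraph = D

/-- `D` is an even cycle of `G[S]`. -/
def IsEvenCycIn {V : Type*} {G : SimpleGraph V} (S : Set V) (D : G.Subgraph) : Prop :=
  D.verts ⊆ S ∧ ∃ (v : V) (p : G.Walk v v), p.IsCycle ∧ Even p.length ∧ p.toSubgraph = D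

/-- `G[S]` contains an odd cycle. -/
def HasOddCycle {V : Type*} (G : SimpleGraph V) (S : Set V) : Prop :=
  ∃ (v : V) (p : G.Walk v v), p.IsCycle ∧ Odd p.length ∧ ∀ x ∈ p.support, x ∈ S

/-- The cycle `c` as a subgraph of `G`. -/
def cycleSubgraph {V : Type*} (G : SimpleGraph V) {n : ℕ} (c : ZMod n → V) : G.Subgraph where
  verts := range c
  Adj a b := G.Adj a b ∧ ∃ i, s(a, b) = s(c i, c (i + 1))
  adj_sub h := h.1
  edge_vert := by
    rintro a b ⟨-, i, hi⟩
    rcases Sym2.eq_iff.1 hi with ⟨rfl, -⟩ | ⟨rfl, -⟩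
    exacts [⟨_, rfl⟩, ⟨_, rfl⟩]
  symm := ⟨fun a b ⟨h, i, hi⟩ => ⟨h.symm, i, by rw [Sym2.eq_swap]; exact hi⟩⟩

/-- `c` has no chord: the subgraph induced by its vertices is the cycle itself. -/
def Chordless {V : Type*} (G : SimpleGraph V) {n : ℕ} (c : ZMod n → V) : Prop :=
  (⊤ : G.Subgraph).induce (range c) = cycleSubgraph G c

/-- `Γ(C)`: the vertices outside `C` adjacent to a vertex of `C`. -/
def gam {V : Type*} (G : SimpleGraph V) {n : ℕ} (c : ZMod n → V) : Set V :=
  {v | v ∉ range c ∧ ∃ i, G.Adj v (c i)}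

/-- `Γ*(C)`: the vertices outside `C` adjacent both to a vertex of `C` with odd subscript and to one
with even subscript. -/
def gamStar {V : Type*} (G : SimpleGraph V) {n : ℕ} (c : ZMod n → V) : Set V :=
  {v | v ∉ range c ∧ (∃ i, Odd i.val ∧ G.Adj v (c i)) ∧ ∃ i, Even i.val ∧ G.Adj v (c i)}

/-- The opened vertices of `C`. -/
def openedVertices {V : Type*} (G : SimpleGraph V) {n : ℕ} (c : ZMod n → V) : Set V :=
  gam G c \ gamStar G c

/-! ### The nine structural types -/

/-- `C` is a closed cycle (and the subgraph induced by `V(C)` is `C`). -/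
def Closed {V : Type*} (G : SimpleGraph V) {n : ℕ} (c : ZMod n → V) : Prop :=
  Chordless G c ∧ gam G c = gamStar G c

/-- `C` is an opened cycle. -/
def Opened {V : Type*} (G : SimpleGraph V) {n : ℕ} (c : ZMod n → V) : Prop :=
  gam G c ≠ gamStar G c

/-- Closed cycle-cycle type, in which `G[Γ*(C)]` is `2`-colorable in `G - C`. -/
def ClosedCycleCycle {V : Type*} (G : SimpleGraph V) {n : ℕ} (c : ZMod n → V) : Prop :=
  Closed G c ∧ IsCyc ((⊤ : G.Subgraph).induce (gamStar G c)) ∧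
    TwoColorableOff G (range c) (gamStar G c)

/-- Closed cycle-tree type: `G[Γ*(C)]` is the subgraph induced by all inner vertices, and it is a
tree. -/
def ClosedCycleTree {V : Type*} (G : SimpleGraph V) {n : ℕ} (c : ZMod n → V) : Prop :=
  Closed G c ∧ gamStar G c = (range c)ᶜ ∧ (G.induce (gamStar G c)).IsTree

/-- Closed cycle-fence type, in which the even cycles of the fence are `2`-colorable. -/
def ClosedCycleFence {V : Type*} [Fintype V] {G : SimpleGraph V} (E : PlaneEmbedding G) {n : ℕ}
    (c : ZMod n → V) : Prop :=
  Closed G c ∧ gamStar G c ≠ (range c)ᶜ ∧ E.IsFence (gamStar G c) ∧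
    ∀ D : G.Subgraph, IsEvenCycIn (gamStar G c) D → TwoColorableOff G (range c) D.verts

/-- A decomposition of `G` into two bipartite induced subgraphs `G₁ = G[V₁]`, which includes `C`,
and `G₂ = G - V₁`. -/
structure IsDecomposition {V : Type*} (G : SimpleGraph V) {n : ℕ} (c : ZMod n → V)
    (V₁ : Set V) : Prop where
  cycle_subset : range c ⊆ V₁
  bipartite_left : (G.induce V₁).IsBipartite
  bipartite_right : (G.induce V₁ᶜ).IsBipartite

/-- The vertex set of the connected component of `G[V₁]` that includes `C`. -/
def cycleComponent {V : Type*} (G : SimpleGraph V) {n : ℕ} (c : ZMod n → V) (V₁ : Set V) : Set V :=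
  {v | ∃ p : G.Walk (c 0) v, ∀ x ∈ p.support, x ∈ V₁}

/-- `C` is the only cycle of `G[S]`. -/
def OnlyCycle {V : Type*} (G : SimpleGraph V) {n : ℕ} (c : ZMod n → V) (S : Set V) : Prop :=
  ∀ D : G.Subgraph, D.verts ⊆ S → IsCyc D → D = cycleSubgraph G c

/-- `D` is an even cycle of `G[S]` other than `C`. -/
def IsOtherEvenCyc {V : Type*} (G : SimpleGraph V) {n : ℕ} (c : ZMod n → V) (S : Set V)
    (D : G.Subgraph) : Prop :=
  IsEvenCycIn S D ∧ D ≠ cycleSubgraph G c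

/-- `G₂ = G - V₁` contains even cycles, and they are `2`-colorable in `G - G_s`, where `G_s` is the
component of `G₁` that includes `C`. -/
def RightCycles {V : Type*} (G : SimpleGraph V) {n : ℕ} (c : ZMod n → V) (V₁ : Set V) : Prop :=
  (∃ D : G.Subgraph, IsEvenCycIn V₁ᶜ D) ∧
    ∀ D : G.Subgraph, IsEvenCycIn V₁ᶜ D → TwoColorableOff G (cycleComponent G c V₁) D.verts

/-- Fence-tree type: `G₁` is a fence whose only cycle is `C`, and `G₂` is a tree. -/
def FenceTree {V : Type*} [Fintype V] {G : SimpleGraph V} (E : PlaneEmbedding G) {n : ℕ}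
    (c : ZMod n → V) : Prop :=
  Opened G c ∧ ∃ V₁ : Set V, IsDecomposition G c V₁ ∧ E.IsFence V₁ ∧ OnlyCycle G c V₁ ∧
    (G.induce V₁ᶜ).IsTree

/-- Fence-cycle type: the component of `G₁` including `C` is a fence whose only cycle is `C`, and
`G₂` contains even cycles, which are `2`-colorable. -/
def FenceCycle {V : Type*} [Fintype V] {G : SimpleGraph V} (E : PlaneEmbedding G) {n : ℕ}
    (c : ZMod n → V) : Prop :=
  Opened G c ∧ ∃ V₁ : Set V, IsDecomposition G c V₁ ∧ E.IsFence (cycleComponent G c V₁) ∧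
    OnlyCycle G c (cycleComponent G c V₁) ∧ RightCycles G c V₁

/-- Scycles-forest type: besides `C`, `G₁` contains other even cycles; each of them is joined by a
path of `G₁` to another one, or is joined to `C` by a path of `G₁` that contains an opened vertex;
`G₂` is a forest. -/
def ScyclesForest {V : Type*} (G : SimpleGraph V) {n : ℕ} (c : ZMod n → V) : Prop :=
  Opened G c ∧ ∃ V₁ : Set V, IsDecomposition G c V₁ ∧
    (∃ D, IsOtherEvenCyc G c V₁ D) ∧
    (∀ D, IsOtherEvenCyc G c V₁ D →
      (∃ D', IsOtherEvenCyc G c V₁ D' ∧ D' ≠ D ∧ ∃ a ∈ D.verts, ∃ b ∈ D'.verts,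
        ∃ p : G.Walk a b, p.IsPath ∧ ∀ x ∈ p.support, x ∈ V₁) ∨
      (∃ a ∈ D.verts, ∃ i, ∃ p : G.Walk a (c i), p.IsPath ∧ (∀ x ∈ p.support, x ∈ V₁) ∧
        ∃ x ∈ p.support, x ∈ openedVertices G c)) ∧
    (G.induce V₁ᶜ).IsAcyclic

/-- Scycles-scycles type: besides `C`, `G₁` contains other even cycles, and `G₂` contains even
cycles, which are `2`-colorable. -/
def ScyclesScycles {V : Type*} (G : SimpleGraph V) {n : ℕ} (c : ZMod n → V) : Prop :=
  Opened G c ∧ ∃ V₁ : Set V, IsDecomposition G c V₁ ∧ (∃ D, IsOtherEvenCyc G c V₁ D) ∧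
    RightCycles G c V₁

/-- `𝒟` is a nonempty family of even cycles of `G₁` other than `C`, each of which has at least two
vertices of `C`, and together they contain all vertices of `C`. -/
def IsIntersectedFamily {V : Type*} (G : SimpleGraph V) {n : ℕ} (c : ZMod n → V) (V₁ : Set V)
    (𝒟 : Set G.Subgraph) : Prop :=
  𝒟.Nonempty ∧ (∀ D ∈ 𝒟, IsOtherEvenCyc G c V₁ D ∧ 2 ≤ (D.verts ∩ range c).ncard) ∧
    ∀ i, ∃ D ∈ 𝒟, c i ∈ D.verts

/-- Intersected cycles-forest type: `G₁` consists of `C` and such a family of even cycles, and `G₂`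
is a forest. -/
def IntersectedForest {V : Type*} (G : SimpleGraph V) {n : ℕ} (c : ZMod n → V) : Prop :=
  (Opened G c ∨ ¬ Chordless G c) ∧ ∃ V₁ : Set V, IsDecomposition G c V₁ ∧
    (∃ 𝒟, IsIntersectedFamily G c V₁ 𝒟 ∧
      (⊤ : G.Subgraph).induce V₁ = cycleSubgraph G c ⊔ sSup 𝒟) ∧
    (G.induce V₁ᶜ).IsAcyclic

/-- Intersected cycles-cycles type: `G₁` contains such a family of even cycles, and `G₂` contains
even cycles, which are `2`-colorable. -/
def IntersectedCycles {V : Type*} (G : SimpleGraph V) {n : ℕ} (c : ZMod n → V) : Prop :=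
  (Opened G c ∨ ¬ Chordless G c) ∧ ∃ V₁ : Set V, IsDecomposition G c V₁ ∧
    (∃ 𝒟, IsIntersectedFamily G c V₁ 𝒟) ∧ RightCycles G c V₁

/-! ### Black-White colorings -/

/-- A partial Black-White coloring: `some true` is black, `some false` is white, and `none` is grey
(no color). -/
abbrev BW (V : Type*) := V → Option Bool

namespace BW

variable {V : Type*}

/-- The set of black (`b = true`) or white (`b = false`) vertices. -/
def cls (f : BW V) (b : Bool) : Set V := {v | f v = some b}

open Classical in
/-- Give the vertex `v` the color `o` (or make it grey). -/
def recolor (f : BW V) (v : V) (o : Option Bool) : BW V := Function.update f v o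

/-- There is an odd cycle of black vertices, or one of white vertices. -/
def Conflict (G : SimpleGraph V) (f : BW V) : Prop := ∃ b, HasOddCycle G (f.cls b)

/-- Giving `v` the color `b` makes an odd cycle appear among the vertices of that color. -/
def Bad (G : SimpleGraph V) (f : BW V) (v : V) (b : Bool) : Prop :=
  HasOddCycle G (insert v (f.cls b))

/-- `v` is a petal-vertex: a grey vertex for which both colors make odd cycles appear. -/
def IsPetalVertex (G : SimpleGraph V) (f : BW V) (v : V) : Prop :=
  f v = none ∧ ∀ b, Bad G f v b

open Classical in
/-- One round of the propagation that computes a fixed-set: the fixed-vertices among the grey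
neighbors of the set `s.2` colored last get the color that remains for them. -/
def propagate (G : SimpleGraph V) (s : BW V × Set V) : BW V × Set V :=
  let D : Set V :=
    {v | s.1 v = none ∧ (∃ d ∈ s.2, G.Adj d v) ∧ ∃ b, Bad G s.1 v b}
  (fun v => if v ∈ D then (if Bad G s.1 v true then some false else some true) else s.1 v, D)

/-- The extension of `f` in which `u` gets the color `b` and the vertices of the fixed-set of `u`
get their colors. (No new fixed-vertex can appear after `|V|` rounds.) -/
def extend (G : SimpleGraph V) (f : BW V) (u : V) (b : Bool) : BW V :=
  ((propagate G)^[Nat.card V] (f.recolor u (some b), {u})).1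

/-- `{u, v}` is a petal-pair: if the grey vertices `u, v` are both colored black, and also if they
are both colored white, an odd cycle including `u` and `v` appears. -/
def IsPetalPair (G : SimpleGraph V) (f : BW V) (u v : V) : Prop :=
  u ≠ v ∧ f u = none ∧ f v = none ∧ ∀ b, ∃ (w : V) (p : G.Walk w w), p.IsCycle ∧ Odd p.length ∧
    (∀ x ∈ p.support, x ∈ insert u (insert v (f.cls b))) ∧ u ∈ p.support ∧ v ∈ p.support

/-- The petal-graph of `f`: its edges are the petal-pairs. -/
def petalGraph (G : SimpleGraph V) (f : BW V) : SimpleGraph V where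
  Adj u v := IsPetalPair G f u v
  symm := ⟨fun u v ⟨h, hu, hv, H⟩ => ⟨h.symm, hv, hu, fun b => by
    obtain ⟨w, p, h1, h2, h3, h4, h5⟩ := H b
    exact ⟨w, p, h1, h2, fun x hx => by rw [insert_comm]; exact h3 x hx, h5, h4⟩⟩⟩
  loopless := ⟨fun _ h => h.1 rfl⟩

/-- `u` is a general petal-vertex: for either color of `u`, the extension of `f` has a unicolor odd
cycle or its petal-graph has an odd cycle. -/
def IsGeneralPetal (G : SimpleGraph V) (f : BW V) (u : V) : Prop :=
  f u = none ∧ ∀ b, Conflict G (extend G f u b) ∨ HasOddCycle (petalGraph G (extend G f u b)) univ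

/-- There are petal-vertices or petal-syndrome, or there is a unicolor odd cycle. -/
def Obstructed (G : SimpleGraph V) (f : BW V) : Prop :=
  (∃ v, IsPetalVertex G f v) ∨ (∃ v, IsGeneralPetal G f v) ∨ Conflict G f

/-- `u` is a restricted-vertex, and `b` is the color that remains for it. -/
def IsRestricted (G : SimpleGraph V) (f : BW V) (u : V) (b : Bool) : Prop :=
  f u = none ∧ ¬ IsGeneralPetal G f u ∧ Conflict G (extend G f u (!b)) ∧
    ¬ Conflict G (extend G f u b)

/-- There is a grey vertex. -/
def HasGrey (f : BW V) : Prop := ∃ v, f v = none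

/-- `v` is a grey vertex with the most neighbors colored black or white. -/
def IsSignCandidate (G : SimpleGraph V) (f : BW V) (v : V) : Prop :=
  f v = none ∧ ∀ u, f u = none →
    {x | G.Adj u x ∧ f x ≠ none}.ncard ≤ {x | G.Adj v x ∧ f x ≠ none}.ncard

/-- `Γ*(S)` for a set `S`: the vertices adjacent to two vertices of opposite parity in the same
component of `G[S]`, that is, to two vertices joined by a walk of odd length in `G[S]`. -/
def starNbr (G : SimpleGraph V) (S : Set V) : Set V :=
  {v | ∃ x y, G.Adj v x ∧ G.Adj v y ∧ ∃ p : G.Walk x y, Odd p.length ∧ ∀ z ∈ p.support, z ∈ S}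

/-- The set `Γ^{k*}(C)` of vertices colored in the step number `k + 1`, together with the set of all
vertices colored in the first `k + 1` steps. -/
def layers (G : SimpleGraph V) {n : ℕ} (c : ZMod n → V) : ℕ → Set V × Set V
  | 0 => (range c, range c)
  | 1 => (gamStar G c, range c ∪ gamStar G c)
  | k + 2 => (starNbr G (layers G c (k + 1)).1 \ (layers G c (k + 1)).2,
      (layers G c (k + 1)).2 ∪ starNbr G (layers G c (k + 1)).1)

open Classical in
/-- The initial coloring: `C`, `Γ^{2*}(C)`, `Γ^{4*}(C)`, … are black and `Γ*(C)`, `Γ^{3*}(C)`, … are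
white; the other vertices are grey. -/
def base (G : SimpleGraph V) {n : ℕ} (c : ZMod n → V) : BW V := fun v =>
  if ∃ k, Even k ∧ v ∈ (layers G c k).1 then some true
  else if ∃ k, Odd k ∧ v ∈ (layers G c k).1 then some false
  else none

/-- The steps of the improved operation after the initial coloring, in their order. -/
inductive Label
  | forceFirst | checkFirst | loopFirst | choose | force | check | loop | halt

/-- A state of the improved operation: the step to be done, the present coloring, and the black
sign-vertices (the latest one first), each with the coloring just before it was colored black. -/
structure State (V : Type*) where
  label : Label
  col : BW V
  signs : List (V × BW V)

/-- The improved operation, step by step. -/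
inductive Step (G : SimpleGraph V) : State V → State V → Prop
  | forceFirst {f s u b} : IsRestricted G f u b →
      Step G ⟨.forceFirst, f, s⟩ ⟨.checkFirst, extend G f u b, s⟩
  | forceFirst_none {f s} : (¬ ∃ u b, IsRestricted G f u b) →
      Step G ⟨.forceFirst, f, s⟩ ⟨.checkFirst, f, s⟩
  | checkFirst_stop {f s} : Obstructed G f → Step G ⟨.checkFirst, f, s⟩ ⟨.halt, f, s⟩
  | checkFirst {f s} : ¬ Obstructed G f → Step G ⟨.checkFirst, f, s⟩ ⟨.loopFirst, f, s⟩
  | loopFirst_back {f s} : (∃ u b, IsRestricted G f u b) →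
      Step G ⟨.loopFirst, f, s⟩ ⟨.forceFirst, f, s⟩
  | loopFirst {f s} : (¬ ∃ u b, IsRestricted G f u b) →
      Step G ⟨.loopFirst, f, s⟩ ⟨.choose, f, s⟩
  | choose_stop {f s} : ¬ HasGrey f → Step G ⟨.choose, f, s⟩ ⟨.halt, f, s⟩
  | choose {f s v} : IsSignCandidate G f v →
      Step G ⟨.choose, f, s⟩ ⟨.force, f.recolor v (some true), (v, f) :: s⟩
  | force {f s u b} : IsRestricted G f u b →
      Step G ⟨.force, f, s⟩ ⟨.check, extend G f u b, s⟩
  | force_none {f s} : (¬ ∃ u b, IsRestricted G f u b) → Step G ⟨.force, f, s⟩ ⟨.check, f, s⟩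
  | check_done {f s} : ¬ HasGrey f → Step G ⟨.check, f, s⟩ ⟨.halt, f, s⟩
  | check_back {f w g s} : HasGrey f → Obstructed G f →
      Step G ⟨.check, f, (w, g) :: s⟩ ⟨.force, g.recolor w (some false), s⟩
  | check_stop {f} : HasGrey f → Obstructed G f → Step G ⟨.check, f, []⟩ ⟨.halt, f, []⟩
  | check {f s} : HasGrey f → ¬ Obstructed G f → Step G ⟨.check, f, s⟩ ⟨.loop, f, s⟩
  | loop_back {f s} : (∃ u b, IsRestricted G f u b) → Step G ⟨.loop, f, s⟩ ⟨.force, f, s⟩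
  | loop {f s} : (¬ ∃ u b, IsRestricted G f u b) → Step G ⟨.loop, f, s⟩ ⟨.choose, f, s⟩

/-- `g` is a possible result of the improved operation of Black-White coloring on `c`. If the
initial coloring has a unicolor odd cycle, a vertex of such a cycle is recolored grey and the
operation stops; if it has no grey vertex, the operation stops; otherwise the steps above are
carried out until they halt. -/
inductive Outcome (G : SimpleGraph V) {n : ℕ} (c : ZMod n → V) : BW V → Prop
  | odd {b : Bool} {v : V} {p : G.Walk v v} : p.IsCycle → Odd p.length →
      (∀ x ∈ p.support, x ∈ (base G c).cls b) → Outcome G c ((base G c).recolor v none)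
  | full : ¬ Conflict G (base G c) → ¬ HasGrey (base G c) → Outcome G c (base G c)
  | run {g : BW V} {s : List (V × BW V)} : ¬ Conflict G (base G c) → HasGrey (base G c) →
      Relation.ReflTransGen (Step G) ⟨.forceFirst, base G c, []⟩ ⟨.halt, g, s⟩ → Outcome G c g

end BW

/-! ### The two sides of a cycle -/

/-- The dart `d` lies on the side of the cycle `c` that is to the left (`b = true`) or to the right
(`b = false`) of `c`. -/
def PlaneEmbedding.OnSide {V : Type*} [Fintype V] {G : SimpleGraph V} (E : PlaneEmbedding G)
    {n : ℕ} (c : ZMod n → V) (b : Bool) (d : G.Dart) : Prop :=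
  ∃ (e : G.Dart) (i : ZMod n), e.toProd = (if b then (c i, c (i + 1)) else (c (i + 1), c i)) ∧
    E.SameFace (cycleSubgraph G c).edgeSet e d

/-- The semi-maximal planar graph on the cycle `c` formed by `c` and one of its sides. -/
def PlaneEmbedding.side {V : Type*} [Fintype V] {G : SimpleGraph V} (E : PlaneEmbedding G)
    {n : ℕ} (c : ZMod n → V) (b : Bool) : G.Subgraph where
  verts := range c ∪ {v | ∃ d : G.Dart, E.OnSide c b d ∧ (d.fst = v ∨ d.snd = v)}
  Adj x y := ∃ d : G.Dart, d.toProd = (x, y) ∧ (E.OnSide c b d ∨ E.OnSide c b d.symm)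
  adj_sub := by
    rintro x y ⟨d, hd, -⟩
    have := d.adj
    rw [hd] at this
    exact this
  edge_vert := by
    rintro x y ⟨d, hd, h | h⟩
    · exact Or.inr ⟨d, h, Or.inl (by rw [hd])⟩
    · exact Or.inr ⟨d.symm, h, Or.inr (by simp [hd])⟩
  symm := ⟨by
    rintro x y ⟨d, hd, h⟩
    exact ⟨d.symm, by simp [hd], by rw [Dart.symm_symm]; exact h.symm⟩⟩

/-- The cycle `c` in its side. -/
def PlaneEmbedding.sideCycle {V : Type*} [Fintype V] {G : SimpleGraph V} (E : PlaneEmbedding G)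
    {n : ℕ} (c : ZMod n → V) (b : Bool) : ZMod n → (E.side c b).verts :=
  fun i => ⟨c i, Or.inl ⟨i, rfl⟩⟩

end

/-! Classification. In a 4-coloring with two colors on C, the vertices of these two colors and the
vertices of the other two induce bipartite graphs. Conversely, two bipartite halves can be colored
from disjoint palettes. So C is 2-colorable exactly when a decomposition exists
(`TwoColorable.exists_isDecomposition`, `IsDecomposition.twoColorable`). Types (4)–(9) contain a
decomposition, hence only the closed types need an argument in the direction from types to
colorings. The hardest of these is the fence: there the pieces enclosed by its even cycles are
colored separately, and their colors are permuted to agree on the fence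
(`ClosedCycleFence.twoColorable`).

In the other direction a decomposition is given. A closed C yields a tree or a fence, according to
whether inner vertices other than the neighbors of C exist. Otherwise the type is read off from
three questions: whether G₂ is a forest, whether C is opened, and whether G₁ has cycles besides C.
The 2-colorability demanded of the cycles of G₂ is automatic. The remaining content is topological:
components of G₁ or G₂ are separated by cycles of the other part (`IsSemiMaximal.exists_isCycle`),
and the neighbors of a chordless C induce a connected graph.

The topology rests on one count: faces minus components minus edges. It never rises when an edge is
added, and Euler's formula makes it equal for the empty subgraph and for G, so it is constant on all
subgraphs (`eulerCount_eq`). This gives the Jordan curve theorem, and a minimality argument then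
shows that any two faces of a plane subgraph are separated by one of its cycles.

Black-White operation. A decomposition is the same as a full black-white coloring without unicolor
odd cycles in which C is black; call it a solution. The initial coloring and every forcing step
assign only colors that each solution extending the present coloring must have, and an obstructed
coloring extends to no solution. The sign-vertices branch over both colors. Therefore the operation
is an exhaustive search, and `Invariant` records that a solution, if one exists, extends the present
coloring or a saved white branch. Termination follows from a potential of powers of 3. Finally,
colorings of the two sides, normalized on C by the parity of the subscript, glue to a coloring of G
(`twoColorable_iff_sides`). -/

noncomputable section

/-! ### Two-colorings and odd cycles -/

/-- `h` is a proper two-coloring of the subgraph induced by `S`. -/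
def ProperOn {V : Type*} (G : SimpleGraph V) (S : Set V) (h : V → Bool) : Prop :=
  ∀ x ∈ S, ∀ y ∈ S, G.Adj x y → h x ≠ h y

theorem ProperOn.mono {V : Type*} {G : SimpleGraph V} {S T : Set V} {h : V → Bool}
    (H : ProperOn G T h) (hST : S ⊆ T) : ProperOn G S h :=
  fun x hx y hy => H x (hST hx) y (hST hy)

theorem bipartite_induce_iff {V : Type*} {G : SimpleGraph V} {S : Set V} :
    (G.induce S).IsBipartite ↔ ∃ h, ProperOn G S h := by
  classical
  constructor
  · rintro ⟨f⟩
    refine ⟨fun v => if hv : v ∈ S then decide (f ⟨v, hv⟩ = 0) else false, ?_⟩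
    intro x hx y hy hxy
    have := f.valid (v := ⟨x, hx⟩) (w := ⟨y, hy⟩) hxy
    simp only [hx, hy, dite_true]
    generalize f ⟨x, hx⟩ = a at *
    generalize f ⟨y, hy⟩ = b at *
    revert a b; decide
  · rintro ⟨h, H⟩
    refine ⟨Coloring.mk (fun v => if h v then (1 : Fin 2) else 0) ?_⟩
    intro x y hxy
    have := H x x.2 y y.2 hxy
    revert this
    cases h x <;> cases h y <;> simp

/-- When an edge is put in front of a path and closes a cycle, that cycle is cut off. It is even, or
else the edge run back and forth, so the parity of the length survives. -/
theorem exists_isPath_even_add {V : Type*} {G : SimpleGraph V} {S : Set V}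
    (hS : ¬ HasOddCycle G S) {u v : V} (p : G.Walk u v) (hp : ∀ x ∈ p.support, x ∈ S) :
    ∃ q : G.Walk u v, q.IsPath ∧ (∀ x ∈ q.support, x ∈ S) ∧ Even (p.length + q.length) := by
  classical
  induction p with
  | nil => exact ⟨.nil, by simp, by simpa using hp, by simp⟩
  | @cons u v w h p ih =>
    obtain ⟨q, hq, hqS, hpq⟩ := ih (fun x hx => hp x (by simp [hx]))
    have huS : u ∈ S := hp u (by simp)
    by_cases hu : u ∈ q.support
    · refine ⟨q.dropUntil u hu, hq.dropUntil hu,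
        fun x hx => hqS x (q.support_dropUntil_subset_support hu hx), ?_⟩
      have hlen : (q.takeUntil u hu).length + (q.dropUntil u hu).length = q.length := by
        rw [← Walk.length_append, Walk.take_spec]
      have hodd : Odd (q.takeUntil u hu).length := by
        by_contra hcon
        rw [Nat.not_odd_iff_even] at hcon
        refine hS ⟨u, .cons h (q.takeUntil u hu), ?_, ?_, ?_⟩
        · rw [Walk.cons_isCycle_iff]
          refine ⟨hq.takeUntil hu, fun he => ?_⟩
          have := (hq.takeUntil hu).length_eq_one_of_mem_edges (Sym2.eq_swap ▸ he)
          rw [this] at hcon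
          exact absurd hcon (by decide)
        · simpa using hcon.add_one
        · intro x hx
          rw [Walk.support_cons, List.mem_cons] at hx
          rcases hx with rfl | hx
          · exact huS
          · exact hqS x (q.support_takeUntil_subset_support hu hx)
      rw [Walk.length_cons]
      rw [Nat.even_iff] at *
      rw [Nat.odd_iff] at hodd
      omega
    · refine ⟨.cons h q, hq.cons hu, ?_, ?_⟩
      · intro x hx
        rw [Walk.support_cons, List.mem_cons] at hx
        rcases hx with rfl | hx
        · exact huS
        · exact hqS x hx
      · rw [Walk.length_cons, Walk.length_cons]
        rw [Nat.even_iff] at *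
        omega

theorem ProperOn.parity {V : Type*} {G : SimpleGraph V} {S : Set V} {h : V → Bool}
    (H : ProperOn G S h) {u v : V} (p : G.Walk u v) (hp : ∀ x ∈ p.support, x ∈ S) :
    h u = h v ↔ Even p.length := by
  induction p with
  | nil => simp
  | @cons u v w e p ih =>
    have h1 := ih (fun x hx => hp x (by simp [hx]))
    have h2 := H u (hp u (by simp)) v (hp v (by simp)) e
    rw [Walk.length_cons, Nat.even_add_one, ← h1]
    revert h2
    cases h u <;> cases h v <;> cases h w <;> simp

/-- A closed walk shortens, with its parity kept, to a path from a vertex to itself, which has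
length 0. So without odd cycles all closed walks are even. -/
theorem not_hasOddCycle_iff {V : Type*} {G : SimpleGraph V} {S : Set V} :
    ¬ HasOddCycle G S ↔ ∃ h, ProperOn G S h := by
  constructor
  · intro hS
    rw [← bipartite_induce_iff]
    refine two_colorable_iff_forall_loop_even.2 fun u w => ?_
    obtain ⟨q, hq, -, hpq⟩ := exists_isPath_even_add hS (w.map (Embedding.induce S).toHom) (by
      intro x hx
      rw [Walk.support_map, List.mem_map] at hx
      obtain ⟨y, -, rfl⟩ := hx
      exact y.2)
    rw [Walk.length_eq_zero_iff.2 (Walk.isPath_iff_nil.1 hq), add_zero] at hpq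
    rwa [Walk.length_map] at hpq
  · rintro ⟨h, H⟩ ⟨v, p, -, hodd, hp⟩
    exact Nat.not_even_iff_odd.2 hodd ((H.parity p hp).1 rfl)

theorem HasOddCycle.mono {V : Type*} {G : SimpleGraph V} {S T : Set V} (h : HasOddCycle G S)
    (hST : S ⊆ T) : HasOddCycle G T := by
  obtain ⟨v, p, h1, h2, h3⟩ := h
  exact ⟨v, p, h1, h2, fun x hx => hST (h3 x hx)⟩

/-! ### Parity along an even cycle -/

theorem odd_val_natCast {m : ℕ} (k : ℕ) : Odd ((k : ZMod (2 * m)).val) ↔ Odd k := by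
  rw [ZMod.val_natCast, Nat.odd_iff, Nat.odd_iff, Nat.mod_mod_of_dvd _ ⟨m, rfl⟩]

theorem ZMod.induction_succ {n : ℕ} [NeZero n] {P : ZMod n → Prop} (h0 : P 0)
    (hs : ∀ i, P i → P (i + 1)) (i : ZMod n) : P i := by
  have : ∀ k : ℕ, P (k : ZMod n) := by
    intro k
    induction k with
    | zero => simpa using h0
    | succ k ih => push_cast; exact hs _ ih
  rw [← ZMod.natCast_zmod_val i]
  exact this _

theorem odd_val_add_one {m : ℕ} [NeZero (2 * m)] (i : ZMod (2 * m)) :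
    Odd ((i + 1).val) ↔ ¬ Odd i.val := by
  have h : i + 1 = ((i.val + 1 : ℕ) : ZMod (2 * m)) := by simp
  rw [h, odd_val_natCast, Nat.odd_add_one]

theorem IsLongCycle.neZero {V : Type*} {G : SimpleGraph V} {n : ℕ} {c : ZMod n → V}
    (hc : IsLongCycle G c) : NeZero n := ⟨by have := hc.four_le; omega⟩

theorem eq_xor_odd {m : ℕ} [NeZero (2 * m)] {h : ZMod (2 * m) → Bool}
    (H : ∀ i, h i ≠ h (i + 1)) (i : ZMod (2 * m)) : h i = xor (h 0) (decide (Odd i.val)) := by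
  refine ZMod.induction_succ (P := fun i => h i = xor (h 0) (decide (Odd i.val))) ?_ ?_ i
  · simp
  · intro i hi
    have := H i
    have hb : h (i + 1) = !(h i) := by
      revert this; cases h i <;> cases h (i + 1) <;> simp
    rw [hb, hi]
    have h2 : decide (Odd (i + 1).val) = !(decide (Odd i.val)) := by
      rw [← decide_not]; exact decide_eq_decide.2 (odd_val_add_one i)
    rw [h2]
    cases h 0 <;> cases decide (Odd i.val) <;> rfl

/-- The colors alternate along C, and the parity of `i.val` alternates also across the wrap-around
because the modulus is even. -/
theorem ProperOn.cycle_eq {V : Type*} {G : SimpleGraph V} {m : ℕ} {c : ZMod (2 * m) → V}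
    (hc : IsLongCycle G c) {S : Set V} (hS : range c ⊆ S) {h : V → Bool} (H : ProperOn G S h)
    (i : ZMod (2 * m)) : h (c i) = xor (h (c 0)) (decide (Odd i.val)) := by
  have := hc.neZero
  exact eq_xor_odd (h := fun i => h (c i))
    (fun i => H _ (hS ⟨i, rfl⟩) _ (hS ⟨i + 1, rfl⟩) (hc.adj i)) i

/-! ### Decompositions and colorings -/

theorem TwoColorable.exists_isDecomposition {V : Type*} {G : SimpleGraph V} {n : ℕ}
    {c : ZMod n → V} (h : TwoColorable G (range c)) : ∃ V₁, IsDecomposition G c V₁ := by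
  obtain ⟨f, hf⟩ := h
  obtain ⟨a, b, hab, hS⟩ := Set.ncard_eq_two.1 hf
  refine ⟨{v | f v = a ∨ f v = b}, ?_, bipartite_induce_iff.2 ⟨fun v => decide (f v = a), ?_⟩, ?_⟩
  · intro v hv
    have : f v ∈ f '' range c := ⟨v, hv, rfl⟩
    rw [hS] at this
    simpa using this
  · intro x hx y hy hxy
    have := f.valid hxy
    simp only [mem_ofPred_eq] at hx hy
    rcases hx with hx | hx <;> rcases hy with hy | hy <;> simp_all [hab.symm]
  -- Here `p` is one of the two colors not used on C; testing for it two-colors the complement.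
  · have key : ∀ a b : Fin 4, a ≠ b → ∃ p : Fin 4, ∀ x y : Fin 4, ¬ (x = a ∨ x = b) →
        ¬ (y = a ∨ y = b) → x ≠ y → decide (x = p) ≠ decide (y = p) := by decide
    obtain ⟨p, hp⟩ := key a b hab
    exact bipartite_induce_iff.2 ⟨fun v => decide (f v = p), fun x hx y hy hxy =>
      hp _ _ hx hy (f.valid hxy)⟩

/-- The two halves use the palettes {0, 1} and {2, 3}. Taking xor with the color of `c 0` normalizes
the first palette, so that C is colored by parity; this is what later allows two sides to be glued.
-/
theorem IsDecomposition.exists_coloring {V : Type*} {G : SimpleGraph V} {m : ℕ}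
    {c : ZMod (2 * m) → V} (hc : IsLongCycle G c) {V₁ : Set V} (h : IsDecomposition G c V₁) :
    ∃ f : G.Coloring (Fin 4), (∀ i, f (c i) = if Odd i.val then 1 else 0) ∧
      (∀ v ∉ V₁, f v = 2 ∨ f v = 3) := by
  classical
  obtain ⟨h₁, H₁⟩ := bipartite_induce_iff.1 h.bipartite_left
  obtain ⟨h₂, H₂⟩ := bipartite_induce_iff.1 h.bipartite_right
  refine ⟨Coloring.mk (fun v => if v ∈ V₁ then (if xor (h₁ (c 0)) (h₁ v) then 1 else 0)
    else (if h₂ v then 3 else 2)) ?_, ?_, ?_⟩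
  · intro x y hxy
    by_cases hx : x ∈ V₁ <;> by_cases hy : y ∈ V₁
    · have := H₁ x hx y hy hxy
      revert this
      simp only [hx, hy, if_true]
      cases h₁ x <;> cases h₁ y <;> cases h₁ (c 0) <;> simp
    · simp only [hx, hy, if_true, if_false]
      split_ifs <;> decide
    · simp only [hx, hy, if_true, if_false]
      split_ifs <;> decide
    · have := H₂ x hx y hy hxy
      revert this
      simp only [hx, hy, if_false]
      cases h₂ x <;> cases h₂ y <;> simp
  · intro i
    have hi : c i ∈ V₁ := h.cycle_subset ⟨i, rfl⟩
    change (if c i ∈ V₁ then _ else _) = _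
    rw [if_pos hi, H₁.cycle_eq hc h.cycle_subset i]
    cases h₁ (c 0) <;> by_cases ho : Odd i.val <;> simp [ho]
  · intro v hv
    change (if v ∈ V₁ then _ else _) = _ ∨ (if v ∈ V₁ then _ else _) = _
    rw [if_neg hv]
    cases h₂ v <;> simp

theorem ncard_image_eq_two {V : Type*} {f : V → Fin 4} {S : Set V} {a b : Fin 4} (hab : a ≠ b)
    (hS : ∀ v ∈ S, f v = a ∨ f v = b) {x y : V} (hx : x ∈ S) (hy : y ∈ S) (hxy : f x ≠ f y) :
    (f '' S).ncard = 2 := by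
  refine Set.ncard_eq_two.2 ⟨a, b, hab, Subset.antisymm ?_ ?_⟩
  · rintro _ ⟨v, hv, rfl⟩
    exact hS v hv
  · have h1 := hS x hx
    have h2 := hS y hy
    rintro z (rfl | rfl)
    · rcases h1 with h1 | h1
      · exact ⟨x, hx, h1⟩
      · exact ⟨y, hy, h2.resolve_right fun h => hxy (h1.trans h.symm)⟩
    · rcases h1 with h1 | h1
      · exact ⟨y, hy, h2.resolve_left fun h => hxy (h1.trans h.symm)⟩
      · exact ⟨x, hx, h1⟩

theorem twoColorable_of_coloring {V : Type*} {G : SimpleGraph V} {n : ℕ} {c : ZMod n → V}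
    (hc : IsLongCycle G c) {a b : Fin 4} (hab : a ≠ b) (f : G.Coloring (Fin 4))
    (hf : ∀ i, f (c i) = a ∨ f (c i) = b) : TwoColorable G (range c) := by
  refine ⟨f, ncard_image_eq_two hab ?_ (mem_range_self 0) (mem_range_self (0 + 1))
    (f.valid (hc.adj 0))⟩
  rintro _ ⟨i, rfl⟩
  exact hf i

theorem IsDecomposition.twoColorable {V : Type*} {G : SimpleGraph V} {m : ℕ}
    {c : ZMod (2 * m) → V} (hc : IsLongCycle G c) {V₁ : Set V} (h : IsDecomposition G c V₁) :
    TwoColorable G (range c) := by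
  obtain ⟨f, hf, -⟩ := h.exists_coloring hc
  refine twoColorable_of_coloring hc (a := 1) (b := 0) (by decide) f fun i => ?_
  rw [hf]
  split_ifs <;> simp

theorem IsDecomposition.twoColorableOff {V : Type*} {G : SimpleGraph V} {m : ℕ}
    {c : ZMod (2 * m) → V} (hc : IsLongCycle G c) {V₁ : Set V} (h : IsDecomposition G c V₁)
    {X S : Set V} (hX : X ⊆ V₁) (hS : S ⊆ V₁ᶜ) {x y : V} (hx : x ∈ S) (hy : y ∈ S)
    (hxy : G.Adj x y) : TwoColorableOff G X S := by
  obtain ⟨f, -, hf⟩ := h.exists_coloring hc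
  refine ⟨f.comp (Embedding.induce _).toHom, ?_⟩
  have hx' : x ∈ Xᶜ := fun h => hS hx (hX h)
  have hy' : y ∈ Xᶜ := fun h => hS hy (hX h)
  exact ncard_image_eq_two (a := 2) (b := 3) (by decide) (fun v hv => hf v (hS hv))
    (x := ⟨x, hx'⟩) (y := ⟨y, hy'⟩) hx hy (f.valid hxy)

theorem twoColorable_iff_exists_coloring {V : Type*} {G : SimpleGraph V} {m : ℕ}
    {c : ZMod (2 * m) → V} (hc : IsLongCycle G c) : TwoColorable G (range c) ↔
      ∃ f : G.Coloring (Fin 4), ∀ i, f (c i) = if Odd i.val then 1 else 0 := by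
  constructor
  · intro h
    obtain ⟨V₁, h⟩ := h.exists_isDecomposition
    obtain ⟨f, hf, -⟩ := h.exists_coloring hc
    exact ⟨f, hf⟩
  · rintro ⟨f, hf⟩
    refine twoColorable_of_coloring hc (a := 1) (b := 0) (by decide) f fun i => ?_
    rw [hf]
    split_ifs <;> simp

/-- C carries both colors of the bipartition of `G[V₁]`, one per parity, so neither is left for a
vertex adjacent to both parities. -/
theorem IsDecomposition.gamStar_subset {V : Type*} {G : SimpleGraph V} {m : ℕ}
    {c : ZMod (2 * m) → V} (hc : IsLongCycle G c) {V₁ : Set V} (h : IsDecomposition G c V₁) :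
    gamStar G c ⊆ V₁ᶜ := by
  rintro v ⟨-, ⟨i, hi, hvi⟩, ⟨j, hj, hvj⟩⟩ hv
  obtain ⟨k, H⟩ := bipartite_induce_iff.1 h.bipartite_left
  have h1 := H v hv _ (h.cycle_subset ⟨i, rfl⟩) hvi
  have h2 := H v hv _ (h.cycle_subset ⟨j, rfl⟩) hvj
  rw [H.cycle_eq hc h.cycle_subset] at h1 h2
  rw [decide_eq_true hi] at h1
  rw [decide_eq_false (Nat.not_odd_iff_even.2 hj)] at h2
  revert h1 h2
  cases k v <;> cases k (c 0) <;> simp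

/-! ### Faces of plane subgraphs -/

/-- The edge set of a walk. -/
def SimpleGraph.Walk.edgesSet {V : Type*} {G : SimpleGraph V} {u v : V} (p : G.Walk u v) :
    Set (Sym2 V) := {e | e ∈ p.edges}

theorem SimpleGraph.Walk.edgesSet_subset {V : Type*} {G : SimpleGraph V} {u v : V}
    (p : G.Walk u v) : p.edgesSet ⊆ G.edgeSet :=
  fun _ he => p.edges_subset_edgeSet he

theorem SimpleGraph.exists_dart_of_mem {V : Type*} {G : SimpleGraph V} {e : Sym2 V}
    (he : e ∈ G.edgeSet) : ∃ d : G.Dart, d.edge = e := by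
  induction e with
  | h u v => exact ⟨⟨(u, v), he⟩, rfl⟩

instance {V : Type*} [Finite V] {G : SimpleGraph V} : Finite G.Dart :=
  Finite.of_injective (fun d : G.Dart => d.toProd) (fun a b h => Dart.ext a b h)

namespace PlaneEmbedding

variable {V : Type*} [Fintype V] {G : SimpleGraph V} (E : PlaneEmbedding G)

theorem sameFace_equivalence (K : Set (Sym2 V)) : Equivalence (E.SameFace K) :=
  Relation.EqvGen.is_equivalence _

variable {E} {K K' : Set (Sym2 V)} {x y z : G.Dart}

@[refl] theorem SameFace.refl (K : Set (Sym2 V)) (x : G.Dart) : E.SameFace K x x :=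
  (E.sameFace_equivalence K).refl x

theorem SameFace.symm (h : E.SameFace K x y) : E.SameFace K y x :=
  (E.sameFace_equivalence K).symm h

theorem SameFace.trans (h : E.SameFace K x y) (h' : E.SameFace K y z) : E.SameFace K x z :=
  (E.sameFace_equivalence K).trans h h'

variable (E) in
theorem sameFace_next (K : Set (Sym2 V)) (x : G.Dart) : E.SameFace K x (E.next x) :=
  Relation.EqvGen.rel _ _ (Or.inl rfl)

variable (E) in
theorem sameFace_symm_of_notMem (h : x.edge ∉ K) : E.SameFace K x x.symm :=
  Relation.EqvGen.rel _ _ (Or.inr ⟨rfl, h⟩)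

/-- `E.SameFace K` is the smallest equivalence relation that contains the generating pairs. -/
theorem SameFace.le_of {r : G.Dart → G.Dart → Prop} (hr : Equivalence r)
    (h1 : ∀ x, r x (E.next x)) (h2 : ∀ x, x.edge ∉ K → r x x.symm) (h : E.SameFace K x y) :
    r x y := by
  induction h with
  | rel a b hab =>
    rcases hab with rfl | ⟨rfl, hb⟩
    · exact h1 a
    · exact h2 a hb
  | refl a => exact hr.refl a
  | symm a b _ ih => exact hr.symm ih
  | trans a b c _ _ ih1 ih2 => exact hr.trans ih1 ih2

theorem SameFace.iff_of {P : G.Dart → Prop} (h1 : ∀ x, P x ↔ P (E.next x))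
    (h2 : ∀ x, x.edge ∉ K → (P x ↔ P x.symm)) (h : E.SameFace K x y) : P x ↔ P y :=
  h.le_of (r := fun a b => P a ↔ P b) ⟨fun _ => Iff.rfl, Iff.symm, Iff.trans⟩ h1 h2

theorem SameFace.mono (hK : ∀ x : G.Dart, x.edge ∈ K → x.edge ∈ K') (h : E.SameFace K' x y) :
    E.SameFace K x y :=
  h.le_of (E.sameFace_equivalence K) (E.sameFace_next K)
    fun x hx => E.sameFace_symm_of_notMem fun h => hx (hK x h)

theorem SameFace.of_subset (hK : K ⊆ K') (h : E.SameFace K' x y) : E.SameFace K x y :=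
  h.mono fun _ hx => hK hx

/-- Removing an edge from `K` merges the faces on its two sides and nothing else. -/
theorem SameFace.of_diff {d : G.Dart} (h : E.SameFace (K \ {d.edge}) x y) : E.SameFace K x y ∨
    (E.SameFace K x d ∧ E.SameFace K d.symm y) ∨ (E.SameFace K x d.symm ∧ E.SameFace K d y) := by
  refine h.le_of (r := fun x y => E.SameFace K x y ∨
    (E.SameFace K x d ∧ E.SameFace K d.symm y) ∨ (E.SameFace K x d.symm ∧ E.SameFace K d y))
    ⟨fun a => Or.inl (SameFace.refl K a), ?_, ?_⟩ (fun a => Or.inl (E.sameFace_next K a)) ?_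
  · rintro a b (h | ⟨h, h'⟩ | ⟨h, h'⟩)
    · exact Or.inl h.symm
    · exact Or.inr (Or.inr ⟨h'.symm, h.symm⟩)
    · exact Or.inr (Or.inl ⟨h'.symm, h.symm⟩)
  · rintro a b c (h | ⟨h, h'⟩ | ⟨h, h'⟩) (k | ⟨k, k'⟩ | ⟨k, k'⟩)
    · exact Or.inl (h.trans k)
    · exact Or.inr (Or.inl ⟨h.trans k, k'⟩)
    · exact Or.inr (Or.inr ⟨h.trans k, k'⟩)
    · exact Or.inr (Or.inl ⟨h, h'.trans k⟩)
    · exact Or.inr (Or.inl ⟨h, k'⟩)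
    · exact Or.inl (h.trans k')
    · exact Or.inr (Or.inr ⟨h, h'.trans k⟩)
    · exact Or.inl (h.trans k')
    · exact Or.inr (Or.inr ⟨h, k'⟩)
  · intro a ha
    by_cases hK : a.edge ∈ K
    · have : a.edge = d.edge := by
        by_contra hne
        exact ha ⟨hK, hne⟩
      rcases dart_edge_eq_iff a d |>.1 this with rfl | rfl
      · exact Or.inr (Or.inl ⟨SameFace.refl K a, SameFace.refl K _⟩)
      · exact Or.inr (Or.inr ⟨SameFace.refl K _, by rw [Dart.symm_symm]⟩)
    · exact Or.inl (E.sameFace_symm_of_notMem hK)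

theorem SameFace.of_diff_of_symm {d : G.Dart} (hd : E.SameFace K d d.symm)
    (h : E.SameFace (K \ {d.edge}) x y) : E.SameFace K x y := by
  rcases h.of_diff with h | ⟨h, h'⟩ | ⟨h, h'⟩
  · exact h
  · exact (h.trans hd).trans h'
  · exact (h.trans hd.symm).trans h'

/-- The rotation at a vertex. -/
def rot (E : PlaneEmbedding G) : Equiv.Perm G.Dart :=
  (Equiv.mk Dart.symm Dart.symm Dart.symm_symm Dart.symm_symm).trans E.next

theorem rot_apply (x : G.Dart) : E.rot x = E.next x.symm := rfl

theorem rot_fst (x : G.Dart) : (E.rot x).fst = x.fst := by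
  rw [rot_apply, E.next_fst]; rfl

theorem exists_rot_iterate (h : x.fst = y.fst) : ∃ k : ℕ, (⇑E.rot)^[k] x = y := by
  classical
  obtain ⟨k, hk⟩ := (E.rotation_transitive x y h).exists_nat_pow_eq
  exact ⟨k, by rw [← hk, Equiv.Perm.iterate_eq_pow]; rfl⟩

/-- A property of darts that the rotation preserves holds at all darts leaving a vertex if it holds
at one of them. -/
theorem rot_induction {P : G.Dart → Prop} (h : x.fst = y.fst)
    (hP : ∀ z : G.Dart, z.fst = x.fst → P z → P (E.rot z)) (hx : P x) : P y := by
  obtain ⟨k, rfl⟩ := E.exists_rot_iterate h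
  have : ∀ k : ℕ, ((⇑E.rot)^[k] x).fst = x.fst ∧ P ((⇑E.rot)^[k] x) := by
    intro k
    induction k with
    | zero => exact ⟨rfl, hx⟩
    | succ k ih =>
      rw [Function.iterate_succ_apply']
      exact ⟨(rot_fst _).trans ih.1, hP _ ih.1 ih.2⟩
  exact (this k).2

/-- All darts leaving a vertex that is on no edge of `K` are on the same face. -/
theorem sameFace_of_fst_eq (h : x.fst = y.fst) (hx : ∀ e ∈ K, x.fst ∉ e) : E.SameFace K x y := by
  refine E.rot_induction (P := fun z => E.SameFace K x z) h ?_ (SameFace.refl K x)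
  intro z hz hxz
  have : z.edge ∉ K := fun hK => hx _ hK (by rw [← hz]; exact Sym2.mem_mk_left _ _)
  exact (hxz.trans (E.sameFace_symm_of_notMem this)).trans (E.sameFace_next K _)

/-- This is where connectedness of G enters: the rotation moves between darts at a vertex, and
reversal moves along a walk. -/
theorem sameFace_empty (x y : G.Dart) : E.SameFace ∅ x y := by
  have key : ∀ (u v : V) (p : G.Walk u v) (x y : G.Dart), x.fst = u → y.fst = v →
      E.SameFace ∅ x y := by
    intro u v p
    induction p with
    | nil => exact fun x y hx hy => sameFace_of_fst_eq (hx.trans hy.symm) (by simp)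
    | @cons u v w h p ih =>
      intro x y hx hy
      refine (sameFace_of_fst_eq (y := ⟨(u, v), h⟩) hx (by simp)).trans
        (.trans ?_ (ih (Dart.symm ⟨(u, v), h⟩) y rfl hy))
      exact E.sameFace_symm_of_notMem (by simp)
  exact key _ _ (E.connected.preconnected x.fst y.fst).some x y rfl rfl

open Classical in
/-- The permutation of the darts that walks along the faces of the plane subgraph with edge set
`K`, skipping the other edges one at a time. -/
def walkPerm (E : PlaneEmbedding G) (K : Set (Sym2 V)) : Equiv.Perm G.Dart :=
  (Function.Involutive.toPerm (fun x : G.Dart => if x.edge ∈ K then x else x.symm) (by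
    intro x
    by_cases h : x.edge ∈ K <;> simp [h])).trans E.next

theorem walkPerm_of_mem (h : x.edge ∈ K) : E.walkPerm K x = E.next x := by
  classical
  change E.next (ite _ _ _) = _
  rw [if_pos h]

theorem walkPerm_of_notMem (h : x.edge ∉ K) : E.walkPerm K x = E.rot x := by
  classical
  change E.next (ite _ _ _) = _
  rw [if_neg h, rot_apply]

theorem sameFace_walkPerm (K : Set (Sym2 V)) (x : G.Dart) : E.SameFace K x (E.walkPerm K x) := by
  by_cases h : x.edge ∈ K
  · rw [walkPerm_of_mem h]; exact E.sameFace_next K x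
  · rw [walkPerm_of_notMem h]
    exact (E.sameFace_symm_of_notMem h).trans (E.sameFace_next K _)

theorem sameFace_walkPerm_iterate (K : Set (Sym2 V)) (x : G.Dart) (k : ℕ) :
    E.SameFace K x ((⇑(E.walkPerm K))^[k] x) := by
  induction k with
  | zero => exact SameFace.refl K x
  | succ k ih =>
    rw [Function.iterate_succ_apply']
    exact ih.trans (sameFace_walkPerm K _)

theorem exists_walkPerm_iterate_eq (K : Set (Sym2 V)) (x : G.Dart) :
    ∃ k, (⇑(E.walkPerm K))^[k + 1] x = x := by
  have h := orderOf_pos (E.walkPerm K)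
  refine ⟨orderOf (E.walkPerm K) - 1, ?_⟩
  rw [Nat.sub_add_cancel h, Equiv.Perm.iterate_eq_pow, pow_orderOf_eq_one]
  rfl

/-- If `d` is the only dart of `K` that leaves `X`, then `d` has the same face on both sides. -/
theorem sameFace_symm_of_cut {X : Set V} {d : G.Dart} (hd : d.snd ∉ X) (hd' : d.fst ∈ X)
    (H : ∀ z : G.Dart, z.edge ∈ K → z.fst ∈ X → z.snd ∉ X → z = d) :
    E.SameFace K d d.symm := by
  by_cases hdK : d.edge ∈ K
  swap
  · exact E.sameFace_symm_of_notMem hdK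
  by_contra hcon
  -- The face walk from `d.symm` enters X at once and could leave it only along `d`, which is
  -- assumed to be on another face. But the walk is periodic and must return to its start outside X.
  have key : ∀ k, ((⇑(E.walkPerm K))^[k + 1] d.symm).fst ∈ X := by
    intro k
    induction k with
    | zero =>
      rw [zero_add, Function.iterate_one, walkPerm_of_mem (by rwa [Dart.edge_symm]), E.next_fst]
      exact hd'
    | succ k ih =>
      rw [Function.iterate_succ_apply']
      have hsf := sameFace_walkPerm_iterate (E := E) K d.symm (k + 1)
      generalize (⇑(E.walkPerm K))^[k + 1] d.symm = z at ih hsf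
      by_cases hz : z.edge ∈ K
      · rw [walkPerm_of_mem hz, E.next_fst]
        by_contra hX
        obtain rfl := H z hz ih hX
        exact hcon hsf.symm
      · rwa [walkPerm_of_notMem hz, rot_fst]
  obtain ⟨k, hk⟩ := exists_walkPerm_iterate_eq (E := E) K d.symm
  exact hd (by simpa [hk] using key k)

/-- Along the boundary of a face, every vertex is entered as often as it is left. -/
theorem sum_face_eq_zero (K : Set (Sym2 V)) (d : G.Dart) (g : V → ℤ) [Fintype G.Dart]
    [DecidablePred fun x : G.Dart => E.SameFace K d x ∧ x.edge ∈ K] :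
    ∑ x with E.SameFace K d x ∧ x.edge ∈ K, (g x.snd - g x.fst) = 0 := by
  classical
  -- `walkPerm` permutes the darts of the face, so the sum telescopes; darts off K are rotated about
  -- their origin and contribute nothing.
  have h1 : ∑ x : G.Dart with E.SameFace K d x, (g (E.walkPerm K x).fst - g x.fst) = 0 := by
    rw [Finset.sum_sub_distrib, sub_eq_zero]
    refine Finset.sum_bij (fun x _ => E.walkPerm K x) ?_ ?_ ?_ ?_
    · intro x hx
      simp only [Finset.mem_filter, Finset.mem_univ, true_and] at hx ⊢
      exact hx.trans (sameFace_walkPerm K x)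
    · intro a _ b _ h
      exact (E.walkPerm K).injective h
    · intro b hb
      refine ⟨(E.walkPerm K).symm b, ?_, by simp⟩
      simp only [Finset.mem_filter, Finset.mem_univ, true_and] at hb ⊢
      refine hb.trans (SameFace.symm ?_)
      simpa using sameFace_walkPerm (E := E) K ((E.walkPerm K).symm b)
    · intro x _
      rfl
  rw [← h1, Finset.sum_filter, Finset.sum_filter]
  refine Finset.sum_congr rfl fun x _ => ?_
  by_cases h : x.edge ∈ K
  · simp only [h, and_true]
    rw [walkPerm_of_mem h, E.next_fst]
  · rw [if_neg fun h' => h h'.2, walkPerm_of_notMem h, rot_fst, sub_self, ite_self]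

end PlaneEmbedding

/-! ### Euler's formula and the Jordan curve theorem -/

theorem insert_sdiff_singleton_of_notMem {α : Type*} {K : Set α} {a : α} (ha : a ∉ K) :
    insert a K \ {a} = K := by
  ext e
  simp only [mem_sdiff, mem_insert_iff, mem_singleton_iff]
  constructor
  · rintro ⟨rfl | h, h'⟩
    exacts [absurd rfl h', h]
  · exact fun h => ⟨Or.inr h, fun h' => ha (h' ▸ h)⟩

theorem card_quotient_le_of_le {α : Type*} [Finite α] {s t : Setoid α} (h : s ≤ t) :
    Nat.card (Quotient t) ≤ Nat.card (Quotient s) := by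
  refine Nat.card_le_card_of_surjective (Quotient.map' id h) ?_
  rintro ⟨x⟩
  exact ⟨Quotient.mk s x, rfl⟩

/-- Discard the class of `b`: among the other classes no merging is possible, so their
representatives inject into the coarser quotient. -/
theorem card_quotient_le_add_one {α : Type*} [Finite α] {s t : Setoid α} {a b : α}
    (h : ∀ x y, t x y → s x y ∨ (s x a ∧ s b y) ∨ (s x b ∧ s a y)) :
    Nat.card (Quotient s) ≤ Nat.card (Quotient t) + 1 := by
  classical
  have := Fintype.ofFinite (Quotient s)
  have := Fintype.ofFinite (Quotient t)
  have hcard : Nat.card {q : Quotient s // q ≠ Quotient.mk s b} ≤ Nat.card (Quotient t) := by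
    refine Nat.card_le_card_of_injective (fun q => Quotient.mk t q.1.out) ?_
    rintro ⟨q, hq⟩ ⟨r, hr⟩ hqr
    have hqb : ¬ s q.out b := fun h => hq (by rw [← Quotient.out_eq q]; exact Quotient.sound h)
    have hrb : ¬ s r.out b := fun h => hr (by rw [← Quotient.out_eq r]; exact Quotient.sound h)
    have := h _ _ (Quotient.exact hqr)
    rcases this with h | ⟨-, h⟩ | ⟨h, -⟩
    · rw [Subtype.mk.injEq, ← Quotient.out_eq q, ← Quotient.out_eq r]
      exact Quotient.sound h
    · exact absurd (s.symm h) hrb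
    · exact absurd h hqb
  rw [Nat.card_eq_fintype_card, Nat.card_eq_fintype_card,
    Fintype.card_subtype_compl, Fintype.card_subtype_eq] at hcard
  rw [Nat.card_eq_fintype_card, Nat.card_eq_fintype_card]
  omega

theorem reachable_fromEdgeSet_insert {V : Type*} {K : Set (Sym2 V)} {u v x y : V}
    (h : (fromEdgeSet (insert s(u, v) K)).Reachable x y) :
    (fromEdgeSet K).Reachable x y ∨
      ((fromEdgeSet K).Reachable x u ∧ (fromEdgeSet K).Reachable v y) ∨
      ((fromEdgeSet K).Reachable x v ∧ (fromEdgeSet K).Reachable u y) := by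
  obtain ⟨p⟩ := h
  induction p with
  | nil => exact Or.inl (Reachable.refl _)
  | @cons a b w e p ih =>
    rw [fromEdgeSet_adj] at e
    obtain ⟨e, hne⟩ := e
    rcases e with e | e
    · rcases Sym2.eq_iff.1 e with ⟨rfl, rfl⟩ | ⟨rfl, rfl⟩
      · rcases ih with h | ⟨-, h⟩ | ⟨-, h⟩
        · exact Or.inr (Or.inl ⟨Reachable.refl _, h⟩)
        · exact Or.inr (Or.inl ⟨Reachable.refl _, h⟩)
        · exact Or.inl h
      · rcases ih with h | ⟨-, h⟩ | ⟨-, h⟩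
        · exact Or.inr (Or.inr ⟨Reachable.refl _, h⟩)
        · exact Or.inl h
        · exact Or.inr (Or.inr ⟨Reachable.refl _, h⟩)
    · have hab : (fromEdgeSet K).Reachable a b := Adj.reachable (by simp [e, hne])
      rcases ih with h | ⟨h, h'⟩ | ⟨h, h'⟩
      · exact Or.inl (hab.trans h)
      · exact Or.inr (Or.inl ⟨hab.trans h, h'⟩)
      · exact Or.inr (Or.inr ⟨hab.trans h, h'⟩)

namespace PlaneEmbedding

variable {V : Type*} [Fintype V] {G : SimpleGraph V} (E : PlaneEmbedding G)

/-- The equivalence relation on the darts whose classes are the faces of a plane subgraph. -/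
def faceSetoid (K : Set (Sym2 V)) : Setoid G.Dart := ⟨E.SameFace K, E.sameFace_equivalence K⟩

/-- The number of faces minus the number of components minus the number of edges. -/
def eulerCount (K : Set (Sym2 V)) : ℤ :=
  (Nat.card (Quotient (E.faceSetoid K)) : ℤ) -
    Nat.card (Quotient (fromEdgeSet K).reachableSetoid) - K.ncard

variable {E} {K K' : Set (Sym2 V)}

/-- A new edge inside a component keeps the components and adds at most one face. A new edge between
components loses at most one component and adds no face, since it is a cut and has the same face on
both sides. -/
theorem eulerCount_insert_le {d : G.Dart} (hd : d.edge ∉ K) :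
    E.eulerCount (insert d.edge K) ≤ E.eulerCount K := by
  have hcard : (insert d.edge K).ncard = K.ncard + 1 := ncard_insert_of_notMem hd (Set.toFinite K)
  have hdiff : insert d.edge K \ {d.edge} = K := insert_sdiff_singleton_of_notMem hd
  have hedge : d.edge = s(d.fst, d.snd) := rfl
  unfold eulerCount
  rw [hcard]
  by_cases hr : (fromEdgeSet K).Reachable d.fst d.snd
  · have h1 : Nat.card (Quotient (fromEdgeSet K).reachableSetoid) ≤
        Nat.card (Quotient (fromEdgeSet (insert d.edge K)).reachableSetoid) := by
      refine card_quotient_le_of_le fun x y h => ?_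
      rcases reachable_fromEdgeSet_insert h with h | ⟨h, h'⟩ | ⟨h, h'⟩
      · exact h
      · exact (h.trans hr).trans h'
      · exact (h.trans hr.symm).trans h'
    have h2 : Nat.card (Quotient (E.faceSetoid (insert d.edge K))) ≤
        Nat.card (Quotient (E.faceSetoid K)) + 1 := by
      refine card_quotient_le_add_one (a := d) (b := d.symm) fun x y h => ?_
      exact SameFace.of_diff (by rw [hdiff]; exact h)
    push_cast
    omega
  · have h1 : Nat.card (Quotient (fromEdgeSet K).reachableSetoid) ≤
        Nat.card (Quotient (fromEdgeSet (insert d.edge K)).reachableSetoid) + 1 :=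
      card_quotient_le_add_one (a := d.fst) (b := d.snd) fun x y h =>
        reachable_fromEdgeSet_insert h
    have h2 : Nat.card (Quotient (E.faceSetoid (insert d.edge K))) ≤
        Nat.card (Quotient (E.faceSetoid K)) := by
      refine card_quotient_le_of_le fun x y h => ?_
      refine SameFace.of_diff_of_symm (d := d) ?_ (by rw [hdiff]; exact h)
      refine sameFace_symm_of_cut (X := {w | (fromEdgeSet K).Reachable d.fst w}) hr
        (Reachable.refl _) ?_
      intro z hz hz1 hz2
      rcases hz with hz | hz
      · rcases (dart_edge_eq_iff z d).1 hz with rfl | rfl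
        · rfl
        · exact absurd hz1 hr
      · refine absurd (Reachable.trans hz1 (Adj.reachable ?_)) hz2
        rw [fromEdgeSet_adj]
        exact ⟨hz, z.fst_ne_snd⟩
    push_cast
    omega

theorem eulerCount_anti (h : K ⊆ K') (hK' : K' ⊆ G.edgeSet) : E.eulerCount K' ≤ E.eulerCount K := by
  have key : ∀ T : Set (Sym2 V), T ⊆ G.edgeSet → E.eulerCount (K ∪ T) ≤ E.eulerCount K := by
    intro T hT
    induction T, Set.toFinite T using Set.Finite.induction_on with
    | empty => simp
    | @insert e T _ _ ih =>
      have ih := ih ((subset_insert _ _).trans hT)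
      obtain ⟨d, rfl⟩ := exists_dart_of_mem (hT (mem_insert _ _))
      rw [union_insert]
      by_cases hd : d.edge ∈ K ∪ T
      · rwa [insert_eq_of_mem hd]
      · exact (eulerCount_insert_le hd).trans ih
  have := key K' hK'
  rwa [union_eq_right.2 h] at this

/-- The antitone count is squeezed between its values at the empty set and at all edges, which agree
by Euler's formula. Faces are classes of darts, hence the need for a dart in order that the empty
subgraph have one face. -/
theorem eulerCount_eq (hne : Nonempty G.Dart) (hK : K ⊆ G.edgeSet) :
    E.eulerCount K = 1 - Nat.card V := by
  have h0 : E.eulerCount ∅ = 1 - Nat.card V := by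
    unfold eulerCount
    have h1 : Nat.card (Quotient (E.faceSetoid ∅)) = 1 := by
      rw [Nat.card_eq_one_iff_unique]
      refine ⟨⟨?_⟩, ⟨Quotient.mk _ hne.some⟩⟩
      rintro ⟨x⟩ ⟨y⟩
      exact Quotient.sound (sameFace_empty x y)
    have h2 : Nat.card (Quotient (fromEdgeSet (∅ : Set (Sym2 V))).reachableSetoid) =
        Nat.card V := by
      symm
      refine Nat.card_congr (Equiv.ofBijective (fun v => Quotient.mk _ v) ⟨?_, ?_⟩)
      · intro a b h
        have : (fromEdgeSet (∅ : Set (Sym2 V))).Reachable a b := Quotient.exact h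
        simpa using this
      · rintro ⟨x⟩
        exact ⟨x, rfl⟩
    rw [h1, h2]
    simp
  have hE : E.eulerCount G.edgeSet = 1 - Nat.card V := by
    unfold eulerCount
    have h1 : Nat.card (Quotient (E.faceSetoid G.edgeSet)) =
        Nat.card (Quotient (Equiv.Perm.SameCycle.setoid E.next)) := by
      refine le_antisymm (card_quotient_le_of_le ?_) (card_quotient_le_of_le ?_)
      · intro x y h
        obtain ⟨k, rfl⟩ := Equiv.Perm.SameCycle.exists_nat_pow_eq h
        rw [← Equiv.Perm.iterate_eq_pow]
        clear h
        induction k with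
        | zero => exact SameFace.refl _ _
        | succ k ih =>
          rw [Function.iterate_succ_apply']
          exact SameFace.trans ih (E.sameFace_next _ _)
      · intro x y h
        refine SameFace.le_of (r := E.next.SameCycle) ⟨fun _ => .refl _ _, .symm, .trans⟩
          (fun z => ?_) (fun z hz => absurd z.edge_mem hz) h
        exact Equiv.Perm.sameCycle_apply_right.2 (Equiv.Perm.SameCycle.refl _ _)
    have h2 : Nat.card (Quotient (fromEdgeSet G.edgeSet).reachableSetoid) = 1 := by
      rw [Nat.card_eq_one_iff_unique]
      refine ⟨⟨?_⟩, ⟨Quotient.mk _ hne.some.fst⟩⟩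
      rintro ⟨x⟩ ⟨y⟩
      refine Quotient.sound ?_
      rw [fromEdgeSet_edgeSet]
      exact E.connected.preconnected x y
    have h3 := E.euler
    rw [h1, h2, ← Nat.card_coe_set_eq]
    push_cast
    omega
  exact le_antisymm (h0 ▸ eulerCount_anti (empty_subset K) hK) (hE ▸ eulerCount_anti hK subset_rfl)

/-- The Jordan curve theorem: an edge on a cycle of a plane subgraph separates two faces. -/
theorem not_sameFace_symm {d : G.Dart} (hK : K ⊆ G.edgeSet) (hd : d.edge ∈ K)
    (hr : (fromEdgeSet (K \ {d.edge})).Reachable d.fst d.snd) : ¬ E.SameFace K d d.symm := by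
  intro hs
  have h1 := eulerCount_eq (E := E) ⟨d⟩ hK
  have h2 := eulerCount_eq (E := E) ⟨d⟩ (sdiff_subset.trans hK : K \ {d.edge} ⊆ _)
  have hcard := ncard_sdiff_singleton_add_one hd (Set.toFinite K)
  have hK' : insert s(d.fst, d.snd) (K \ {d.edge}) = K := by
    rw [show s(d.fst, d.snd) = d.edge from rfl, insert_sdiff_singleton, insert_eq_of_mem hd]
  -- With the same face on both sides, deleting the edge changes neither faces nor components, only
  -- the number of edges; the constant count forbids this.
  have hF : E.faceSetoid K = E.faceSetoid (K \ {d.edge}) := by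
    ext x y
    exact ⟨fun h => SameFace.of_subset sdiff_subset h, fun h => SameFace.of_diff_of_symm hs h⟩
  have hC : (fromEdgeSet K).reachableSetoid = (fromEdgeSet (K \ {d.edge})).reachableSetoid := by
    ext x y
    constructor
    · intro h
      have h : (fromEdgeSet K).Reachable x y := h
      rw [← hK'] at h
      rcases reachable_fromEdgeSet_insert h with h | ⟨h, h'⟩ | ⟨h, h'⟩
      · exact h
      · exact (h.trans hr).trans h'
      · exact (h.trans hr.symm).trans h'
    · intro h
      exact Reachable.mono (fromEdgeSet_mono sdiff_subset) h
  unfold eulerCount at h1 h2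
  rw [hF, hC, ← hcard] at h1
  push_cast at h1
  omega

/-- An edge of a cycle is not a bridge of that cycle, so its ends stay connected without it. -/
theorem not_sameFace_symm_of_isCycle {u : V} {p : G.Walk u u} (hp : p.IsCycle) {d : G.Dart}
    (hd : d.edge ∈ p.edges) : ¬ E.SameFace p.edgesSet d d.symm := by
  refine not_sameFace_symm p.edgesSet_subset hd ?_
  have hH : ∀ e ∈ p.edges, e ∈ (fromEdgeSet p.edgesSet).edgeSet := by
    intro e he
    rw [edgeSet_fromEdgeSet]
    exact ⟨he, G.not_isDiag_of_mem_edgeSet (p.edges_subset_edgeSet he)⟩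
  have hb := mt (isBridge_iff_forall_cycle_notMem (hH _ hd)).1 (by
    push Not
    exact ⟨u, p.transfer _ hH, hp.transfer hH, by rwa [Walk.edges_transfer]⟩)
  change ¬ ¬ _ at hb
  rw [not_not] at hb
  convert hb using 1
  ext a b
  simp [Dart.edge]

end PlaneEmbedding

/-! ### Cycles that separate two faces -/

theorem SimpleGraph.exists_isCycle_of_reachable_sdiff {V : Type*} {G : SimpleGraph V}
    {K : Set (Sym2 V)} (hK : K ⊆ G.edgeSet) {d : G.Dart}
    (hd : d.edge ∈ K) (hr : (fromEdgeSet (K \ {d.edge})).Reachable d.fst d.snd) :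
    ∃ (v : V) (p : G.Walk v v), p.IsCycle ∧ d.edge ∈ p.edges ∧ p.edgesSet ⊆ K := by
  have hle : fromEdgeSet K ≤ G := by
    intro a b h
    exact hK ((fromEdgeSet_adj _).1 h).1
  have hb : ¬ (fromEdgeSet K).IsBridge d.edge := by
    change ¬ ¬ _
    rw [not_not]
    convert hr using 1
    ext a b
    simp [Dart.edge]
  rw [isBridge_iff_forall_cycle_notMem (by
    rw [edgeSet_fromEdgeSet]; exact ⟨hd, G.not_isDiag_of_mem_edgeSet d.edge_mem⟩)] at hb
  push Not at hb
  obtain ⟨v, p, hp, hdp⟩ := hb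
  refine ⟨v, p.mapLe hle, hp.mapLe hle, by simpa using hdp, ?_⟩
  intro e he
  have : e ∈ p.edges := by simpa [Walk.edgesSet] using he
  have := p.edges_subset_edgeSet this
  rw [edgeSet_fromEdgeSet] at this
  exact this.1

theorem SimpleGraph.Walk.notMem_of_notMem_support {V : Type*} {G : SimpleGraph V}
    {u v w : V} {p : G.Walk u v}
    (hw : w ∉ p.support) : ∀ e ∈ p.edgesSet, w ∉ e :=
  fun _ he hwe => hw (p.mem_support_of_mem_edges he hwe)

namespace PlaneEmbedding

variable {V : Type*} [Fintype V] {G : SimpleGraph V} {E : PlaneEmbedding G} {K : Set (Sym2 V)}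
  {x y z : G.Dart}

theorem sameFace_inter_edgeSet : E.SameFace (K ∩ G.edgeSet) x y ↔ E.SameFace K x y :=
  ⟨SameFace.mono fun d hd => (⟨hd, d.edge_mem⟩ : d.edge ∈ K ∩ G.edgeSet),
    SameFace.mono fun _ hd => hd.1⟩

/-- Two faces of a plane subgraph are separated by a cycle of that subgraph. -/
theorem exists_isCycle_of_not_sameFace (h : ¬ E.SameFace K x y) :
    ∃ (v : V) (p : G.Walk v v), p.IsCycle ∧ p.edgesSet ⊆ K ∧ ¬ E.SameFace p.edgesSet x y := by
  -- In a minimal separating edge set no edge is a bridge, because removing a bridge merges no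
  -- faces. So any of its edges lies on a cycle.
  obtain ⟨K', hK'K, hmin⟩ := (Set.toFinite {K' | ¬ E.SameFace K' x y}).exists_le_minimal
    (a := K ∩ G.edgeSet) (fun h' => h (sameFace_inter_edgeSet.1 h'))
  have hK'E : K' ⊆ G.edgeSet := fun e he => (hK'K he).2
  have hne : K'.Nonempty := by
    rw [nonempty_iff_ne_empty]
    rintro rfl
    exact hmin.1 (sameFace_empty x y)
  obtain ⟨e, he⟩ := hne
  obtain ⟨d, rfl⟩ := exists_dart_of_mem (hK'E he)
  have hsub : E.SameFace (K' \ {d.edge}) x y := by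
    by_contra hcon
    exact (hmin.2 hcon sdiff_subset he).2 rfl
  have hr : (fromEdgeSet (K' \ {d.edge})).Reachable d.fst d.snd := by
    by_contra hr
    refine hmin.1 (SameFace.of_diff_of_symm (d := d) ?_ hsub)
    refine sameFace_symm_of_cut
      (X := {w | (fromEdgeSet (K' \ {d.edge})).Reachable d.fst w}) hr (Reachable.refl _) ?_
    intro z hz hz1 hz2
    by_cases hzd : z.edge = d.edge
    · rcases (dart_edge_eq_iff z d).1 hzd with rfl | rfl
      · rfl
      · exact absurd hz1 hr
    · refine absurd (Reachable.trans hz1 (Adj.reachable ?_)) hz2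
      rw [fromEdgeSet_adj]
      exact ⟨⟨hz, hzd⟩, z.fst_ne_snd⟩
  obtain ⟨v, p, hp, hdp, hpK⟩ := exists_isCycle_of_reachable_sdiff hK'E he hr
  refine ⟨v, p, hp, fun e he => (hK'K (hpK he)).1, fun hxy => ?_⟩
  have hd := not_sameFace_symm_of_isCycle (E := E) hp hdp
  -- By minimality, `x` and `y` lie on opposite sides of `d`. These sides remain different for the
  -- cycle alone.
  rcases hsub.of_diff with h | ⟨h, h'⟩ | ⟨h, h'⟩
  · exact hmin.1 h
  · exact hd (((h.of_subset hpK).symm.trans hxy).trans (h'.of_subset hpK).symm)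
  · exact hd ((h'.of_subset hpK).trans (hxy.symm.trans (h.of_subset hpK)))

/-- The first edge is the only one at the initial vertex, hence a cut, and can be peeled off without
merging faces. -/
theorem sameFace_of_isPath {u v : V} {p : G.Walk u v} (hp : p.IsPath) (x y : G.Dart) :
    E.SameFace p.edgesSet x y := by
  induction p with
  | nil => exact (sameFace_empty x y).mono (by simp [Walk.edgesSet])
  | @cons u v w h p ih =>
    rw [Walk.cons_isPath_iff] at hp
    have hd : E.SameFace (Walk.cons h p).edgesSet ⟨(u, v), h⟩ (Dart.symm ⟨(u, v), h⟩) := by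
      refine sameFace_symm_of_cut (X := {u}) (fun h' => h.ne' h') rfl ?_
      rintro ⟨⟨a, b⟩, hab⟩ hz (rfl : a = u) _
      have hz : s(a, b) ∈ (Walk.cons h p).edges := hz
      rw [Walk.edges_cons, List.mem_cons] at hz
      rcases hz with hz | hz
      · obtain rfl := Sym2.congr_right.1 hz
        rfl
      · exact absurd (p.fst_mem_support_of_mem_edges hz) hp.2
    refine SameFace.of_diff_of_symm hd ((ih hp.1).mono fun z hz => ?_)
    obtain ⟨hz, hne⟩ := hz
    have hz : z.edge ∈ (Walk.cons h p).edges := hz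
    rw [Walk.edges_cons, List.mem_cons] at hz
    exact hz.resolve_left hne

/-- A cycle has only two sides. -/
theorem sameFace_or_of_isCycle {u : V} {p : G.Walk u u} (hp : p.IsCycle) :
    ∃ d : G.Dart, d.edge ∈ p.edges ∧
      ∀ x, E.SameFace p.edgesSet x d ∨ E.SameFace p.edgesSet x d.symm := by
  cases p with
  | nil => exact absurd hp (by simp)
  | @cons _ v _ h p =>
    rw [Walk.cons_isCycle_iff] at hp
    refine ⟨⟨(u, v), h⟩, by simp [Dart.edge], fun x => ?_⟩
    have := sameFace_of_isPath (E := E) hp.1 x ⟨(u, v), h⟩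
    -- Without its first edge the cycle is a path with a single face; restoring the edge splits that
    -- face into at most two.
    have := SameFace.of_diff (K := (Walk.cons h p).edgesSet) (d := ⟨(u, v), h⟩) (x := x)
      (y := ⟨(u, v), h⟩) (this.mono fun z hz => by
        obtain ⟨hz, hne⟩ := hz
        have hz : z.edge ∈ (Walk.cons h p).edges := hz
        rw [Walk.edges_cons, List.mem_cons] at hz
        exact hz.resolve_left hne)
    rcases this with h | ⟨h, -⟩ | ⟨h, -⟩
    exacts [Or.inl h, Or.inl h, Or.inr h]

theorem sameFace_or_sameFace_of_isCycle {u : V} {p : G.Walk u u} (hp : p.IsCycle) {d : G.Dart}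
    (hd : d.edge ∈ p.edges) (x : G.Dart) :
    E.SameFace p.edgesSet x d ∨ E.SameFace p.edgesSet x d.symm := by
  obtain ⟨e, -, he⟩ := sameFace_or_of_isCycle (E := E) hp
  have hn := not_sameFace_symm_of_isCycle (E := E) hp hd
  rcases he x with h | h <;> rcases he d with h1 | h1 <;> rcases he d.symm with h2 | h2
  · exact absurd (h1.trans h2.symm) hn
  · exact Or.inl (h.trans h1.symm)
  · exact Or.inr (h.trans h2.symm)
  · exact absurd (h1.trans h2.symm) hn
  · exact absurd (h1.trans h2.symm) hn
  · exact Or.inr (h.trans h2.symm)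
  · exact Or.inl (h.trans h1.symm)
  · exact absurd (h1.trans h2.symm) hn

/-- Darts that leave vertices joined by a walk avoiding `K` are on the same face. -/
theorem sameFace_of_walk {u v : V} (p : G.Walk u v) (hp : ∀ w ∈ p.support, ∀ e ∈ K, w ∉ e)
    (hx : x.fst = u) (hy : y.fst = v) : E.SameFace K x y := by
  induction p generalizing x with
  | nil => exact sameFace_of_fst_eq (hx.trans hy.symm) (by rw [hx]; exact hp _ (by simp))
  | @cons u v w h p ih =>
    have hu : ∀ e ∈ K, u ∉ e := hp u (by simp)
    refine (sameFace_of_fst_eq (y := ⟨(u, v), h⟩) hx (by rwa [hx])).trans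
      (.trans ?_ (ih (x := Dart.symm ⟨(u, v), h⟩) (fun w hw => hp w (by simp [hw])) rfl hy))
    exact E.sameFace_symm_of_notMem fun hK => hu _ hK (Sym2.mem_mk_left _ _)

end PlaneEmbedding

/-! ### Semi-maximal planar graphs -/

/-- The edges of the subgraph induced by `S`. -/
def edgesIn {V : Type*} (S : Set V) : Set (Sym2 V) := {a | ∀ x ∈ a, x ∈ S}

theorem mk_mem_edgesIn {V : Type*} {S : Set V} {a b : V} : s(a, b) ∈ edgesIn S ↔ a ∈ S ∧ b ∈ S := by
  simp [edgesIn]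

theorem dart_mem_edgesIn {V : Type*} {G : SimpleGraph V} {S : Set V} {d : G.Dart} :
    d.edge ∈ edgesIn S ↔ d.fst ∈ S ∧ d.snd ∈ S := mk_mem_edgesIn

theorem SimpleGraph.Walk.IsCycle.support_subset_of_edgesSet_subset {V : Type*} {G : SimpleGraph V}
    {S : Set V} {u : V} {p : G.Walk u u} (hp : p.IsCycle) (h : p.edgesSet ⊆ edgesIn S) :
    ∀ v ∈ p.support, v ∈ S := by
  intro v hv
  obtain ⟨e, he, hve⟩ := (Walk.mem_support_iff_exists_mem_edges_of_not_nil hp.not_nil).1 hv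
  exact h he v hve

/-- The dart lies on the cycle `c` in its direction. -/
def IsOuter {V : Type*} {G : SimpleGraph V} {n : ℕ} (c : ZMod n → V) (d : G.Dart) :
    Prop := ∃ i, d.toProd = (c i, c (i + 1))

theorem IsOuter.fst_mem {V : Type*} {G : SimpleGraph V} {n : ℕ} {c : ZMod n → V}
    {d : G.Dart} (h : IsOuter c d) : d.fst ∈ range c := by
  obtain ⟨i, hi⟩ := h
  exact ⟨i, (congrArg Prod.fst hi).symm⟩

theorem IsOuter.snd_mem {V : Type*} {G : SimpleGraph V} {n : ℕ} {c : ZMod n → V}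
    {d : G.Dart} (h : IsOuter c d) : d.snd ∈ range c := by
  obtain ⟨i, hi⟩ := h
  exact ⟨i + 1, (congrArg Prod.snd hi).symm⟩

namespace IsLongCycle

variable {V : Type*} {G : SimpleGraph V} {n : ℕ} {c : ZMod n → V}

/-- The walk that follows the cycle for `k` steps. -/
def arc (hc : IsLongCycle G c) (i : ZMod n) : (k : ℕ) → G.Walk (c i) (c (i + k))
  | 0 => Walk.nil.copy rfl (by simp)
  | k + 1 => (Walk.concat (hc.arc i k) (hc.adj _)).copy rfl (by push_cast; rw [add_assoc])

theorem support_arc (hc : IsLongCycle G c) (i : ZMod n) (k : ℕ) :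
    (hc.arc i k).support = (List.range (k + 1)).map fun j : ℕ => c (i + j) := by
  induction k with
  | zero => simp [arc]
  | succ k ih =>
    rw [arc, Walk.support_copy, Walk.support_concat, ih, List.range_succ (n := k + 1)]
    simp [add_assoc]

theorem exists_walk (hc : IsLongCycle G c) (i j : ZMod n) :
    ∃ p : G.Walk (c i) (c j), ∀ v ∈ p.support, v ∈ range c := by
  have := hc.neZero
  refine ⟨(hc.arc i (j - i).val).copy rfl (by simp), ?_⟩
  intro v hv
  rw [Walk.support_copy, hc.support_arc, List.mem_map] at hv
  obtain ⟨k, -, rfl⟩ := hv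
  exact ⟨_, rfl⟩

/-- The dart of the cycle from `c i` to `c (i + 1)`. -/
def dart (hc : IsLongCycle G c) (i : ZMod n) : G.Dart := ⟨(c i, c (i + 1)), hc.adj i⟩

theorem natCast_ne_zero (hc : IsLongCycle G c) {k : ℕ} (h0 : 0 < k) (hk : k < 4) :
    (k : ZMod n) ≠ 0 := by
  intro h
  rw [ZMod.natCast_eq_zero_iff] at h
  have := Nat.le_of_dvd h0 h
  have := hc.four_le
  omega

end IsLongCycle

namespace PlaneEmbedding

variable {V : Type*} [Fintype V] {G : SimpleGraph V} {E : PlaneEmbedding G} {n : ℕ}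
  {c : ZMod n → V}

theorem IsSemiMaximal.next_isOuter (hE : E.IsSemiMaximal c) {d : G.Dart} :
    IsOuter c (E.next d) ↔ IsOuter c d := by
  constructor
  · rintro ⟨i, hi⟩
    have h := hE.outer (hE.isCycle.dart (i - 1)) (i - 1) rfl
    have : E.next (hE.isCycle.dart (i - 1)) = E.next d := by
      apply Dart.ext
      rw [h, hi]
      simp
    rw [← E.next.injective this]
    exact ⟨i - 1, rfl⟩
  · rintro ⟨i, hi⟩
    exact ⟨i + 1, hE.outer d i hi⟩

theorem IsSemiMaximal.next_next_next (hE : E.IsSemiMaximal c) {d : G.Dart} (hd : ¬ IsOuter c d) :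
    E.next (E.next (E.next d)) = d := hE.triangle d fun i hi => hd ⟨i, hi⟩

/-- The third vertex of the triangle on the left of a dart. -/
def apex (E : PlaneEmbedding G) (d : G.Dart) : V := (E.next d).snd

theorem adj_apex (d : G.Dart) : G.Adj d.snd (E.apex d) := by
  have h := (E.next d).adj
  rw [E.next_fst] at h
  exact h

theorem IsSemiMaximal.apex_adj (hE : E.IsSemiMaximal c) {d : G.Dart} (hd : ¬ IsOuter c d) :
    G.Adj (E.apex d) d.fst := by
  have h := (E.next (E.next d)).adj
  rw [E.next_fst] at h
  have h2 := E.next_fst (E.next (E.next d))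
  rw [hE.next_next_next hd] at h2
  rw [h2]
  exact h

theorem IsSemiMaximal.apex_next (hE : E.IsSemiMaximal c) {d : G.Dart} (hd : ¬ IsOuter c d) :
    E.apex (E.next d) = d.fst := by
  have h2 := E.next_fst (E.next (E.next d))
  rw [hE.next_next_next hd] at h2
  exact h2.symm

/-- If `Z` is a union of components of `G - S` that does not meet `c`, then a dart leaving a vertex
of `Z` is separated by a cycle of `G[S]` from every dart on the outer face and from every dart
leaving a vertex that is neither in `S` nor in `Z`. -/
theorem IsSemiMaximal.exists_isCycle (hE : E.IsSemiMaximal c) {S Z : Set V}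
    (hZc : Disjoint Z (range c)) (hZ : ∀ z ∈ Z, ∀ w, G.Adj z w → w ∉ S → w ∈ Z) {x y : G.Dart}
    (hx : x.fst ∈ Z) (hy : IsOuter c y ∨ (y.fst ∉ S ∧ y.fst ∉ Z)) :
    ∃ (v : V) (p : G.Walk v v), p.IsCycle ∧ (∀ w ∈ p.support, w ∈ S) ∧
      ¬ E.SameFace p.edgesSet x y := by
  have hnot : ∀ z ∈ Z, z ∉ range c := fun z hz h => disjoint_left.1 hZc hz h
  have key : ¬ E.SameFace (edgesIn S) x y := by
    intro h
    -- The property that the triangle on the left meets Z is constant on faces of `G[S]`. It passes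
    -- across an edge not inside S, because an end outside S of a triangle that meets Z is itself in
    -- Z. It holds at `x` and fails at `y`.
    have hP := SameFace.iff_of (P := fun d => d.fst ∈ Z ∨ d.snd ∈ Z ∨ E.apex d ∈ Z) ?_ ?_ h
    · rcases hP.1 (Or.inl hx) with h1 | h1 | h1 <;> rcases hy with hy | ⟨hy, hy'⟩
      · exact hnot _ h1 hy.fst_mem
      · exact hy' h1
      · exact hnot _ h1 hy.snd_mem
      · exact hy' (hZ _ h1 _ y.adj.symm hy)
      · exact hnot _ h1 ((hE.next_isOuter.2 hy).snd_mem)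
      · by_cases ho : IsOuter c y
        · exact hnot _ h1 ((hE.next_isOuter.2 ho).snd_mem)
        · exact hy' (hZ _ h1 _ (hE.apex_adj ho) hy)
    · intro d
      by_cases ho : IsOuter c d
      · have ho' := hE.next_isOuter.2 ho
        have ho'' := hE.next_isOuter.2 ho'
        constructor
        · rintro (h | h | h)
          · exact absurd ho.fst_mem (hnot _ h)
          · exact absurd ho.snd_mem (hnot _ h)
          · exact absurd ho'.snd_mem (hnot _ h)
        · rintro (h | h | h)
          · exact absurd ho'.fst_mem (hnot _ h)
          · exact absurd ho'.snd_mem (hnot _ h)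
          · exact absurd ho''.snd_mem (hnot _ h)
      · rw [hE.apex_next ho, E.next_fst]
        change _ ↔ d.snd ∈ Z ∨ E.apex d ∈ Z ∨ d.fst ∈ Z
        tauto
    · have hhalf : ∀ d : G.Dart, d.edge ∉ edgesIn S → (d.fst ∈ Z ∨ d.snd ∈ Z ∨ E.apex d ∈ Z) →
          d.fst ∈ Z ∨ d.snd ∈ Z := by
        intro d hd h
        rw [dart_mem_edgesIn, not_and_or] at hd
        rcases h with h | h | h
        · exact Or.inl h
        · exact Or.inr h
        · rcases hd with hd | hd
          · by_cases ho : IsOuter c d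
            · exact absurd (hE.next_isOuter.2 ho).snd_mem (hnot _ h)
            · exact Or.inl (hZ _ h _ (hE.apex_adj ho) hd)
          · exact Or.inr (hZ _ h _ (E.adj_apex d).symm hd)
      intro d hd
      constructor
      · intro h
        rcases hhalf d hd h with h | h
        · exact Or.inr (Or.inl h)
        · exact Or.inl h
      · intro h
        rcases hhalf d.symm (by rwa [Dart.edge_symm]) h with h | h
        · exact Or.inr (Or.inl h)
        · exact Or.inl h
  obtain ⟨v, p, hp, hpS, hxy⟩ := exists_isCycle_of_not_sameFace key
  exact ⟨v, p, hp, hp.support_subset_of_edgesSet_subset hpS, hxy⟩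

end PlaneEmbedding

/-! ### Fences -/

namespace PlaneEmbedding

variable {V : Type*} [Fintype V] {G : SimpleGraph V} {E : PlaneEmbedding G}

/-- A face of a plane subgraph that has no edge of the subgraph on its boundary with another face is
the only face. -/
theorem sameFace_of_symm_closed {K : Set (Sym2 V)} {d : G.Dart}
    (H : ∀ x, E.SameFace K d x → x.edge ∈ K → E.SameFace K d x.symm) (y : G.Dart) :
    E.SameFace K d y := by
  have hstep : ∀ x, E.SameFace K d x → E.SameFace K d x.symm := by
    intro x hx
    by_cases hK : x.edge ∈ K
    · exact H x hx hK
    · exact hx.trans (E.sameFace_symm_of_notMem hK)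
  refine (SameFace.iff_of (E := E) (P := fun x => E.SameFace K d x) (fun x => ?_) (fun x _ => ?_)
    (sameFace_empty d y)).1 (SameFace.refl K d)
  · exact ⟨fun h => h.trans (E.sameFace_next K x), fun h => h.trans (E.sameFace_next K x).symm⟩
  · exact ⟨hstep x, fun h => by simpa using hstep _ h⟩

/-- The darts on the boundary of the face of `G[S]` to the left of `d`. -/
def faceDarts (E : PlaneEmbedding G) (S : Set V) (d : G.Dart) : Set G.Dart :=
  {x | E.SameFace (edgesIn S) d x ∧ x.edge ∈ edgesIn S}

theorem isFence_iff {S : Set V} :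
    E.IsFence S ↔ ∀ d, Even (E.faceDarts S d).ncard ∧ 4 ≤ (E.faceDarts S d).ncard := by
  have : ∀ d, E.faceDarts S d = {e : G.Dart | E.SameFace {a | ∀ x ∈ a, x ∈ S} d e ∧
      e.fst ∈ S ∧ e.snd ∈ S} := by
    intro d
    ext e
    exact and_congr Iff.rfl dart_mem_edgesIn
  simp only [this]
  rfl

theorem sum_faceDarts (S : Set V) (d : G.Dart) (g : V → ℤ) :
    ∑ x ∈ (Set.toFinite (E.faceDarts S d)).toFinset, (g x.snd - g x.fst) = 0 := by
  classical
  have := Fintype.ofFinite G.Dart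
  rw [← E.sum_face_eq_zero (edgesIn S) d g]
  refine Finset.sum_congr ?_ fun _ _ => rfl
  ext x
  simp [faceDarts]

/-- Around a face the increments of the 0-1 coloring sum to zero, while each of them is odd. -/
theorem even_ncard_faceDarts {S : Set V} {h : V → Bool} (H : ProperOn G S h) (d : G.Dart) :
    Even (E.faceDarts S d).ncard := by
  have hsum := E.sum_faceDarts S d (fun v => if h v then 1 else 0)
  have hdvd : (2 : ℤ) ∣ ∑ x ∈ (Set.toFinite (E.faceDarts S d)).toFinset,
      (((if h x.snd then 1 else 0) - (if h x.fst then 1 else 0) : ℤ) - 1) := by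
    refine Finset.dvd_sum fun x hx => ?_
    have hx : x ∈ E.faceDarts S d := (Set.Finite.mem_toFinset _).1 hx
    obtain ⟨h1, h2⟩ := dart_mem_edgesIn.1 hx.2
    have := H _ h1 _ h2 x.adj
    revert this
    cases h x.fst <;> cases h x.snd <;> simp
  rw [Finset.sum_sub_distrib, hsum, Finset.sum_const, ← Set.ncard_eq_toFinset_card] at hdvd
  rw [Nat.even_iff]
  simp only [nsmul_eq_mul, mul_one, zero_sub, dvd_neg] at hdvd
  omega

/-- Face degrees are even by bipartiteness, so only degrees 0 and 2 must be excluded; having two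
different edges does this. -/
theorem isFence_of_properOn {S : Set V} {h : V → Bool} (H : ProperOn G S h) {x y : G.Dart}
    (hx : x.edge ∈ edgesIn S) (hy : y.edge ∈ edgesIn S) (hxy : x.edge ≠ y.edge) :
    E.IsFence S := by
  refine isFence_iff.2 fun d => ⟨even_ncard_faceDarts H d, ?_⟩
  have h0 : (E.faceDarts S d).ncard ≠ 0 := by
    intro h0
    rw [Set.ncard_eq_zero] at h0
    have hempty : ∀ z, z ∉ E.faceDarts S d := fun z hz => by rw [h0] at hz; exact hz
    exact hempty x ⟨sameFace_of_symm_closed (fun z h1 h2 => absurd ⟨h1, h2⟩ (hempty z)) x, hx⟩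
  have h2 : (E.faceDarts S d).ncard ≠ 2 := by
    intro h2
    obtain ⟨a, b, hab, hset⟩ := Set.ncard_eq_two.1 h2
    -- Two boundary darts that balance at every vertex are reverse to each other. Then the face has
    -- no other face across its boundary, so it is everything, and `G[S]` has just one edge.
    have hsum : ∀ g : V → ℤ, (g a.snd - g a.fst) + (g b.snd - g b.fst) = 0 := by
      classical
      intro g
      have := E.sum_faceDarts S d g
      have hfin : (Set.toFinite (E.faceDarts S d)).toFinset = {a, b} := by
        ext z
        rw [Set.Finite.mem_toFinset, hset]
        simp
      rwa [hfin, Finset.sum_pair hab] at this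
    classical
    have hne := a.fst_ne_snd
    have e1 : b.fst = a.snd := by
      have := hsum (fun v => if v = a.snd then 1 else 0)
      by_contra hcon
      rw [if_pos rfl, if_neg hne, if_neg hcon] at this
      split_ifs at this <;> omega
    have e2 : b.snd = a.fst := by
      have := hsum (fun v => if v = a.fst then 1 else 0)
      by_contra hcon
      rw [if_pos rfl, if_neg hne.symm, if_neg hcon] at this
      split_ifs at this <;> omega
    have hb : b = a.symm := Dart.ext _ _ (Prod.ext e1 e2)
    subst hb
    have hall := sameFace_of_symm_closed (E := E) (K := edgesIn S) (d := d) (by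
      intro z h1 h2
      have hz : z ∈ E.faceDarts S d := ⟨h1, h2⟩
      have ha : a ∈ E.faceDarts S d := by rw [hset]; simp
      have ha' : a.symm ∈ E.faceDarts S d := by rw [hset]; simp
      rw [hset] at hz
      rcases hz with rfl | hz
      · exact ha'.1
      · rw [mem_singleton_iff] at hz
        rw [hz, Dart.symm_symm]
        exact ha.1)
    have hedge : ∀ z : G.Dart, z.edge ∈ edgesIn S → z.edge = a.edge := by
      intro z hz
      have hz : z ∈ E.faceDarts S d := ⟨hall z, hz⟩
      rw [hset] at hz
      rcases hz with rfl | hz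
      · rfl
      · rw [mem_singleton_iff] at hz
        rw [hz, Dart.edge_symm]
    exact hxy ((hedge x hx).trans (hedge y hy).symm)
  have h3 := even_ncard_faceDarts (E := E) H d
  rw [Nat.even_iff] at h3
  omega

/-- The darts of `G[S]` on one side of a cycle of a fence `G[S]` are even in number. -/
theorem IsFence.even_ncard {S : Set V} (hF : E.IsFence S) {K : Set (Sym2 V)}
    (hK : K ⊆ edgesIn S) (d : G.Dart) :
    Even {x : G.Dart | E.SameFace K d x ∧ x.edge ∈ edgesIn S}.ncard := by
  classical
  have hfin := Set.toFinite {x : G.Dart | E.SameFace K d x ∧ x.edge ∈ edgesIn S}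
  -- A face of K is a union of faces of `G[S]`, each contributing an even number of darts.
  rw [Set.ncard_eq_toFinset_card _ hfin,
    Finset.card_eq_sum_card_image (Quotient.mk (E.faceSetoid (edgesIn S)))]
  refine Finset.even_sum _ fun q hq => ?_
  obtain ⟨x, hx, rfl⟩ := Finset.mem_image.1 hq
  rw [Set.Finite.mem_toFinset] at hx
  have := (isFence_iff.1 hF x).1
  rw [Set.ncard_eq_toFinset_card _ (Set.toFinite _)] at this
  refine (congrArg Even (congrArg Finset.card ?_)).mp this
  ext y
  simp only [Finset.mem_filter, Set.Finite.mem_toFinset]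
  constructor
  · rintro ⟨h1, h2⟩
    exact ⟨⟨hx.1.trans (h1.of_subset hK), h2⟩, Quotient.sound (SameFace.symm h1)⟩
  · rintro ⟨h1, h2⟩
    exact ⟨SameFace.symm (Quotient.exact h2), h1.2⟩

/-- By the Jordan curve theorem, exactly one of the two darts of each cycle edge lies on a given
side. -/
theorem ncard_side_of_isCycle {u : V} {p : G.Walk u u} (hp : p.IsCycle) {d : G.Dart}
    (hd : d.edge ∈ p.edges) :
    {x : G.Dart | E.SameFace p.edgesSet d x ∧ x.edge ∈ p.edges}.ncard = p.length := by
  classical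
  have hn : p.length = p.edgesSet.ncard := by
    rw [← p.length_edges, ← List.toFinset_card_of_nodup hp.edges_nodup, ← Set.ncard_coe_finset]
    congr 1
    ext e
    simp [Walk.edgesSet]
  rw [hn]
  refine Set.ncard_congr (fun x _ => x.edge) (fun x hx => hx.2) ?_ ?_
  · rintro x y ⟨h1, h2⟩ ⟨h3, -⟩ hxy
    rcases (dart_edge_eq_iff x y).1 hxy with h | rfl
    · exact h
    · exact absurd (h1.symm.trans h3) (by
        have := not_sameFace_symm_of_isCycle (E := E) hp h2
        rwa [Dart.symm_symm] at this)
  · intro e he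
    obtain ⟨x, rfl⟩ := exists_dart_of_mem (p.edges_subset_edgeSet he)
    have hx := not_sameFace_symm_of_isCycle (E := E) hp he
    rcases sameFace_or_sameFace_of_isCycle (E := E) hp hd x with h | h
    · exact ⟨x, ⟨h.symm, he⟩, rfl⟩
    · rcases sameFace_or_sameFace_of_isCycle (E := E) hp hd x.symm with h' | h'
      · exact ⟨x.symm, ⟨h'.symm, by rwa [Dart.edge_symm]⟩, Dart.edge_symm x⟩
      · exact absurd (h.trans h'.symm) hx

/-- Count the darts of `G[S]` on one side of a cycle. The total is even by the fence condition,
darts off the cycle pair up by reversal, and the rest number the length of the cycle. -/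
theorem IsFence.not_hasOddCycle {S : Set V} (hF : E.IsFence S) : ¬ HasOddCycle G S := by
  classical
  rintro ⟨v, p, hp, hodd, hS⟩
  obtain ⟨d, hd, -⟩ := sameFace_or_of_isCycle (E := E) hp
  have hK : p.edgesSet ⊆ edgesIn S := fun e he x hx => hS x (p.mem_support_of_mem_edges he hx)
  have h1 := hF.even_ncard hK d
  have h2 := ncard_side_of_isCycle (E := E) hp hd
  have h3 : Even {x : G.Dart | E.SameFace p.edgesSet d x ∧ x.edge ∈ edgesIn S ∧
      x.edge ∉ p.edgesSet}.ncard := by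
    have hfin := Set.toFinite {x : G.Dart | E.SameFace p.edgesSet d x ∧ x.edge ∈ edgesIn S ∧
      x.edge ∉ p.edgesSet}
    rw [Set.ncard_eq_toFinset_card _ hfin, ← ZMod.natCast_eq_zero_iff_even, Finset.cast_card]
    refine Finset.sum_involution (fun x _ => x.symm) (fun _ _ => by decide)
      (fun x _ _ => x.symm_ne) ?_ (fun x _ => x.symm_symm)
    intro x hx
    rw [Set.Finite.mem_toFinset] at hx ⊢
    exact ⟨hx.1.trans (E.sameFace_symm_of_notMem hx.2.2), by rw [Dart.edge_symm]; exact hx.2⟩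
  have h4 : {x : G.Dart | E.SameFace p.edgesSet d x ∧ x.edge ∈ edgesIn S} =
      {x : G.Dart | E.SameFace p.edgesSet d x ∧ x.edge ∈ p.edges} ∪
      {x : G.Dart | E.SameFace p.edgesSet d x ∧ x.edge ∈ edgesIn S ∧ x.edge ∉ p.edgesSet} := by
    ext x
    constructor
    · rintro ⟨hx, hx'⟩
      by_cases h : x.edge ∈ p.edgesSet
      · exact Or.inl ⟨hx, h⟩
      · exact Or.inr ⟨hx, hx', h⟩
    · rintro (⟨hx, hx'⟩ | ⟨hx, hx', -⟩)
      · exact ⟨hx, hK hx'⟩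
      · exact ⟨hx, hx'⟩
  rw [h4, Set.ncard_union_eq (disjoint_left.2 fun x hx hx' => hx'.2.2 hx.2) (Set.toFinite _)
    (Set.toFinite _), h2] at h1
  rw [Nat.even_iff] at h1 h3
  rw [Nat.odd_iff] at hodd
  omega

end PlaneEmbedding

/-! ### Chords of a cycle -/

namespace IsLongCycle

variable {V : Type*} {G : SimpleGraph V} {n : ℕ} {c : ZMod n → V}

theorem natCast_injOn {a b : ℕ} (ha : a < n) (hb : b < n) (h : (a : ZMod n) = b) : a = b := by
  have := congrArg ZMod.val h
  rwa [ZMod.val_cast_of_lt ha, ZMod.val_cast_of_lt hb] at this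

theorem isPath_arc (hc : IsLongCycle G c) (i : ZMod n) {k : ℕ} (hk : k < n) :
    (hc.arc i k).IsPath := by
  rw [Walk.isPath_def, support_arc]
  refine List.Nodup.map_on ?_ List.nodup_range
  intro a ha b hb h
  rw [List.mem_range] at ha hb
  exact natCast_injOn (by omega) (by omega) (add_left_cancel (hc.injective h))

theorem length_arc (hc : IsLongCycle G c) (i : ZMod n) (k : ℕ) : (hc.arc i k).length = k := by
  have := (hc.arc i k).length_support
  rw [support_arc, List.length_map, List.length_range] at this
  omega

theorem exists_isCycle_arc (hc : IsLongCycle G c) {i j : ZMod n} (h : G.Adj (c i) (c j)) {k : ℕ}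
    (hj : j = i + k) (h2 : 2 ≤ k) (hk : k < n) :
    ∃ p : G.Walk (c j) (c j), p.IsCycle ∧ p.toSubgraph.Adj (c i) (c j) ∧
      ∀ v, v ∈ p.support ↔ ∃ t ≤ k, v = c (i + (t : ℕ)) := by
  subst hj
  refine ⟨.cons h.symm (hc.arc i k), ?_, ?_, ?_⟩
  · rw [Walk.cons_isCycle_iff]
    refine ⟨hc.isPath_arc i hk, fun he => ?_⟩
    have := (hc.isPath_arc i hk).length_eq_one_of_mem_edges (Sym2.eq_swap ▸ he)
    rw [length_arc] at this
    omega
  · rw [Walk.toSubgraph, Subgraph.sup_adj]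
    left
    exact Sym2.eq_swap
  · intro v
    rw [Walk.support_cons, List.mem_cons, support_arc, List.mem_map]
    simp only [List.mem_range]
    constructor
    · rintro (rfl | ⟨t, ht, rfl⟩)
      · exact ⟨k, le_rfl, rfl⟩
      · exact ⟨t, by omega, rfl⟩
    · rintro ⟨t, ht, rfl⟩
      exact Or.inr ⟨t, by omega, rfl⟩

/-- A chord splits a cycle into two. -/
theorem exists_chord_cycles (hc : IsLongCycle G c) {i j : ZMod n} (h : G.Adj (c i) (c j))
    (hij : j ≠ i + 1) (hji : i ≠ j + 1) :
    ∃ D₁ D₂ : G.Subgraph, D₁ ≠ D₂ ∧ (∀ i', c i' ∈ D₁.verts ∨ c i' ∈ D₂.verts) ∧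
      ∀ D, D = D₁ ∨ D = D₂ → IsCyc D ∧ D.verts ⊆ range c ∧ D.Adj (c i) (c j) := by
  have := hc.neZero
  set k := (j - i).val with hk
  have hkn : k < n := ZMod.val_lt _
  have hj : j = i + (k : ℕ) := by simp [hk]
  have h0 : k ≠ 0 := by
    intro h0
    rw [h0] at hj
    simp only [Nat.cast_zero, add_zero] at hj
    exact h.ne (by rw [hj])
  have h1 : k ≠ 1 := by
    intro h1
    rw [h1] at hj
    exact hij (by simpa using hj)
  have hi : i = j + ((n - k : ℕ) : ZMod n) := by
    rw [hj, Nat.cast_sub hkn.le]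
    simp
  have h1' : n - k ≠ 1 := by
    intro h1
    rw [h1] at hi
    exact hji (by simpa using hi)
  obtain ⟨p, hp, hpa, hps⟩ := hc.exists_isCycle_arc h hj (by omega) hkn
  obtain ⟨q, hq, hqa, hqs⟩ := hc.exists_isCycle_arc h.symm hi (by omega) (by omega)
  refine ⟨p.toSubgraph, q.toSubgraph, ?_, ?_, ?_⟩
  · intro hpq
    -- The vertex after `c i` lies strictly inside the first arc, hence not on the second.
    have h1 : c (i + (1 : ℕ)) ∈ p.toSubgraph.verts :=
      (Walk.mem_verts_toSubgraph p).2 ((hps _).2 ⟨1, by omega, rfl⟩)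
    rw [hpq, Walk.mem_verts_toSubgraph, hqs] at h1
    obtain ⟨t, ht, h1⟩ := h1
    have h1 := hc.injective h1
    rw [hj, add_assoc, add_right_inj, ← Nat.cast_add, ZMod.natCast_eq_natCast_iff'] at h1
    rw [Nat.mod_eq_of_lt (by omega)] at h1
    by_cases htn : k + t = n
    · rw [htn, Nat.mod_self] at h1
      omega
    · rw [Nat.mod_eq_of_lt (by omega)] at h1
      omega
  · intro x
    rw [Walk.mem_verts_toSubgraph, Walk.mem_verts_toSubgraph, hps, hqs]
    have hx : x = i + ((x - i).val : ℕ) := by simp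
    have hlt : (x - i).val < n := ZMod.val_lt _
    generalize (x - i).val = s at hx hlt
    by_cases hs : s ≤ k
    · exact Or.inl ⟨s, hs, by rw [hx]⟩
    · refine Or.inr ⟨s - k, by omega, ?_⟩
      rw [hx, hj, add_assoc, ← Nat.cast_add, Nat.add_sub_cancel' (by omega)]
  · rintro D (rfl | rfl)
    · refine ⟨⟨_, p, hp, rfl⟩, ?_, hpa⟩
      intro v hv
      rw [Walk.mem_verts_toSubgraph, hps] at hv
      obtain ⟨t, -, rfl⟩ := hv
      exact ⟨_, rfl⟩
    · refine ⟨⟨_, q, hq, rfl⟩, ?_, hqa.symm⟩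
      intro v hv
      rw [Walk.mem_verts_toSubgraph, hqs] at hv
      obtain ⟨t, -, rfl⟩ := hv
      exact ⟨_, rfl⟩

theorem cycleSubgraph_adj (hc : IsLongCycle G c) {i j : ZMod n} :
    (cycleSubgraph G c).Adj (c i) (c j) ↔ j = i + 1 ∨ i = j + 1 := by
  constructor
  · rintro ⟨-, k, hk⟩
    rcases Sym2.eq_iff.1 hk with ⟨h1, h2⟩ | ⟨h1, h2⟩
    · rw [hc.injective h1, hc.injective h2]
      exact Or.inl rfl
    · rw [hc.injective h1, hc.injective h2]
      exact Or.inr rfl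
  · rintro (rfl | rfl)
    · exact ⟨hc.adj i, i, rfl⟩
    · exact ⟨(hc.adj j).symm, j, Sym2.eq_swap⟩

/-- A cycle on vertices of `c` other than `c` has a chord of `c`. -/
theorem exists_chord (hc : IsLongCycle G c) {D : G.Subgraph} (hD : IsCyc D)
    (hDc : D.verts ⊆ range c) (hne : D ≠ cycleSubgraph G c) :
    ∃ i j, D.Adj (c i) (c j) ∧ j ≠ i + 1 ∧ i ≠ j + 1 := by
  have := hc.neZero
  by_contra hcon
  push Not at hcon
  obtain ⟨v, p, hp, rfl⟩ := hD
  -- Without chords the only possible neighbors are the two along `c`. A cycle has degree two at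
  -- each vertex, so it uses both and runs through all of `c`.
  have hstep : ∀ i, c i ∈ p.toSubgraph.verts →
      p.toSubgraph.Adj (c i) (c (i + 1)) ∧ p.toSubgraph.Adj (c i) (c (i - 1)) := by
    intro i hi
    have hsub : p.toSubgraph.neighborSet (c i) ⊆ {c (i + 1), c (i - 1)} := by
      intro w hw
      obtain ⟨j, rfl⟩ := hDc (Subgraph.Adj.snd_mem hw)
      by_cases hj : j = i + 1
      · rw [hj]; simp
      · rw [hcon i j hw hj]; simp
    have hcard := hp.ncard_neighborSet_toSubgraph_eq_two ((Walk.mem_verts_toSubgraph p).1 hi)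
    have heq : p.toSubgraph.neighborSet (c i) = {c (i + 1), c (i - 1)} := by
      refine Set.eq_of_subset_of_ncard_le hsub ?_ (by simp)
      rw [hcard]
      exact (Set.ncard_insert_le _ _).trans (by simp)
    constructor
    · have : c (i + 1) ∈ p.toSubgraph.neighborSet (c i) := by rw [heq]; simp
      exact this
    · have : c (i - 1) ∈ p.toSubgraph.neighborSet (c i) := by rw [heq]; simp
      exact this
  have hall : ∀ i, c i ∈ p.toSubgraph.verts := by
    obtain ⟨j, hj⟩ := hDc p.start_mem_verts_toSubgraph
    have key : ∀ i, c (j + i) ∈ p.toSubgraph.verts := by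
      refine ZMod.induction_succ ?_ ?_
      · rw [add_zero, hj]
        exact p.start_mem_verts_toSubgraph
      · intro i hi
        rw [← add_assoc]
        exact (hstep _ hi).1.snd_mem
    intro i
    simpa using key (i - j)
  refine hne (Subgraph.ext ?_ ?_)
  · refine Subset.antisymm hDc ?_
    rintro _ ⟨i, rfl⟩
    exact hall i
  · ext a b
    constructor
    · intro hab
      obtain ⟨i, rfl⟩ := hDc hab.fst_mem
      obtain ⟨j, rfl⟩ := hDc hab.snd_mem
      rw [hc.cycleSubgraph_adj]
      by_cases hj : j = i + 1
      · exact Or.inl hj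
      · exact Or.inr (hcon i j hab hj)
    · rintro ⟨-, i, hi⟩
      rcases Sym2.eq_iff.1 hi with ⟨rfl, rfl⟩ | ⟨rfl, rfl⟩
      · exact (hstep i (hall i)).1
      · exact (hstep i (hall i)).1.symm

end IsLongCycle

/-! ### Induced subgraphs and walks -/

section Walks

variable {V : Type*} {G : SimpleGraph V}

theorem isAcyclic_induce_iff {S : Set V} : (G.induce S).IsAcyclic ↔
    ∀ (v : V) (p : G.Walk v v), p.IsCycle → ¬ ∀ x ∈ p.support, x ∈ S := by
  constructor
  · intro h v p hp hS
    refine h (p.induce S hS) ?_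
    rw [← Walk.isCycle_map_iff_of_injective (f := (Embedding.induce (G := G) S).toHom)
      (Embedding.induce (G := G) S).injective]
    exact (Walk.map_induce p hS).symm ▸ hp
  · intro h v p hp
    refine h _ (p.map (Embedding.induce S).toHom)
      ((Walk.isCycle_map_iff_of_injective (f := (Embedding.induce (G := G) S).toHom)
        (Embedding.induce (G := G) S).injective).2 hp) ?_
    intro x hx
    rw [Walk.support_map, List.mem_map] at hx
    obtain ⟨y, -, rfl⟩ := hx
    exact y.2

/-- The vertices that can be reached from `v` inside `S`. -/
def compIn (G : SimpleGraph V) (S : Set V) (v : V) : Set V :=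
  {w | ∃ p : G.Walk v w, ∀ x ∈ p.support, x ∈ S}

theorem compIn_subset {S : Set V} {v : V} : compIn G S v ⊆ S :=
  fun _ ⟨p, hp⟩ => hp _ p.end_mem_support

theorem self_mem_compIn {S : Set V} {v : V} (hv : v ∈ S) : v ∈ compIn G S v :=
  ⟨.nil, by simpa using hv⟩

theorem compIn_closed {S : Set V} {u v w : V} (hv : v ∈ compIn G S u) (h : G.Adj v w)
    (hw : w ∈ S) : w ∈ compIn G S u := by
  obtain ⟨p, hp⟩ := hv
  refine ⟨p.concat h, fun x hx => ?_⟩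
  rw [Walk.support_concat, List.mem_append, List.mem_singleton] at hx
  rcases hx with hx | rfl
  · exact hp x hx
  · exact hw

theorem compIn_eq {S : Set V} {v w : V} (hv : v ∈ S) (hw : w ∈ S) (h : G.Adj v w) :
    compIn G S v = compIn G S w := by
  have key : ∀ v w : V, v ∈ S → w ∈ S → G.Adj v w → compIn G S w ⊆ compIn G S v := by
    rintro v w hv hw h x ⟨p, hp⟩
    refine ⟨.cons h p, fun y hy => ?_⟩
    rw [Walk.support_cons, List.mem_cons] at hy
    rcases hy with rfl | hy
    · exact hv
    · exact hp y hy
  exact Subset.antisymm (key w v hw hv h.symm) (key v w hv hw h)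

theorem connected_induce {S : Set V} {v : V} (hv : v ∈ S) (h : S ⊆ compIn G S v) :
    (G.induce S).Connected := by
  rw [connected_iff_exists_forall_reachable]
  refine ⟨⟨v, hv⟩, fun ⟨w, hw⟩ => ?_⟩
  obtain ⟨p, hp⟩ := h hw
  exact ⟨p.induce S hp⟩

theorem SimpleGraph.Walk.IsCycle.exists_two_darts {u : V} {p : G.Walk u u} (hp : p.IsCycle) :
    ∃ x y : G.Dart, x.edge ∈ p.edges ∧ y.edge ∈ p.edges ∧ x.edge ≠ y.edge := by
  have h3 := hp.three_le_length
  have h0 : 0 < p.edges.length := by rw [Walk.length_edges]; omega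
  have h1 : 1 < p.edges.length := by rw [Walk.length_edges]; omega
  obtain ⟨x, hx⟩ := exists_dart_of_mem (p.edges_subset_edgeSet (p.edges.getElem_mem h0))
  obtain ⟨y, hy⟩ := exists_dart_of_mem (p.edges_subset_edgeSet (p.edges.getElem_mem h1))
  refine ⟨x, y, hx ▸ p.edges.getElem_mem h0, hy ▸ p.edges.getElem_mem h1, ?_⟩
  rw [hx, hy]
  intro h
  have := (hp.edges_nodup.getElem_inj_iff).1 h
  omega

theorem SimpleGraph.Walk.dart_fst_mem_support {u v : V} {p : G.Walk u v} {x : G.Dart}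
    (hx : x.edge ∈ p.edges) : x.fst ∈ p.support := p.fst_mem_support_of_mem_edges hx

theorem SimpleGraph.Walk.dart_snd_mem_support {u v : V} {p : G.Walk u v} {x : G.Dart}
    (hx : x.edge ∈ p.edges) : x.snd ∈ p.support := p.snd_mem_support_of_mem_edges hx

theorem exists_mem_gam {n : ℕ} {c : ZMod n → V} {u v : V} (p : G.Walk u v) (hu : u ∈ range c)
    (hv : v ∉ range c) : ∃ x ∈ p.support, x ∈ gam G c := by
  induction p with
  | nil => exact absurd hu hv
  | @cons u w v h p ih =>
    by_cases hw : w ∈ range c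
    · obtain ⟨x, hx, hx'⟩ := ih hw hv
      exact ⟨x, by simp [hx], hx'⟩
    · obtain ⟨i, rfl⟩ := hu
      exact ⟨w, by simp, hw, i, h.symm⟩

end Walks

/-! ### Chordless and closed cycles -/

theorem decide_eq_ne {α : Type*} [DecidableEq α] {a b x y : α} (hx : x = a ∨ x = b)
    (hy : y = a ∨ y = b) (hxy : x ≠ y) : decide (x = a) ≠ decide (y = a) := by
  rw [ne_eq, decide_eq_decide]
  rintro h
  rcases hx with rfl | rfl
  · exact hxy (h.1 rfl).symm
  · rcases hy with rfl | rfl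
    · exact hxy (h.2 rfl)
    · exact hxy rfl

section Closed

variable {V : Type*} {G : SimpleGraph V}

theorem Chordless.eq_or_eq {n : ℕ} {c : ZMod n → V} (hc : IsLongCycle G c) (h : Chordless G c)
    {i j : ZMod n} (hij : G.Adj (c i) (c j)) : j = i + 1 ∨ i = j + 1 := by
  rw [← hc.cycleSubgraph_adj, ← h]
  exact ⟨⟨i, rfl⟩, ⟨j, rfl⟩, hij⟩

theorem exists_chord_of_not_chordless {n : ℕ} {c : ZMod n → V} (hc : IsLongCycle G c)
    (h : ¬ Chordless G c) : ∃ i j, G.Adj (c i) (c j) ∧ j ≠ i + 1 ∧ i ≠ j + 1 := by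
  by_contra hcon
  push Not at hcon
  refine h (Subgraph.ext rfl ?_)
  ext a b
  constructor
  · rintro ⟨⟨i, rfl⟩, ⟨j, rfl⟩, hij⟩
    have hij : G.Adj (c i) (c j) := hij
    rw [hc.cycleSubgraph_adj]
    by_cases hj : j = i + 1
    · exact Or.inl hj
    · exact Or.inr (hcon i j hij hj)
  · intro hab
    exact ⟨(cycleSubgraph G c).edge_vert hab, (cycleSubgraph G c).edge_vert hab.symm, hab.1⟩

open Classical in
/-- The parity of the subscript of a vertex of the cycle. -/
def subscriptOdd {n : ℕ} (c : ZMod n → V) (v : V) : Bool := decide (∃ i, Odd i.val ∧ c i = v)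

theorem subscriptOdd_apply {n : ℕ} {c : ZMod n → V} (hc : IsLongCycle G c) (i : ZMod n) :
    subscriptOdd c (c i) = decide (Odd i.val) := by
  refine decide_eq_decide.2 ⟨?_, fun h => ⟨i, h, rfl⟩⟩
  rintro ⟨j, hj, hji⟩
  rwa [← hc.injective hji]

theorem Chordless.properOn {m : ℕ} {c : ZMod (2 * m) → V} (hc : IsLongCycle G c)
    (h : Chordless G c) : ProperOn G (range c) (subscriptOdd c) := by
  have := hc.neZero
  rintro _ ⟨i, rfl⟩ _ ⟨j, rfl⟩ hij
  rw [subscriptOdd_apply hc, subscriptOdd_apply hc]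
  rcases h.eq_or_eq hc hij with rfl | rfl
  · rw [ne_eq, decide_eq_decide, odd_val_add_one]
    tauto
  · rw [ne_eq, decide_eq_decide, odd_val_add_one]
    tauto

theorem ClosedCycleTree.twoColorable {m : ℕ} {c : ZMod (2 * m) → V} (hc : IsLongCycle G c)
    (h : ClosedCycleTree G c) : TwoColorable G (range c) := by
  obtain ⟨⟨h1, -⟩, h2, h3⟩ := h
  refine IsDecomposition.twoColorable hc (V₁ := range c) ⟨subset_rfl, ?_, ?_⟩
  · exact bipartite_induce_iff.2 ⟨_, h1.properOn hc⟩
  · rw [← h2]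
    exact h3.isBipartite

/-- V₁ consists of C and the inner vertices with the two colors not used on Γ*. All neighbors of C
carry the other two colors, so no edge joins C to the rest of V₁, and the two pieces are bipartite
independently. -/
theorem ClosedCycleCycle.twoColorable {m : ℕ} {c : ZMod (2 * m) → V} (hc : IsLongCycle G c)
    (h : ClosedCycleCycle G c) : TwoColorable G (range c) := by
  classical
  obtain ⟨⟨h1, h2⟩, -, f, hf⟩ := h
  obtain ⟨a, b, hab, hS⟩ := Set.ncard_eq_two.1 hf
  have key : ∀ a b : Fin 4, a ≠ b → ∃ p : Fin 4, ∀ x y : Fin 4, ¬ (x = a ∨ x = b) →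
      ¬ (y = a ∨ y = b) → x ≠ y → decide (x = p) ≠ decide (y = p) := by decide
  obtain ⟨p, hp⟩ := key a b hab
  set k : V → Fin 4 := fun v => if hv : v ∈ (range c)ᶜ then f ⟨v, hv⟩ else 0 with hk
  have hkv : ∀ v, ∀ hv : v ∈ (range c)ᶜ, k v = f ⟨v, hv⟩ := fun v hv => dif_pos hv
  have hproper : ∀ x ∉ range c, ∀ y ∉ range c, G.Adj x y → k x ≠ k y := by
    intro x hx y hy hxy
    rw [hkv x hx, hkv y hy]
    exact f.valid hxy
  have hgam : ∀ v ∈ gamStar G c, k v = a ∨ k v = b := by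
    intro v hv
    have : f ⟨v, hv.1⟩ ∈ f '' (Subtype.val ⁻¹' gamStar G c) := ⟨_, hv, rfl⟩
    rw [hS] at this
    rw [hkv v hv.1]
    exact this
  refine IsDecomposition.twoColorable hc
    (V₁ := range c ∪ {v | ¬ (k v = a ∨ k v = b)}) ⟨subset_union_left, ?_, ?_⟩
  · refine bipartite_induce_iff.2
      ⟨fun v => if v ∈ range c then subscriptOdd c v else decide (k v = p), ?_⟩
    have hno : ∀ x ∈ range c, ∀ y ∉ range c, ¬ (k y = a ∨ k y = b) → ¬ G.Adj x y := by
      rintro _ ⟨i, rfl⟩ y hy hky hxy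
      exact hky (hgam y (h2 ▸ ⟨hy, i, hxy.symm⟩))
    intro x hx y hy hxy
    by_cases hxc : x ∈ range c <;> by_cases hyc : y ∈ range c
    · simp only [hxc, hyc, if_true]
      exact h1.properOn hc x hxc y hyc hxy
    · exact absurd hxy (hno x hxc y hyc (hy.resolve_left hyc))
    · exact absurd hxy.symm (hno y hyc x hxc (hx.resolve_left hxc))
    · simp only [hxc, hyc, if_false]
      exact hp _ _ (hx.resolve_left hxc) (hy.resolve_left hyc) (hproper x hxc y hyc hxy)
  · refine bipartite_induce_iff.2 ⟨fun v => decide (k v = a), ?_⟩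
    intro x hx y hy hxy
    simp only [mem_compl_iff, mem_union, not_or, mem_ofPred_eq] at hx hy
    have := hproper x hx.1 y hy.1 hxy
    exact decide_eq_ne (not_not.1 (by rw [not_or]; exact hx.2))
      (not_not.1 (by rw [not_or]; exact hy.2)) this

end Closed

/-! ### Closed cycles in the plane: enclosing cycles and the cycle-fence type -/

namespace PlaneEmbedding

variable {V : Type*} [Fintype V] {G : SimpleGraph V} {E : PlaneEmbedding G}

theorem exists_dart_fst (E : PlaneEmbedding G) {v w : V} (h : v ≠ w) : ∃ x : G.Dart, x.fst = v := by
  obtain ⟨p⟩ := E.connected.preconnected v w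
  cases p with
  | nil => exact absurd rfl h
  | cons h p => exact ⟨⟨(v, _), h⟩, rfl⟩

variable {n : ℕ} {c : ZMod n → V}

/-- C is connected and avoids the walk, so it lies in one face of it. -/
theorem sameFace_of_mem_range (hc : IsLongCycle G c) {u v : V} {p : G.Walk u v}
    (hp : ∀ i, c i ∉ p.support) {x y : G.Dart} (hx : x.fst ∈ range c) (hy : y.fst ∈ range c) :
    E.SameFace p.edgesSet x y := by
  obtain ⟨i, hi⟩ := hx
  obtain ⟨j, hj⟩ := hy
  obtain ⟨q, hq⟩ := hc.exists_walk i j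
  refine sameFace_of_walk q (fun w hw => ?_) hi.symm hj.symm
  obtain ⟨k, rfl⟩ := hq w hw
  exact Walk.notMem_of_notMem_support (hp k)

theorem sameFace_of_adj_cycle (hc : IsLongCycle G c) {u v : V} {p : G.Walk u v}
    (hp : ∀ i, c i ∉ p.support) {x y : G.Dart} (hx : x.fst ∉ p.support) {i : ZMod n}
    (hi : G.Adj x.fst (c i)) (hy : y.fst ∈ range c) : E.SameFace p.edgesSet x y := by
  refine SameFace.trans (y := Dart.symm ⟨(x.fst, c i), hi⟩) ?_
    (sameFace_of_mem_range hc hp ⟨i, rfl⟩ hy)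
  refine sameFace_of_walk (.cons hi .nil) (fun w hw => ?_) rfl rfl
  simp only [Walk.support_cons, Walk.support_nil, List.mem_cons, List.not_mem_nil, or_false] at hw
  rcases hw with rfl | rfl
  · exact Walk.notMem_of_notMem_support hx
  · exact Walk.notMem_of_notMem_support (hp i)

/-- A union of components of the graph without the closed cycle and its neighbors is enclosed by a
cycle of neighbors of the closed cycle. -/
theorem IsSemiMaximal.exists_enclosing_cycle (hE : E.IsSemiMaximal c) {v : V}
    (hv : v ∈ (range c ∪ gam G c)ᶜ) :
    ∃ (u : V) (p : G.Walk u u), p.IsCycle ∧ (∀ w ∈ p.support, w ∈ gam G c) ∧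
      ∀ x ∈ gam G c, ∀ w ∈ compIn G (range c ∪ gam G c)ᶜ v, G.Adj x w → x ∈ p.support := by
  have hc := hE.isCycle
  obtain ⟨d, hd⟩ := E.exists_dart_fst (w := c 0) (fun h => hv (Or.inl ⟨0, h.symm⟩))
  have hdisj : Disjoint (compIn G (range c ∪ gam G c)ᶜ v) (range c) :=
    disjoint_left.2 fun z hz hzc => compIn_subset hz (Or.inl hzc)
  have hclosed : ∀ z ∈ compIn G (range c ∪ gam G c)ᶜ v, ∀ w, G.Adj z w → w ∉ gam G c →
      w ∈ compIn G (range c ∪ gam G c)ᶜ v := by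
    intro z hz w hzw hw
    refine compIn_closed hz hzw ?_
    rintro (⟨i, rfl⟩ | hw')
    · exact compIn_subset hz (Or.inr ⟨fun h => compIn_subset hz (Or.inl h), i, hzw⟩)
    · exact hw hw'
  obtain ⟨u, p, hp, hpS, hsep⟩ := hE.exists_isCycle hdisj hclosed (x := d) (y := hc.dart 0)
    (by rw [hd]; exact self_mem_compIn hv) (Or.inl ⟨0, rfl⟩)
  refine ⟨u, p, hp, hpS, fun x hx w hw hxw => ?_⟩
  by_contra hxp
  have hpc : ∀ i, c i ∉ p.support := fun i hi => (hpS _ hi).1 ⟨i, rfl⟩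
  obtain ⟨i, hi⟩ := hx.2
  obtain ⟨q, hq⟩ := hw
  -- A neighbor `x` of C off the enclosing cycle would give a connection from the component through
  -- `x` to C that avoids this cycle.
  refine hsep (SameFace.trans ?_ (sameFace_of_adj_cycle hc hpc (x := ⟨(x, w), hxw⟩) hxp hi
    ⟨0, rfl⟩))
  refine sameFace_of_walk (q.concat hxw.symm) (fun z hz => ?_) hd rfl
  rw [Walk.support_concat, List.mem_append, List.mem_singleton] at hz
  refine Walk.notMem_of_notMem_support fun hzp => ?_
  rcases hz with hz | rfl
  · exact hq z hz (Or.inr (hpS z hzp))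
  · exact hxp hzp

/-- C gets colors 2 and 3, and Γ gets 0 and 1 from the bipartition of the fence. The neighbors in Γ
of each remaining component lie on one even cycle. A coloring using two colors on that cycle, after
a permutation of colors, agrees there with the bipartition and can be used on the component. -/
theorem _root_.ClosedCycleFence.twoColorable {m : ℕ} {c : ZMod (2 * m) → V}
    (hE : E.IsSemiMaximal c) (h : ClosedCycleFence E c) : TwoColorable G (range c) := by
  classical
  obtain ⟨⟨h1, h2⟩, -, hF, hcyc⟩ := h
  have hc := hE.isCycle
  have := hc.neZero
  rw [← h2] at hF hcyc
  obtain ⟨h, H⟩ := not_hasOddCycle_iff.1 hF.not_hasOddCycle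
  set R : Set V := (range c ∪ gam G c)ᶜ with hR
  -- Indexing by the component as a set, not by a vertex of it, makes adjacent vertices of R use the
  -- same chosen coloring.
  have key : ∀ Z : Set V, ∃ f : V → Fin 4, ∀ v ∈ R, Z = compIn G R v →
      (∀ x ∉ range c, ∀ y ∉ range c, G.Adj x y → f x ≠ f y) ∧
      ∀ x ∈ gam G c, ∀ w ∈ Z, G.Adj x w → f x = if h x then 1 else 0 := by
    intro Z
    by_cases hZ : ∃ v ∈ R, Z = compIn G R v
    swap
    · exact ⟨fun _ => 0, fun v hv hvZ => absurd ⟨v, hv, hvZ⟩ hZ⟩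
    obtain ⟨v, hv, rfl⟩ := hZ
    obtain ⟨u, p, hp, hpS, hnb⟩ := hE.exists_enclosing_cycle hv
    have hpE : Even p.length := (H.parity p hpS).1 rfl
    obtain ⟨f, hf⟩ := hcyc p.toSubgraph ⟨fun x hx => hpS x ((Walk.mem_verts_toSubgraph p).1 hx),
      u, p, hp, hpE, rfl⟩
    obtain ⟨a, b, hab, hS⟩ := Set.ncard_eq_two.1 hf
    set k : V → Fin 4 := fun v => if hv : v ∈ (range c)ᶜ then f ⟨v, hv⟩ else 0 with hk
    have hkv : ∀ v, ∀ hv : v ∈ (range c)ᶜ, k v = f ⟨v, hv⟩ := fun v hv => dif_pos hv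
    have hproper : ∀ x ∉ range c, ∀ y ∉ range c, G.Adj x y → k x ≠ k y := by
      intro x hx y hy hxy
      rw [hkv x hx, hkv y hy]
      exact f.valid hxy
    have hkp : ∀ x ∈ p.support, k x = a ∨ k x = b := by
      intro x hx
      have hxc : x ∈ (range c)ᶜ := (hpS x hx).1
      have : f ⟨x, hxc⟩ ∈ f '' (Subtype.val ⁻¹' p.toSubgraph.verts) :=
        ⟨_, (Walk.mem_verts_toSubgraph p).2 hx, rfl⟩
      rw [hS] at this
      rw [hkv x hxc]
      exact this
    have hK : ProperOn G {x | x ∈ p.support} (fun x => decide (k x = a)) := by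
      intro x hx y hy hxy
      have := hproper x (hpS x hx).1 y (hpS y hy).1 hxy
      exact decide_eq_ne (hkp x hx) (hkp y hy) this
    have hH : ProperOn G {x | x ∈ p.support} h := H.mono hpS
    -- Both two-colorings alternate along the cycle, so they agree or are opposite on it as a whole;
    -- the value at `u` decides which.
    have hrel : ∀ x ∈ p.support, (h u = h x ↔ decide (k u = a) = decide (k x = a)) := by
      intro x hx
      have hsub : ∀ y ∈ (p.takeUntil x hx).support, y ∈ {x | x ∈ p.support} :=
        fun y hy => p.support_takeUntil_subset_support hx hy
      rw [hH.parity _ hsub, hK.parity _ hsub]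
    have hperm : ∀ a b : Fin 4, a ≠ b → ∀ t : Bool, ∃ π : Equiv.Perm (Fin 4),
        π a = (if t then 1 else 0) ∧ π b = (if t then 0 else 1) := by decide
    obtain ⟨π, hπa, hπb⟩ := hperm a b hab (if k u = a then h u else !(h u))
    refine ⟨fun v => π (k v), fun v' _ _ =>
      ⟨fun x hx y hy hxy heq => hproper x hx y hy hxy (π.injective heq), fun x hx w hw hxw => ?_⟩⟩
    have hxp := hnb x hx w hw hxw
    have ht : (if k u = a then h u else !(h u)) = if k x = a then h x else !(h x) := by
      have hr := hrel x hxp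
      by_cases hu : k u = a <;> by_cases hx : k x = a <;> simp only [hu, hx, if_true, if_false] <;>
        simp only [hu, hx, decide_true, decide_false] at hr <;> revert hr <;>
        cases h u <;> cases h x <;> simp
    rw [ht] at hπa hπb
    change π (k x) = _
    rcases hkp x hxp with hx' | hx'
    · rw [if_pos hx'] at hπa
      rw [hx', hπa]
    · rw [if_neg (hx'.trans_ne hab.symm)] at hπb
      rw [hx', hπb]
      cases h x <;> rfl
  choose F hF' using key
  set g : V → Fin 4 := fun v => if v ∈ range c then (if subscriptOdd c v then 3 else 2) else
    if v ∈ gam G c then (if h v then 1 else 0) else F (compIn G R v) v with hg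
  have gc : ∀ v ∈ range c, g v = if subscriptOdd c v then 3 else 2 := fun v hv => if_pos hv
  have gg : ∀ v ∈ gam G c, g v = if h v then 1 else 0 := fun v hv => by
    simp only [hg]
    rw [if_neg hv.1, if_pos hv]
  have gr : ∀ v ∈ R, g v = F (compIn G R v) v := fun v hv => by
    rw [hR, mem_compl_iff, mem_union, not_or] at hv
    simp only [hg]
    rw [if_neg hv.1, if_neg hv.2]
  have cases3 : ∀ v, v ∈ range c ∨ v ∈ gam G c ∨ v ∈ R := by
    intro v
    by_cases h1 : v ∈ range c
    · exact Or.inl h1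
    · by_cases h2 : v ∈ gam G c
      · exact Or.inr (Or.inl h2)
      · exact Or.inr (Or.inr (by simp [hR, h1, h2]))
  have hnot : ∀ x ∈ range c, ∀ y ∈ R, ¬ G.Adj x y := by
    rintro _ ⟨i, rfl⟩ y hy hxy
    exact hy (Or.inr ⟨fun h => hy (Or.inl h), i, hxy.symm⟩)
  have hcg : ∀ x ∈ range c, ∀ y ∈ gam G c, g x ≠ g y := by
    intro x hx y hy
    rw [gc x hx, gg y hy]
    split_ifs <;> decide
  have hgr : ∀ x ∈ gam G c, ∀ y ∈ R, G.Adj x y → g x ≠ g y := by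
    intro x hx y hy hxy
    obtain ⟨h3, h4⟩ := hF' _ y hy rfl
    rw [gg x hx, gr y hy, ← h4 x hx y (self_mem_compIn hy) hxy]
    exact h3 x hx.1 y (fun h => hy (Or.inl h)) hxy
  have hgood : ∀ {x y}, G.Adj x y → g x ≠ g y := by
    intro x y hxy
    rcases cases3 x with hx | hx | hx <;> rcases cases3 y with hy | hy | hy
    · have := h1.properOn hc x hx y hy hxy
      rw [gc x hx, gc y hy]
      revert this
      cases subscriptOdd c x <;> cases subscriptOdd c y <;> simp
    · exact hcg x hx y hy
    · exact absurd hxy (hnot x hx y hy)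
    · exact (hcg y hy x hx).symm
    · have := H x hx y hy hxy
      rw [gg x hx, gg y hy]
      revert this
      cases h x <;> cases h y <;> simp
    · exact hgr x hx y hy hxy
    · exact absurd hxy.symm (hnot y hy x hx)
    · exact (hgr y hy x hx hxy.symm).symm
    · rw [gr x hx, gr y hy, compIn_eq hx hy hxy]
      exact (hF' _ y hy rfl).1 x (fun h => hx (Or.inl h)) y (fun h => hy (Or.inl h)) hxy
  refine twoColorable_of_coloring hc (a := 3) (b := 2) (by decide) (Coloring.mk g hgood) fun i => ?_
  change g (c i) = 3 ∨ g (c i) = 2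
  rw [gc _ ⟨i, rfl⟩]
  split_ifs <;> simp

end PlaneEmbedding

/-! ### From decompositions to the structural types -/

section Decomposition

variable {V : Type*} {G : SimpleGraph V} {m : ℕ} {c : ZMod (2 * m) → V} {V₁ : Set V}

theorem even_length_of_isBipartite {S : Set V} (hS : (G.induce S).IsBipartite) {v : V}
    (p : G.Walk v v) (hp : ∀ x ∈ p.support, x ∈ S) : Even p.length := by
  obtain ⟨h, H⟩ := bipartite_induce_iff.1 hS
  exact (H.parity p hp).1 rfl

theorem IsCyc.isEvenCycIn {S : Set V} (hS : (G.induce S).IsBipartite) {D : G.Subgraph}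
    (hD : IsCyc D) (hDS : D.verts ⊆ S) : IsEvenCycIn S D := by
  refine ⟨hDS, ?_⟩
  obtain ⟨v, p, hp, rfl⟩ := hD
  exact ⟨v, p, hp, even_length_of_isBipartite hS p fun x hx =>
    hDS ((Walk.mem_verts_toSubgraph p).2 hx), rfl⟩

theorem IsEvenCycIn.isCyc {S : Set V} {D : G.Subgraph} (h : IsEvenCycIn S D) : IsCyc D := by
  obtain ⟨-, v, p, hp, -, hD⟩ := h
  exact ⟨v, p, hp, hD⟩

theorem IsCyc.exists_adj {D : G.Subgraph} (h : IsCyc D) : ∃ x y, D.Adj x y := by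
  obtain ⟨v, p, hp, rfl⟩ := h
  exact ⟨_, _, p.toSubgraph_adj_snd hp.not_nil⟩

theorem IsDecomposition.twoColorableOff_of_isEvenCycIn (hc : IsLongCycle G c)
    (h : IsDecomposition G c V₁) {X : Set V} (hX : X ⊆ V₁) {D : G.Subgraph}
    (hD : IsEvenCycIn V₁ᶜ D) : TwoColorableOff G X D.verts := by
  obtain ⟨x, y, hxy⟩ := hD.isCyc.exists_adj
  exact h.twoColorableOff hc hX hD.1 hxy.fst_mem hxy.snd_mem hxy.adj_sub

theorem cycleComponent_subset {n : ℕ} {c : ZMod n → V} : cycleComponent G c V₁ ⊆ V₁ :=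
  compIn_subset

theorem IsDecomposition.mem_cycleComponent (hc : IsLongCycle G c) (h : IsDecomposition G c V₁)
    (i : ZMod (2 * m)) : c i ∈ cycleComponent G c V₁ := by
  obtain ⟨p, hp⟩ := hc.exists_walk 0 i
  exact ⟨p, fun x hx => h.cycle_subset (hp x hx)⟩

/-- The coloring of the decomposition uses only two colors on G₂, so 2-colorability of its cycles
costs nothing. -/
theorem IsDecomposition.rightCycles (hc : IsLongCycle G c) (h : IsDecomposition G c V₁)
    (hcyc : ¬ (G.induce V₁ᶜ).IsAcyclic) : RightCycles G c V₁ := by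
  refine ⟨?_, fun D hD => h.twoColorableOff_of_isEvenCycIn hc cycleComponent_subset hD⟩
  rw [isAcyclic_induce_iff] at hcyc
  push Not at hcyc
  obtain ⟨v, p, hp, hpS⟩ := hcyc
  refine ⟨p.toSubgraph, IsCyc.isEvenCycIn h.bipartite_right ⟨v, p, hp, rfl⟩ fun x hx => ?_⟩
  exact hpS x ((Walk.mem_verts_toSubgraph p).1 hx)

/-- The two cycles that a chord of `c` forms with `c`. -/
theorem IsDecomposition.exists_other_cycles (hc : IsLongCycle G c) (h : IsDecomposition G c V₁)
    {i j : ZMod (2 * m)} (hij : G.Adj (c i) (c j)) (h1 : j ≠ i + 1) (h2 : i ≠ j + 1) :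
    ∃ D₁ D₂ : G.Subgraph, D₁ ≠ D₂ ∧ (∀ i', c i' ∈ D₁.verts ∨ c i' ∈ D₂.verts) ∧
      ∀ D, D = D₁ ∨ D = D₂ → IsOtherEvenCyc G c V₁ D ∧ D.Adj (c i) (c j) ∧
        2 ≤ (D.verts ∩ range c).ncard := by
  obtain ⟨D₁, D₂, hne, hcov, hD⟩ := hc.exists_chord_cycles hij h1 h2
  refine ⟨D₁, D₂, hne, hcov, fun D hD' => ?_⟩
  obtain ⟨hcyc, hsub, hadj⟩ := hD D hD'
  refine ⟨⟨hcyc.isEvenCycIn h.bipartite_left (hsub.trans h.cycle_subset), ?_⟩, hadj, ?_⟩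
  · rintro rfl
    rcases hc.cycleSubgraph_adj.1 hadj with h | h
    exacts [h1 h, h2 h]
  · have hsub : {c i, c j} ⊆ D.verts ∩ range c := by
      rintro x (rfl | rfl)
      · exact ⟨hadj.fst_mem, i, rfl⟩
      · exact ⟨hadj.snd_mem, j, rfl⟩
    have := hc.neZero
    exact (Set.ncard_pair hij.ne).symm.le.trans
      (Set.ncard_le_ncard hsub ((Set.finite_range c).inter_of_right _))

theorem IsDecomposition.isIntersectedFamily (hc : IsLongCycle G c) (h : IsDecomposition G c V₁)
    (hch : ¬ Chordless G c) : IsIntersectedFamily G c V₁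
      {D | IsOtherEvenCyc G c V₁ D ∧ 2 ≤ (D.verts ∩ range c).ncard} := by
  obtain ⟨i, j, hij, h1, h2⟩ := exists_chord_of_not_chordless hc hch
  obtain ⟨D₁, D₂, -, hcov, hD⟩ := h.exists_other_cycles hc hij h1 h2
  have hD₁ := hD D₁ (Or.inl rfl)
  have hD₂ := hD D₂ (Or.inr rfl)
  refine ⟨⟨D₁, hD₁.1, hD₁.2.2⟩, fun D hD => hD, fun i' => ?_⟩
  rcases hcov i' with h | h
  · exact ⟨D₁, ⟨hD₁.1, hD₁.2.2⟩, h⟩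
  · exact ⟨D₂, ⟨hD₂.1, hD₂.2.2⟩, h⟩

theorem IsDecomposition.onlyCycle (h : IsDecomposition G c V₁)
    (hno : ¬ ∃ D, IsOtherEvenCyc G c V₁ D) : OnlyCycle G c V₁ := by
  intro D hD hcyc
  by_contra hne
  exact hno ⟨D, hcyc.isEvenCycIn h.bipartite_left hD, hne⟩

/-- Every edge of `G[C]` is an edge of C or a chord, and a chord lies on the cycles that it forms
with C. -/
theorem IsDecomposition.intersectedForest_of_eq (hc : IsLongCycle G c)
    (h : IsDecomposition G c (range c)) (hch : ¬ Chordless G c)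
    (hacyc : (G.induce (range c)ᶜ).IsAcyclic) : IntersectedForest G c := by
  refine ⟨Or.inr hch, range c, h, ⟨_, h.isIntersectedFamily hc hch, ?_⟩, hacyc⟩
  refine le_antisymm ?_ (sup_le ?_ (sSup_le ?_))
  · constructor
    · exact fun v hv => Or.inl hv
    · rintro a b ⟨⟨i, rfl⟩, ⟨j, rfl⟩, hij⟩
      have hij : G.Adj (c i) (c j) := hij
      by_cases hcyc : (cycleSubgraph G c).Adj (c i) (c j)
      · exact Or.inl hcyc
      · rw [hc.cycleSubgraph_adj, not_or] at hcyc
        obtain ⟨D₁, D₂, -, -, hD⟩ := h.exists_other_cycles hc hij hcyc.1 hcyc.2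
        obtain ⟨h1, h2, h3⟩ := hD D₁ (Or.inl rfl)
        refine Or.inr ?_
        rw [Subgraph.sSup_adj]
        exact ⟨D₁, ⟨h1, h3⟩, h2⟩
  · exact ⟨subset_rfl, fun a b hab => ⟨(cycleSubgraph G c).edge_vert hab,
      (cycleSubgraph G c).edge_vert hab.symm, hab.1⟩⟩
  · rintro D ⟨hD, -⟩
    exact ⟨hD.1.1, fun a b hab => ⟨hD.1.1 hab.fst_mem, hD.1.1 hab.snd_mem, hab.adj_sub⟩⟩

/-- A cycle on vertices of C has a chord of C, and one of the two cycles formed by that chord is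
different and meets it, so a path of length 0 suffices. A cycle leaving C is joined to C inside V₁
through a vertex of Γ; this vertex is opened because Γ* misses V₁. -/
theorem IsDecomposition.scyclesForest (hc : IsLongCycle G c) (h : IsDecomposition G c V₁)
    (hop : Opened G c) (hacyc : (G.induce V₁ᶜ).IsAcyclic) (hconn : V₁ ⊆ cycleComponent G c V₁)
    (hD : ∃ D, IsOtherEvenCyc G c V₁ D) : ScyclesForest G c := by
  classical
  refine ⟨hop, V₁, h, hD, fun D hD => ?_, hacyc⟩
  by_cases hDc : D.verts ⊆ range c
  · left
    obtain ⟨i, j, hij, h1, h2⟩ := hc.exists_chord hD.1.isCyc hDc hD.2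
    obtain ⟨D₁, D₂, hne, -, hD'⟩ := h.exists_other_cycles hc hij.adj_sub h1 h2
    obtain ⟨D', hD'', hne'⟩ : ∃ D', (D' = D₁ ∨ D' = D₂) ∧ D' ≠ D := by
      by_cases hD₁ : D₁ = D
      · exact ⟨D₂, Or.inr rfl, fun h => hne (hD₁.trans h.symm)⟩
      · exact ⟨D₁, Or.inl rfl, hD₁⟩
    obtain ⟨h3, h4, -⟩ := hD' D' hD''
    exact ⟨D', h3, hne', c i, hij.fst_mem, c i, h4.fst_mem, .nil, Walk.IsPath.nil,
      by simpa using h.cycle_subset ⟨i, rfl⟩⟩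
  · right
    obtain ⟨a, ha, hac⟩ := not_subset.1 hDc
    obtain ⟨p, hp⟩ := hconn (hD.1.1 ha)
    have hp' : ∀ x ∈ p.bypass.reverse.support, x ∈ V₁ := by
      intro x hx
      rw [Walk.support_reverse, List.mem_reverse] at hx
      exact hp x (p.support_bypass_subset_support hx)
    refine ⟨a, ha, 0, p.bypass.reverse, p.bypass_isPath.reverse, hp', ?_⟩
    obtain ⟨x, hx, hxg⟩ := exists_mem_gam p.bypass ⟨0, rfl⟩ hac
    have hx' : x ∈ p.bypass.reverse.support := by
      rw [Walk.support_reverse, List.mem_reverse]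
      exact hx
    exact ⟨x, hx', hxg, fun hs => h.gamStar_subset hc hs (hp' x hx')⟩

end Decomposition

theorem IsLongCycle.not_isOuter_dart_symm {V : Type*} {G : SimpleGraph V} {n : ℕ}
    {c : ZMod n → V} (hc : IsLongCycle G c) (i : ZMod n) :
    ¬ IsOuter c (hc.dart i).symm := by
  rintro ⟨j, hj⟩
  have h1 : c (i + 1) = c j := congrArg Prod.fst hj
  have h2 : c i = c (j + 1) := congrArg Prod.snd hj
  have h3 := hc.injective h1
  have h4 := hc.injective h2
  rw [← h3, add_assoc, left_eq_add] at h4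
  exact hc.natCast_ne_zero (k := 2) (by norm_num) (by norm_num) (by rw [← h4]; norm_num)

/-! ### The neighbors of a chordless cycle -/

namespace PlaneEmbedding

variable {V : Type*} [Fintype V] {G : SimpleGraph V} {E : PlaneEmbedding G} {n : ℕ}
  {c : ZMod n → V}

theorem IsSemiMaximal.apex_mem_gam (hE : E.IsSemiMaximal c) (hch : Chordless G c) (i : ZMod n) :
    E.apex (hE.isCycle.dart i).symm ∈ gam G c ∧ G.Adj (E.apex (hE.isCycle.dart i).symm) (c i) ∧
      G.Adj (E.apex (hE.isCycle.dart i).symm) (c (i + 1)) := by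
  have hc := hE.isCycle
  have h1 : G.Adj (E.apex (hc.dart i).symm) (c i) := (E.adj_apex (hc.dart i).symm).symm
  have h2 : G.Adj (E.apex (hc.dart i).symm) (c (i + 1)) :=
    hE.apex_adj (hc.not_isOuter_dart_symm i)
  refine ⟨⟨?_, i, h1⟩, h1, h2⟩
  rintro ⟨j, hj⟩
  rw [← hj] at h1 h2
  have e1 := hch.eq_or_eq hc h1
  have e2 := hch.eq_or_eq hc h2
  have z1 := hc.natCast_ne_zero (k := 1) (by norm_num) (by norm_num)
  have z3 := hc.natCast_ne_zero (k := 3) (by norm_num) (by norm_num)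
  push_cast at z1 z3
  -- An apex on C would be a C-neighbor of two consecutive vertices, forcing 1 or 3 to vanish modulo
  -- a length of at least 4.
  rcases e1 with e1 | e1 <;> rcases e2 with e2 | e2
  · apply z1
    linear_combination e2 - e1
  · apply z3
    linear_combination -e2 - e1
  · apply z1
    linear_combination -e2 - e1
  · apply z1
    linear_combination e1 - e2

/-- The neighbors of a chordless cycle induce a connected graph. -/
theorem IsSemiMaximal.gam_subset (hE : E.IsSemiMaximal c) (hch : Chordless G c) {A : Set V}
    (hA : ∀ x ∈ gam G c, ∀ y ∈ gam G c, G.Adj x y → (x ∈ A ↔ y ∈ A)) {x y : V}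
    (hx : x ∈ gam G c) (hy : y ∈ gam G c) (hxA : x ∈ A) : y ∈ A := by
  have hc := hE.isCycle
  have := hc.neZero
  set t : ZMod n → V := fun i => E.apex (hc.dart i).symm with ht
  -- Rotate about `c i` starting from `c (i + 1)`. Successive inner neighbors span triangles with `c
  -- i`, so they are adjacent, and the first one is `t i`; the outer face only leads from `c (i -
  -- 1)` back to `c (i + 1)`.
  have key : ∀ i, ∀ z ∈ gam G c, G.Adj (c i) z → (z ∈ A ↔ t i ∈ A) := by
    intro i z hz hiz
    have hind := E.rot_induction (x := hc.dart i) (y := ⟨(c i, z), hiz⟩)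
      (P := fun d => d.snd = c (i + 1) ∨ d.snd = c (i - 1) ∨
        (d.snd ∈ gam G c ∧ (d.snd ∈ A ↔ t i ∈ A))) rfl ?_ (Or.inl rfl)
    · rcases hind with h | h | h
      · exact absurd ⟨_, h.symm⟩ hz.1
      · exact absurd ⟨_, h.symm⟩ hz.1
      · exact h.2
    · rintro ⟨⟨a, b⟩, hab⟩ (rfl : a = c i) hP
      rw [rot_apply]
      change E.apex _ = _ ∨ E.apex _ = _ ∨ _
      rcases hP with (rfl : b = _) | (rfl : b = _) | hP
      · exact Or.inr (Or.inr ⟨(hE.apex_mem_gam hch i).1, Iff.rfl⟩)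
      · left
        have := hE.outer (Dart.symm ⟨(c i, c (i - 1)), hab⟩) (i - 1) (by simp)
        have := congrArg Prod.snd this
        rw [sub_add_cancel] at this
        exact this
      · have ho : ¬ IsOuter c (Dart.symm ⟨(c i, b), hab⟩) := fun h => hP.1.1 h.fst_mem
        have h1 : G.Adj (c i) (E.apex (Dart.symm ⟨(c i, b), hab⟩)) :=
          E.adj_apex (Dart.symm ⟨(c i, b), hab⟩)
        have h2 : G.Adj (E.apex (Dart.symm ⟨(c i, b), hab⟩)) b := hE.apex_adj ho
        by_cases hr : E.apex (Dart.symm ⟨(c i, b), hab⟩) ∈ range c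
        · obtain ⟨j, hj⟩ := hr
          rw [← hj] at h1 ⊢
          rcases hch.eq_or_eq hc h1 with rfl | rfl
          · exact Or.inl rfl
          · right; left; simp
        · have hg : E.apex (Dart.symm ⟨(c i, b), hab⟩) ∈ gam G c := ⟨hr, i, h1.symm⟩
          exact Or.inr (Or.inr ⟨hg, (hA _ hg _ hP.1 h2).trans hP.2⟩)
  -- The apex `t i` is adjacent to both `c i` and `c (i + 1)`, and so links the neighborhoods of
  -- consecutive vertices.
  have hstep : ∀ i, (t 0 ∈ A ↔ t i ∈ A) := by
    refine ZMod.induction_succ Iff.rfl fun i hi => hi.trans ?_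
    obtain ⟨h1, -, h3⟩ := hE.apex_mem_gam hch i
    exact key (i + 1) (t i) h1 h3.symm
  obtain ⟨i, hi⟩ := hx.2
  obtain ⟨j, hj⟩ := hy.2
  rw [key j y hy hj.symm, ← hstep, hstep i, ← key i x hx hi.symm]
  exact hxA

theorem IsSemiMaximal.connected_gam (hE : E.IsSemiMaximal c) (hch : Chordless G c) :
    (G.induce (gam G c)).Connected := by
  have h0 := (hE.apex_mem_gam hch 0).1
  refine connected_induce h0 fun y hy => ?_
  refine hE.gam_subset hch (fun a ha b hb hab => ?_) h0 hy (self_mem_compIn h0)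
  exact ⟨fun h => compIn_closed h hab hb, fun h => compIn_closed h hab.symm ha⟩

/-- If all inner vertices are neighbors of the cycle and induce a bipartite graph, then they induce
a forest. -/
theorem IsSemiMaximal.isAcyclic_gam (hE : E.IsSemiMaximal c) (h : gam G c = (range c)ᶜ)
    (hb : (G.induce (gam G c)).IsBipartite) : (G.induce (gam G c)).IsAcyclic := by
  obtain ⟨k, hk⟩ := bipartite_induce_iff.1 hb
  have hc := hE.isCycle
  refine isAcyclic_induce_iff.2 fun v p hp hpS => ?_
  have hpc : ∀ i, c i ∉ p.support := fun i hi => (hpS _ hi).1 ⟨i, rfl⟩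
  obtain ⟨d, -, hd, -, -⟩ := hp.exists_two_darts
  -- On the side of the cycle away from C, the triangle at a cycle edge has no vertex on C. Then all
  -- its vertices are in Γ, and a triangle is not bipartite.
  obtain ⟨x, hx, hx0⟩ : ∃ x : G.Dart, x.edge ∈ p.edges ∧
      ¬ E.SameFace p.edgesSet x (hc.dart 0) := by
    by_contra hcon
    push Not at hcon
    have h1 := hcon d hd
    have h2 := hcon d.symm (by rwa [Dart.edge_symm])
    exact not_sameFace_symm_of_isCycle (E := E) hp hd (h1.trans h2.symm)
  have hx1 := hpS _ (Walk.dart_fst_mem_support hx)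
  have hx2 := hpS _ (Walk.dart_snd_mem_support hx)
  have ho : ¬ IsOuter c x := fun h => hx1.1 h.fst_mem
  have hnext : E.SameFace p.edgesSet x (E.next (E.next x)) :=
    (E.sameFace_next _ x).trans (E.sameFace_next _ _)
  have hfst : (E.next (E.next x)).fst = E.apex x := E.next_fst _
  by_cases ht : E.apex x ∈ range c
  · exact hx0 (hnext.trans (sameFace_of_mem_range hc hpc (by rwa [hfst]) ⟨0, rfl⟩))
  · have htg : E.apex x ∈ gam G c := by rw [h]; exact ht
    have h1 := hk _ hx1 _ hx2 x.adj
    have h2 := hk _ hx2 _ htg (E.adj_apex x)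
    have h3 := hk _ htg _ hx1 (hE.apex_adj ho)
    revert h1 h2 h3
    cases k x.fst <;> cases k x.snd <;> cases k (E.apex x) <;> simp

end PlaneEmbedding

/-! ### Separation of the two halves and the classification -/

namespace PlaneEmbedding

variable {V : Type*} [Fintype V] {G : SimpleGraph V} {E : PlaneEmbedding G} {m : ℕ}
  {c : ZMod (2 * m) → V} {V₁ : Set V}

theorem isFence_of_range_subset (hc : IsLongCycle G c) {S : Set V} (hS : range c ⊆ S)
    (hb : (G.induce S).IsBipartite) : E.IsFence S := by
  obtain ⟨h, H⟩ := bipartite_induce_iff.1 hb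
  have hmem : ∀ i, (hc.dart i).edge ∈ edgesIn S := fun i =>
    dart_mem_edgesIn.2 ⟨hS ⟨i, rfl⟩, hS ⟨i + 1, rfl⟩⟩
  refine isFence_of_properOn H (hmem 0) (hmem 1) fun he => ?_
  have z1 := hc.natCast_ne_zero (k := 1) (by norm_num) (by norm_num)
  have z2 := hc.natCast_ne_zero (k := 2) (by norm_num) (by norm_num)
  push_cast at z1 z2
  rcases Sym2.eq_iff.1 he with ⟨h1, -⟩ | ⟨h1, -⟩
  · exact z1 (hc.injective h1).symm
  · have h1 := hc.injective h1
    exact z2 (by linear_combination -h1)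

/-- Γ* lies in V₂ and is bipartite. If it is all of the interior, it is connected and acyclic;
otherwise a remaining vertex is enclosed by a cycle in it, which provides the edges that make it a
fence. -/
theorem IsSemiMaximal.closed_type (hE : E.IsSemiMaximal c) (hV : IsDecomposition G c V₁)
    (hcl : Closed G c) : ClosedCycleTree G c ∨ ClosedCycleFence E c := by
  have hc := hE.isCycle
  obtain ⟨hch, hg⟩ := hcl
  have hsub : gamStar G c ⊆ V₁ᶜ := hV.gamStar_subset hc
  have hb : (G.induce (gamStar G c)).IsBipartite := by
    obtain ⟨h, H⟩ := bipartite_induce_iff.1 hV.bipartite_right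
    exact bipartite_induce_iff.2 ⟨h, H.mono hsub⟩
  by_cases hrest : gamStar G c = (range c)ᶜ
  · refine Or.inl ⟨⟨hch, hg⟩, hrest, ?_⟩
    rw [← hg] at hrest hb ⊢
    exact ⟨hE.connected_gam hch, hE.isAcyclic_gam hrest hb⟩
  · right
    refine ⟨⟨hch, hg⟩, hrest, ?_, fun D hD => hV.twoColorableOff_of_isEvenCycIn hc
      hV.cycle_subset ⟨hD.1.trans hsub, hD.2⟩⟩
    obtain ⟨v, hv, hvg⟩ : ∃ v, v ∉ range c ∧ v ∉ gamStar G c := by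
      by_contra hcon
      push Not at hcon
      exact hrest (Subset.antisymm (fun v hv => hv.1) hcon)
    obtain ⟨u, p, hp, hpS, -⟩ := hE.exists_enclosing_cycle (v := v) (by
      rw [hg]; rintro (h | h); exacts [hv h, hvg h])
    rw [hg] at hpS
    obtain ⟨x, y, hx, hy, hxy⟩ := hp.exists_two_darts
    obtain ⟨h, H⟩ := bipartite_induce_iff.1 hb
    exact isFence_of_properOn H
      (dart_mem_edgesIn.2 ⟨hpS _ (Walk.dart_fst_mem_support hx),
        hpS _ (Walk.dart_snd_mem_support hx)⟩)
      (dart_mem_edgesIn.2 ⟨hpS _ (Walk.dart_fst_mem_support hy),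
        hpS _ (Walk.dart_snd_mem_support hy)⟩)
      hxy

/-- A further component of G₁ would be separated from the outer face by a cycle of G₂, which is
acyclic. -/
theorem IsSemiMaximal.subset_cycleComponent (hE : E.IsSemiMaximal c)
    (hV : IsDecomposition G c V₁) (hacyc : (G.induce V₁ᶜ).IsAcyclic) :
    V₁ ⊆ cycleComponent G c V₁ := by
  intro v hv
  by_contra hcon
  have hc := hE.isCycle
  obtain ⟨d, hd⟩ := E.exists_dart_fst (v := v) (w := c 0)
    (fun h => hcon (h ▸ hV.mem_cycleComponent hc 0))
  obtain ⟨u, p, hp, hpS, -⟩ := hE.exists_isCycle (S := V₁ᶜ) (Z := V₁ \ cycleComponent G c V₁)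
    (x := d) (y := hc.dart 0) (disjoint_left.2 fun z hz hzc => by
      obtain ⟨i, rfl⟩ := hzc
      exact hz.2 (hV.mem_cycleComponent hc i)) (fun z hz w hzw hw => by
      rw [mem_compl_iff, not_not] at hw
      exact ⟨hw, fun h => hz.2 (compIn_closed h hzw.symm hz.1)⟩)
    (by rw [hd]; exact ⟨hv, hcon⟩) (Or.inl ⟨0, rfl⟩)
  exact isAcyclic_induce_iff.1 hacyc u p hp hpS

/-- Two components of G₂ would be separated by a cycle of G₁. The only one is C, and everything in
G₂ is on the same side of C. -/
theorem IsSemiMaximal.connected_compl (hE : E.IsSemiMaximal c) (hV : IsDecomposition G c V₁)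
    (honly : OnlyCycle G c V₁) : (G.induce V₁ᶜ).Connected := by
  have hc := hE.isCycle
  -- V₂ is nonempty: the triangle at an edge of C cannot lie in a bipartite graph.
  have hne : E.apex (hc.dart 0).symm ∈ V₁ᶜ := by
    intro h
    obtain ⟨k, hk⟩ := bipartite_induce_iff.1 hV.bipartite_left
    have m0 := hV.cycle_subset ⟨0, rfl⟩
    have m1 := hV.cycle_subset ⟨0 + 1, rfl⟩
    have h1 := hk _ m0 _ m1 (hc.adj 0)
    have h2 := hk _ h _ m0 (E.adj_apex (hc.dart 0).symm).symm
    have h3 := hk _ h _ m1 (hE.apex_adj (hc.not_isOuter_dart_symm 0))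
    revert h1 h2 h3
    cases k (c 0) <;> cases k (c (0 + 1)) <;> cases k (E.apex (hc.dart 0).symm) <;> simp
  generalize E.apex (hc.dart 0).symm = z at hne
  refine connected_induce hne fun w hw => ?_
  by_contra hcon
  have hzc : z ≠ c 0 := fun h => hne (h ▸ hV.cycle_subset ⟨0, rfl⟩)
  have hwc : w ≠ c 0 := fun h => hw (h ▸ hV.cycle_subset ⟨0, rfl⟩)
  obtain ⟨x, rfl⟩ := E.exists_dart_fst hzc
  obtain ⟨y, rfl⟩ := E.exists_dart_fst hwc
  obtain ⟨u, p, hp, hpS, hsep⟩ := hE.exists_isCycle (S := V₁) (Z := compIn G V₁ᶜ x.fst)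
    (x := x) (y := y) (disjoint_left.2 fun z hz hzc => compIn_subset hz (hV.cycle_subset hzc))
    (fun z hz w hzw hw => compIn_closed hz hzw hw) (self_mem_compIn hne) (Or.inr ⟨hw, hcon⟩)
  have hpc : p.toSubgraph = cycleSubgraph G c := honly _
    (fun v hv => hpS v ((Walk.mem_verts_toSubgraph p).1 hv)) ⟨u, p, hp, rfl⟩
  have hedge : ∀ d : G.Dart, d.edge ∈ p.edges ↔ (cycleSubgraph G c).Adj d.fst d.snd := by
    intro d
    rw [← hpc, ← Subgraph.mem_edgeSet, Walk.mem_edges_toSubgraph]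
    rfl
  have hout : ∀ d : G.Dart, IsOuter c d → d.edge ∈ p.edges := by
    rintro d ⟨i, hi⟩
    rw [hedge, show d.fst = c i from congrArg Prod.fst hi,
      show d.snd = c (i + 1) from congrArg Prod.snd hi, hc.cycleSubgraph_adj]
    exact Or.inl rfl
  have hnot : ∀ d : G.Dart, d.fst ∈ V₁ᶜ → ¬ E.SameFace p.edgesSet d (hc.dart 0) := by
    intro d hd h
    have := SameFace.iff_of (P := IsOuter c) (fun x => hE.next_isOuter.symm) (fun x hx => ?_) h
    · exact hd (hV.cycle_subset (this.2 ⟨0, rfl⟩).fst_mem)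
    · exact ⟨fun h => absurd (hout x h) hx, fun h => absurd (by
        have := hout _ h
        rwa [Dart.edge_symm] at this) hx⟩
  have hd0 := hout (hc.dart 0) ⟨0, rfl⟩
  have hx := (sameFace_or_sameFace_of_isCycle (E := E) hp hd0 x).resolve_left (hnot x hne)
  have hy := (sameFace_or_sameFace_of_isCycle (E := E) hp hd0 y).resolve_left (hnot y hw)
  exact hsep (hx.trans hy.symm)

/-- The classification of the semi-maximal planar graphs whose cycle is `2`-colorable. -/
theorem IsSemiMaximal.twoColorable_iff (hE : E.IsSemiMaximal c) : TwoColorable G (range c) ↔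
    ClosedCycleCycle G c ∨ ClosedCycleTree G c ∨ ClosedCycleFence E c ∨
      FenceTree E c ∨ FenceCycle E c ∨ ScyclesForest G c ∨ ScyclesScycles G c ∨
      IntersectedForest G c ∨ IntersectedCycles G c := by
  have hc := hE.isCycle
  constructor
  · intro h
    obtain ⟨V₁, hV⟩ := h.exists_isDecomposition
    by_cases hcl : Closed G c
    · rcases hE.closed_type hV hcl with h | h
      exacts [Or.inr (Or.inl h), Or.inr (Or.inr (Or.inl h))]
    refine Or.inr (Or.inr (Or.inr ?_))
    by_cases hacyc : (G.induce V₁ᶜ).IsAcyclic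
    · have hconn := hE.subset_cycleComponent hV hacyc
      by_cases hop : Opened G c
      · by_cases hD : ∃ D, IsOtherEvenCyc G c V₁ D
        · exact Or.inr (Or.inr (Or.inl (hV.scyclesForest hc hop hacyc hconn hD)))
        · have honly := hV.onlyCycle hD
          exact Or.inl ⟨hop, V₁, hV, isFence_of_range_subset hc hV.cycle_subset hV.bipartite_left,
            honly, hE.connected_compl hV honly, hacyc⟩
      · have hg : gam G c = gamStar G c := not_not.1 hop
        have hch : ¬ Chordless G c := fun h => hcl ⟨h, hg⟩
        -- Since Γ = Γ* misses V₁, the connected graph G₁ cannot get off C.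
        have hV₁ : V₁ = range c := by
          refine Subset.antisymm (fun v hv => ?_) hV.cycle_subset
          by_contra hvc
          obtain ⟨p, hp⟩ := hconn hv
          obtain ⟨x, hx, hxg⟩ := exists_mem_gam p ⟨0, rfl⟩ hvc
          exact hV.gamStar_subset hc (hg ▸ hxg) (hp x hx)
        subst hV₁
        exact Or.inr (Or.inr (Or.inr (Or.inr (Or.inl
          (hV.intersectedForest_of_eq hc hch hacyc)))))
    · have hR := hV.rightCycles hc hacyc
      by_cases hop : Opened G c
      · by_cases hD : ∃ D, IsOtherEvenCyc G c V₁ D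
        · exact Or.inr (Or.inr (Or.inr (Or.inl ⟨hop, V₁, hV, hD, hR⟩)))
        · refine Or.inr (Or.inl ⟨hop, V₁, hV, isFence_of_range_subset hc ?_ ?_, ?_, hR⟩)
          · rintro _ ⟨i, rfl⟩
            exact hV.mem_cycleComponent hc i
          · obtain ⟨k, hk⟩ := bipartite_induce_iff.1 hV.bipartite_left
            exact bipartite_induce_iff.2 ⟨k, hk.mono cycleComponent_subset⟩
          · exact fun D hD' => hV.onlyCycle hD D (hD'.trans cycleComponent_subset)
      · have hch : ¬ Chordless G c := fun h => hcl ⟨h, not_not.1 hop⟩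
        exact Or.inr (Or.inr (Or.inr (Or.inr (Or.inr ⟨Or.inr hch, V₁, hV,
          ⟨_, hV.isIntersectedFamily hc hch⟩, hR⟩))))
  · rintro (h | h | h | ⟨-, V₁, hV, -⟩ | ⟨-, V₁, hV, -⟩ | ⟨-, V₁, hV, -⟩ | ⟨-, V₁, hV, -⟩ |
      ⟨-, V₁, hV, -⟩ | ⟨-, V₁, hV, -⟩)
    · exact h.twoColorable hc
    · exact h.twoColorable hc
    · exact h.twoColorable hE
    all_goals exact hV.twoColorable hc

end PlaneEmbedding

/-! ### Correctness and termination of the Black-White operation -/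

namespace BW

variable {V : Type*} {G : SimpleGraph V} {f g : BW V} {h : V → Bool} {u v w : V} {b : Bool}

/-- A full Black-White coloring without unicolor odd cycles. -/
def IsSolution (G : SimpleGraph V) (h : V → Bool) : Prop := ∀ b, ¬ HasOddCycle G {v | h v = b}

/-- The full coloring `h` agrees with the partial coloring `f`. -/
def Extends (f : BW V) (h : V → Bool) : Prop := ∀ v b, f v = some b → h v = b

theorem Extends.cls_subset (he : Extends f h) (b : Bool) : f.cls b ⊆ {v | h v = b} :=
  fun v hv => he v b hv

theorem Extends.not_conflict (he : Extends f h) (hs : IsSolution G h) : ¬ Conflict G f :=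
  fun ⟨b, hb⟩ => hs b (hb.mono (he.cls_subset b))

theorem Extends.not_bad (he : Extends f h) (hs : IsSolution G h) : ¬ Bad G f v (h v) :=
  fun hb => hs (h v) (hb.mono (insert_subset rfl (he.cls_subset _)))

theorem recolor_self (o : Option Bool) : f.recolor v o v = o := by
  classical
  simp [recolor]

theorem recolor_of_ne (o : Option Bool) (hne : w ≠ v) : f.recolor v o w = f w := by
  classical
  simp [recolor, hne]

theorem Extends.recolor (he : Extends f h) : Extends (f.recolor v (some (h v))) h := by
  intro w b hw
  by_cases hwv : w = v
  · subst hwv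
    rw [recolor_self] at hw
    exact Option.some.inj hw
  · rw [recolor_of_ne _ hwv] at hw
    exact he w b hw

/-- The partial coloring `g` keeps all colors of `f`. -/
def Keeps (f g : BW V) : Prop := ∀ v b, f v = some b → g v = some b

theorem Keeps.refl (f : BW V) : Keeps f f := fun _ _ h => h

theorem Keeps.trans {k : BW V} (h₁ : Keeps f g) (h₂ : Keeps g k) : Keeps f k :=
  fun v b h => h₂ v b (h₁ v b h)

theorem Keeps.conflict (hk : Keeps f g) : Conflict G f → Conflict G g :=
  fun ⟨b, hb⟩ => ⟨b, hb.mono fun v hv => hk v b hv⟩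

theorem keeps_recolor (hv : f v = none) (o : Option Bool) : Keeps f (f.recolor v o) := by
  intro w b hw
  rw [recolor_of_ne]
  · exact hw
  · rintro rfl
    rw [hv] at hw
    exact absurd hw (by simp)

theorem propagate_fst_of_ne_none (s : BW V × Set V) (h : s.1 v ≠ none) :
    (propagate G s).1 v = s.1 v :=
  if_neg fun hD => h hD.1

theorem keeps_propagate (s : BW V × Set V) : Keeps s.1 (propagate G s).1 := by
  intro v b hv
  rw [propagate_fst_of_ne_none s (by rw [hv]; simp), hv]

/-- A solution never gives a vertex a color in which it is bad, so the remaining color is the one it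
has. -/
theorem Extends.propagate {s : BW V × Set V} (he : Extends s.1 h) (hs : IsSolution G h) :
    Extends (propagate G s).1 h := by
  classical
  intro v b hv
  by_cases hn : s.1 v = none
  · by_cases hD : (∃ d ∈ s.2, G.Adj d v) ∧ ∃ b, Bad G s.1 v b
    · have hval : (BW.propagate G s).1 v = if Bad G s.1 v true then some false else some true :=
        if_pos ⟨hn, hD⟩
      have hnb := he.not_bad (v := v) hs
      rw [hval] at hv
      by_cases hb : Bad G s.1 v true
      · rw [if_pos hb] at hv
        obtain rfl := Option.some.inj hv
        cases hhv : h v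
        · rfl
        · rw [hhv] at hnb
          exact absurd hb hnb
      · rw [if_neg hb] at hv
        obtain rfl := Option.some.inj hv
        obtain ⟨b', hb'⟩ := hD.2
        cases b'
        · cases hhv : h v
          · rw [hhv] at hnb
            exact absurd hb' hnb
          · rfl
        · exact absurd hb' hb
    · have hval : (BW.propagate G s).1 v = s.1 v := if_neg fun h => hD h.2
      rw [hval, hn] at hv
      exact absurd hv (by simp)
  · rw [propagate_fst_of_ne_none s hn] at hv
    exact he v b hv

theorem keeps_recolor_extend : Keeps (f.recolor u (some b)) (extend G f u b) := by
  have key : ∀ k, Keeps (f.recolor u (some b))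
      ((propagate G)^[k] (f.recolor u (some b), {u})).1 := by
    intro k
    induction k with
    | zero => exact Keeps.refl _
    | succ k ih =>
      rw [Function.iterate_succ_apply']
      exact ih.trans (keeps_propagate _)
  exact key _

theorem keeps_extend (hu : f u = none) : Keeps f (extend G f u b) :=
  (keeps_recolor hu _).trans keeps_recolor_extend

theorem Extends.extend (he : Extends f h) (hs : IsSolution G h) :
    Extends (extend G f u (h u)) h := by
  have key : ∀ k, Extends ((BW.propagate G)^[k] (f.recolor u (some (h u)), {u})).1 h := by
    intro k
    induction k with
    | zero => exact he.recolor
    | succ k ih =>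
      rw [Function.iterate_succ_apply']
      exact ih.propagate hs
  exact key _

/-- A solution must give the two vertices of a petal-pair different colors; so it properly
two-colors the petal-graph. -/
theorem Extends.not_hasOddCycle_petalGraph (he : Extends f h) (hs : IsSolution G h) :
    ¬ HasOddCycle (petalGraph G f) univ := by
  refine not_hasOddCycle_iff.2 ⟨h, ?_⟩
  rintro x - y - ⟨-, -, -, H⟩ hxy
  obtain ⟨w, p, hp, hodd, hsub, -⟩ := H (h x)
  refine hs (h x) ⟨w, p, hp, hodd, fun z hz => ?_⟩
  rcases hsub z hz with rfl | rfl | hz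
  · rfl
  · exact hxy.symm
  · exact he z _ hz

theorem Extends.not_isGeneralPetal (he : Extends f h) (hs : IsSolution G h) :
    ¬ IsGeneralPetal G f v := by
  rintro ⟨-, H⟩
  have he' : Extends (BW.extend G f v (h v)) h := he.extend hs
  rcases H (h v) with hc | hp
  · exact he'.not_conflict hs hc
  · exact he'.not_hasOddCycle_petalGraph hs hp

theorem Extends.not_obstructed (he : Extends f h) (hs : IsSolution G h) : ¬ Obstructed G f := by
  rintro (⟨v, -, hv⟩ | ⟨v, hv⟩ | hc)
  · exact he.not_bad hs (hv (h v))
  · exact he.not_isGeneralPetal hs hv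
  · exact he.not_conflict hs hc

/-- The extension in the solution's own color is conflict-free, so that color is not the conflicting
one. -/
theorem Extends.of_isRestricted (he : Extends f h) (hs : IsSolution G h)
    (hr : IsRestricted G f u b) : Extends (BW.extend G f u b) h := by
  have hub : h u = b := by
    by_contra hne
    have he' : Extends (BW.extend G f u (h u)) h := he.extend hs
    have : h u = !b := by
      revert hne
      cases h u <;> cases b <;> simp
    rw [this] at he'
    exact he'.not_conflict hs hr.2.2.1
  rw [← hub]
  exact he.extend hs

/-! #### The initial coloring -/

theorem base_eq_true {n : ℕ} {c : ZMod n → V} (i : ZMod n) : base G c (c i) = some true :=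
  if_pos ⟨0, by simp, i, rfl⟩

/-- Each layer is forced by the one before. A vertex joined to both ends of an odd walk inside one
color class would close an odd walk in that class if it had the same color. -/
theorem layers_color {m : ℕ} {c : ZMod (2 * m) → V} (hc : IsLongCycle G c)
    (hs : IsSolution G h) (hC : ∀ i, h (c i) = true) (k : ℕ) :
    ∀ v ∈ (layers G c k).1, h v = decide (Even k) := by
  have hstar : ∀ (S : Set V) (b : Bool), (∀ x ∈ S, h x = b) → ∀ v ∈ starNbr G S, h v = !b := by
    intro S b hS v hv
    obtain ⟨x, y, hvx, hvy, p, hodd, hp⟩ := hv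
    by_contra hcon
    have hvb : h v = b := by
      revert hcon
      cases h v <;> cases b <;> simp
    obtain ⟨k, hk⟩ := not_hasOddCycle_iff.1 (hs b)
    have h1 := hk v hvb x (hS x (hp x p.start_mem_support)) hvx
    have h2 := hk v hvb y (hS y (hp y p.end_mem_support)) hvy
    have h3 := hk.parity p fun z hz => hS z (hp z hz)
    rw [← Nat.not_odd_iff_even, iff_false_intro (not_not.2 hodd)] at h3
    revert h1 h2 h3
    cases k v <;> cases k x <;> cases k y <;> simp
  match k with
  | 0 =>
    rintro _ ⟨i, rfl⟩
    simpa using hC i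
  | 1 =>
    intro v hv
    by_contra hcon
    have hvb : h v = true := by simpa using hcon
    obtain ⟨k, hk⟩ := not_hasOddCycle_iff.1 (hs true)
    obtain ⟨-, ⟨i, hi, hvi⟩, ⟨j, hj, hvj⟩⟩ := hv
    have h1 := hk v hvb _ (hC i) hvi
    have h2 := hk v hvb _ (hC j) hvj
    have hsub : range c ⊆ {v | h v = true} := by
      rintro _ ⟨i, rfl⟩
      exact hC i
    rw [hk.cycle_eq hc hsub, decide_eq_true hi] at h1
    rw [hk.cycle_eq hc hsub, decide_eq_false (Nat.not_odd_iff_even.2 hj)] at h2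
    revert h1 h2
    cases k v <;> cases k (c 0) <;> simp
  | k + 2 =>
    intro v hv
    have := hstar _ _ (layers_color hc hs hC (k + 1)) v hv.1
    rw [this, ← decide_not]
    exact decide_eq_decide.2 (Nat.even_add_one (n := k + 1)).symm

theorem extends_base_iff {m : ℕ} {c : ZMod (2 * m) → V} (hc : IsLongCycle G c)
    (hs : IsSolution G h) : Extends (base G c) h ↔ ∀ i, h (c i) = true := by
  refine ⟨fun he i => he _ _ (base_eq_true i), fun hC v b hv => ?_⟩
  unfold base at hv
  split_ifs at hv with h1 h2
  · obtain ⟨k, hk, hvk⟩ := h1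
    obtain rfl := Option.some.inj hv
    rw [layers_color hc hs hC k v hvk]
    simpa using hk
  · obtain ⟨k, hk, hvk⟩ := h2
    obtain rfl := Option.some.inj hv
    rw [layers_color hc hs hC k v hvk]
    simpa using hk

/-- Black is V₁ and white is its complement. The initial coloring demands nothing beyond black on C,
because its layers are forced. -/
theorem exists_solution_iff {m : ℕ} {c : ZMod (2 * m) → V} (hc : IsLongCycle G c) :
    TwoColorable G (range c) ↔ ∃ h, IsSolution G h ∧ Extends (base G c) h := by
  classical
  constructor
  · intro H
    obtain ⟨V₁, hV⟩ := H.exists_isDecomposition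
    have hs : IsSolution G (fun v => decide (v ∈ V₁)) := by
      intro b
      have hset : {v | decide (v ∈ V₁) = b} = if b then V₁ else V₁ᶜ := by
        ext v
        cases b <;> simp
      rw [hset]
      cases b
      · exact not_hasOddCycle_iff.2 (bipartite_induce_iff.1 hV.bipartite_right)
      · exact not_hasOddCycle_iff.2 (bipartite_induce_iff.1 hV.bipartite_left)
    exact ⟨_, hs, (extends_base_iff hc hs).2 fun i => decide_eq_true (hV.cycle_subset ⟨i, rfl⟩)⟩
  · rintro ⟨h, hs, he⟩
    refine IsDecomposition.twoColorable hc (V₁ := {v | h v = true}) ⟨?_, ?_, ?_⟩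
    · rintro _ ⟨i, rfl⟩
      exact (extends_base_iff hc hs).1 he i
    · exact bipartite_induce_iff.2 (not_hasOddCycle_iff.1 (hs true))
    · have : {v | h v = true}ᶜ = {v | h v = false} := by
        ext v
        simp
      rw [this]
      exact bipartite_induce_iff.2 (not_hasOddCycle_iff.1 (hs false))

theorem exists_solution_of_not_hasGrey (hg : ¬ HasGrey f) (hc : ¬ Conflict G f) :
    ∃ h, IsSolution G h ∧ Extends f h := by
  have hsome : ∀ v, ∃ b, f v = some b := fun v => Option.ne_none_iff_exists'.1 fun h => hg ⟨v, h⟩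
  choose h hh using hsome
  refine ⟨h, fun b hb => hc ⟨b, hb.mono fun v hv => ?_⟩, fun v b hv => ?_⟩
  · have hv : h v = b := hv
    exact (hh v).trans (congrArg some hv)
  · rw [hh v] at hv
    exact Option.some.inj hv

/-! #### Correctness -/

/-- Some solution extends `f`. -/
def Solvable (G : SimpleGraph V) (f : BW V) : Prop := ∃ h, IsSolution G h ∧ Extends f h

theorem Solvable.of_keeps (hk : Keeps f g) : Solvable G g → Solvable G f :=
  fun ⟨h, hs, he⟩ => ⟨h, hs, fun v b hv => he v b (hk v b hv)⟩

theorem Solvable.not_obstructed : Solvable G f → ¬ Obstructed G f :=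
  fun ⟨_, hs, he⟩ => he.not_obstructed hs

theorem Solvable.of_isRestricted (hr : IsRestricted G f u b) :
    Solvable G f → Solvable G (extend G f u b) :=
  fun ⟨h, hs, he⟩ => ⟨h, hs, he.of_isRestricted hs hr⟩

theorem Solvable.recolor (h : Solvable G f) (v : V) :
    Solvable G (f.recolor v (some true)) ∨ Solvable G (f.recolor v (some false)) := by
  obtain ⟨h, hs, he⟩ := h
  have := he.recolor (v := v)
  cases hv : h v
  · rw [hv] at this
    exact Or.inr ⟨h, hs, this⟩
  · rw [hv] at this
    exact Or.inl ⟨h, hs, this⟩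

/-- In a coloring that is not obstructed and has no restricted vertices, a grey vertex may be given
either color without creating a unicolor odd cycle. -/
theorem not_conflict_recolor (ho : ¬ Obstructed G f) (hr : ¬ ∃ u b, IsRestricted G f u b)
    (hv : f v = none) (b : Bool) : ¬ Conflict G (f.recolor v (some b)) := by
  intro hc
  have hc' := (keeps_recolor_extend (G := G)).conflict hc
  have hg : ¬ IsGeneralPetal G f v := fun hg => ho (Or.inr (Or.inl ⟨v, hg⟩))
  by_cases hc2 : Conflict G (extend G f v (!b))
  · refine hg ⟨hv, fun b' => Or.inl ?_⟩
    by_cases hb : b' = b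
    · rwa [hb]
    · have : b' = !b := by
        revert hb
        cases b' <;> cases b <;> simp
      rwa [this]
  · exact hr ⟨v, !b, hv, hg, by rwa [Bool.not_not], hc2⟩

/-- What holds throughout the improved operation that starts from the coloring `f₀`. -/
structure Invariant (G : SimpleGraph V) (f₀ : BW V) (s : State V) : Prop where
  keeps : Keeps f₀ s.col
  signs_keeps : ∀ p ∈ s.signs, Keeps f₀ (p.2.recolor p.1 (some false))
  not_conflict : ¬ Conflict G s.col
  signs_not_conflict : ∀ p ∈ s.signs, ¬ Conflict G (p.2.recolor p.1 (some false))
  solvable : s.label ≠ .halt → Solvable G f₀ →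
    Solvable G s.col ∨ ∃ p ∈ s.signs, Solvable G (p.2.recolor p.1 (some false))
  first : s.label = .forceFirst ∨ s.label = .checkFirst → s.signs = []
  not_obstructed : s.label = .loopFirst ∨ s.label = .loop ∨ s.label = .choose →
    ¬ Obstructed G s.col
  not_restricted : s.label = .choose → ¬ ∃ u b, IsRestricted G s.col u b
  loopFirst : s.label = .loopFirst → s.signs = []
  halt : s.label = .halt → HasGrey s.col → ¬ Solvable G f₀

/-- Absence of conflicts must be carried along, also for the saved white branches: the operation may
halt with no grey vertex before any test for obstruction. -/
theorem Invariant.step {f₀ : BW V} {s t : State V} (hs : Invariant G f₀ s) (h : Step G s t) :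
    Invariant G f₀ t := by
  obtain ⟨h1, h2, h3, h4, h5, h6, h7, h8, h9, h10⟩ := hs
  cases h with
  | forceFirst hr =>
    exact ⟨h1.trans (keeps_extend hr.1), h2, hr.2.2.2, h4,
      fun _ hS => (h5 (by simp) hS).imp (Solvable.of_isRestricted hr) id, fun _ => h6 (Or.inl rfl),
      by simp, by simp, by simp, by simp⟩
  | forceFirst_none hr =>
    exact ⟨h1, h2, h3, h4, fun _ hS => h5 (by simp) hS, fun _ => h6 (Or.inl rfl),
      by simp, by simp, by simp, by simp⟩
  | checkFirst_stop ho =>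
    refine ⟨h1, h2, h3, h4, by simp, by simp, by simp, by simp, by simp, fun _ _ hS => ?_⟩
    rcases h5 (by simp) hS with h | ⟨p, hp, -⟩
    · exact h.not_obstructed ho
    · have := h6 (Or.inr rfl)
      simp only at this hp
      rw [this] at hp
      simp at hp
  | checkFirst ho =>
    exact ⟨h1, h2, h3, h4, fun _ hS => h5 (by simp) hS, by simp, fun _ => ho, by simp,
      fun _ => h6 (Or.inr rfl), by simp⟩
  | loopFirst_back hr =>
    exact ⟨h1, h2, h3, h4, fun _ hS => h5 (by simp) hS, fun _ => h9 rfl, by simp, by simp, by simp,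
      by simp⟩
  | loopFirst hr =>
    exact ⟨h1, h2, h3, h4, fun _ hS => h5 (by simp) hS, by simp, fun _ => h7 (Or.inl rfl),
      fun _ => hr, by simp, by simp⟩
  | choose_stop hg =>
    exact ⟨h1, h2, h3, h4, by simp, by simp, by simp, by simp, by simp, fun _ h => absurd h hg⟩
  | @choose f s v hv =>
    have ho := h7 (Or.inr (Or.inr rfl))
    have hr := h8 rfl
    refine ⟨h1.trans (keeps_recolor hv.1 _), ?_, not_conflict_recolor ho hr hv.1 _, ?_, ?_, by simp,
      by simp, by simp, by simp, by simp⟩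
    · intro p hp
      rcases List.mem_cons.1 hp with rfl | hp
      · exact h1.trans (keeps_recolor hv.1 _)
      · exact h2 p hp
    · intro p hp
      rcases List.mem_cons.1 hp with rfl | hp
      · exact not_conflict_recolor ho hr hv.1 _
      · exact h4 p hp
    · intro _ hS
      -- A solution extending the present coloring has the sign-vertex black, and continues, or
      -- white, and is kept by the new stack entry.
      rcases h5 (by simp) hS with h | ⟨p, hp, h⟩
      · rcases h.recolor v with h | h
        · exact Or.inl h
        · exact Or.inr ⟨(v, f), by simp, h⟩
      · exact Or.inr ⟨p, List.mem_cons_of_mem _ hp, h⟩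
  | force hr =>
    exact ⟨h1.trans (keeps_extend hr.1), h2, hr.2.2.2, h4,
      fun _ hS => (h5 (by simp) hS).imp (Solvable.of_isRestricted hr) id, by simp,
      by simp, by simp, by simp, by simp⟩
  | force_none hr =>
    exact ⟨h1, h2, h3, h4, fun _ hS => h5 (by simp) hS, by simp, by simp, by simp, by simp, by simp⟩
  | check_done hg =>
    exact ⟨h1, h2, h3, h4, by simp, by simp, by simp, by simp, by simp, fun _ h => absurd h hg⟩
  | @check_back f w g s hg ho =>
    refine ⟨h2 (w, g) (by simp), fun p hp => h2 p (List.mem_cons_of_mem _ hp), h4 (w, g) (by simp),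
      fun p hp => h4 p (List.mem_cons_of_mem _ hp), fun _ hS => ?_, by simp, by simp, by simp,
      by simp, by simp⟩
    -- An obstructed coloring has no solution, so a solution must be in a saved branch: the one now
    -- opened or an earlier one.
    rcases h5 (by simp) hS with h | ⟨p, hp, h⟩
    · exact absurd ho h.not_obstructed
    · rcases List.mem_cons.1 hp with rfl | hp
      · exact Or.inl h
      · exact Or.inr ⟨p, hp, h⟩
  | check_stop hg ho =>
    refine ⟨h1, h2, h3, h4, by simp, by simp, by simp, by simp, by simp, fun _ _ hS => ?_⟩
    rcases h5 (by simp) hS with h | ⟨p, hp, -⟩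
    · exact h.not_obstructed ho
    · simp at hp
  | check hg ho =>
    exact ⟨h1, h2, h3, h4, fun _ hS => h5 (by simp) hS, by simp, fun _ => ho, by simp, by simp,
      by simp⟩
  | loop_back hr =>
    exact ⟨h1, h2, h3, h4, fun _ hS => h5 (by simp) hS, by simp, by simp, by simp, by simp, by simp⟩
  | loop hr =>
    exact ⟨h1, h2, h3, h4, fun _ hS => h5 (by simp) hS, by simp, fun _ => h7 (Or.inr (Or.inl rfl)),
      fun _ => hr, by simp, by simp⟩

theorem Invariant.init {f₀ : BW V} (hc : ¬ Conflict G f₀) :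
    Invariant G f₀ ⟨.forceFirst, f₀, []⟩ :=
  ⟨Keeps.refl _, by simp, hc, by simp, fun _ h => Or.inl h, by simp, by simp, by simp, by simp,
    by simp⟩

theorem Invariant.reflTransGen {f₀ : BW V} {s t : State V} (hs : Invariant G f₀ s)
    (h : Relation.ReflTransGen (Step G) s t) : Invariant G f₀ t := by
  induction h with
  | refl => exact hs
  | tail _ h ih => exact ih.step h

/-- A result without grey vertices is itself a solution. A stop with grey vertices happens only for
an obstructed coloring with no saved branch, or after an initial conflict, and both exclude
solutions. -/
theorem Outcome.not_hasGrey_iff {m : ℕ} {c : ZMod (2 * m) → V} (hc : IsLongCycle G c)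
    (h : Outcome G c g) : ¬ HasGrey g ↔ TwoColorable G (range c) := by
  rw [exists_solution_iff hc]
  change _ ↔ Solvable G (base G c)
  cases h with
  | odd hp hodd hsub =>
    refine ⟨fun h => absurd ⟨_, recolor_self none⟩ h, fun h => ?_⟩
    exact absurd (Or.inr (Or.inr ⟨_, _, _, hp, hodd, hsub⟩)) h.not_obstructed
  | full hconf hgrey => exact ⟨fun h => exists_solution_of_not_hasGrey h hconf, fun _ => hgrey⟩
  | run hconf hgrey hrun =>
    have hinv := (Invariant.init hconf).reflTransGen hrun
    constructor
    · intro h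
      exact Solvable.of_keeps hinv.keeps (exists_solution_of_not_hasGrey h hinv.not_conflict)
    · exact fun h hg => hinv.halt rfl hg h

/-! #### Termination -/

/-- The number of grey vertices. -/
def greyCount (f : BW V) : ℕ := {v | f v = none}.ncard

/-- A bound for the number of colorings that the operation still has to look at. -/
def potential (f : BW V) (s : List (V × BW V)) : ℕ :=
  3 ^ greyCount f + (s.map fun p => 3 ^ greyCount (p.2.recolor p.1 (some false))).sum

theorem potential_lt_of_greyCount_lt (h : greyCount g < greyCount f) (s : List (V × BW V)) :
    potential g s < potential f s :=
  Nat.add_lt_add_right (Nat.pow_lt_pow_right (by norm_num) h) _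

theorem potential_back_lt (s : List (V × BW V)) :
    potential (g.recolor w (some false)) s < potential f ((w, g) :: s) := by
  unfold potential
  rw [List.map_cons, List.sum_cons]
  have : 0 < 3 ^ greyCount f := by positivity
  simp only
  omega

/-- The operation can be carried out from the state `s` until it halts. -/
def Halts (G : SimpleGraph V) (s : State V) : Prop :=
  ∃ g l, Relation.ReflTransGen (Step G) s ⟨.halt, g, l⟩

theorem Halts.of_step {s t : State V} (h : Step G s t) (ht : Halts G t) : Halts G s := by
  obtain ⟨g, l, ht⟩ := ht
  exact ⟨g, l, .head h ht⟩

variable [Finite V]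

theorem Keeps.greyCount_lt (hk : Keeps f g) (hf : f u = none) (hg : g u ≠ none) :
    greyCount g < greyCount f := by
  refine Set.ncard_lt_ncard ⟨fun v hv => ?_, fun h => hg (h hf)⟩ (Set.toFinite _)
  by_contra hcon
  obtain ⟨b, hb⟩ := Option.ne_none_iff_exists'.1 hcon
  have hv : g v = none := hv
  rw [hk v b hb] at hv
  exact absurd hv (by simp)

theorem greyCount_recolor_lt (hf : f u = none) (b : Bool) :
    greyCount (f.recolor u (some b)) < greyCount f :=
  (keeps_recolor hf _).greyCount_lt hf (by rw [recolor_self]; simp)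

theorem greyCount_extend_lt (hf : f u = none) (b : Bool) :
    greyCount (extend G f u b) < greyCount f :=
  (keeps_extend hf).greyCount_lt hf (by rw [keeps_recolor_extend u b (recolor_self _)]; simp)

/-- One term 3 ^ (k + 1) is replaced by two terms of at most 3 ^ k each; base 3 makes the drop
strict. -/
theorem potential_cons_lt (hv : f v = none) (s : List (V × BW V)) :
    potential (f.recolor v (some true)) ((v, f) :: s) < potential f s := by
  unfold potential
  rw [List.map_cons, List.sum_cons, ← add_assoc]
  refine Nat.add_lt_add_right ?_ _
  obtain ⟨k, hk⟩ : ∃ k, greyCount f = k + 1 :=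
    ⟨greyCount f - 1, by have := greyCount_recolor_lt hv true; omega⟩
  have h1 : 3 ^ greyCount (f.recolor v (some true)) ≤ 3 ^ k :=
    Nat.pow_le_pow_right (by norm_num) (by have := greyCount_recolor_lt hv true; omega)
  have h2 : 3 ^ greyCount (f.recolor v (some false)) ≤ 3 ^ k :=
    Nat.pow_le_pow_right (by norm_num) (by have := greyCount_recolor_lt hv false; omega)
  have h3 : 0 < 3 ^ k := by positivity
  rw [hk, pow_succ]
  simp only
  omega

theorem exists_isSignCandidate (h : HasGrey f) : ∃ v, IsSignCandidate G f v := by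
  obtain ⟨v, hv, hmax⟩ := Set.exists_max_image {v | f v = none}
    (fun v => {x | G.Adj v x ∧ f x ≠ none}.ncard) (Set.toFinite _) h
  exact ⟨v, hv, hmax⟩

theorem halts_choose {s : List (V × BW V)} (ih : ∀ f' s', potential f' s' < potential f s →
    Halts G ⟨.force, f', s'⟩) : Halts G ⟨.choose, f, s⟩ := by
  by_cases hg : HasGrey f
  · obtain ⟨v, hv⟩ := exists_isSignCandidate (G := G) hg
    exact Halts.of_step (Step.choose hv) (ih _ _ (potential_cons_lt hv.1 s))
  · exact ⟨f, s, .single (Step.choose_stop hg)⟩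

/-- Looping back to forcing changes no color, so it is harmless only if the preceding forcing
lowered the potential. The last hypothesis records this: if nothing was forced, no restricted vertex
is left. -/
theorem halts_check {N : ℕ} {s : List (V × BW V)} (ih : ∀ f' s', potential f' s' < N →
    Halts G ⟨.force, f', s'⟩) (hle : potential f s ≤ N)
    (hr : (∃ u b, IsRestricted G f u b) → potential f s < N) : Halts G ⟨.check, f, s⟩ := by
  by_cases hg : HasGrey f
  · by_cases ho : Obstructed G f
    · cases s with
      | nil => exact ⟨f, [], .single (Step.check_stop hg ho)⟩
      | cons p s =>
        obtain ⟨w, g⟩ := p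
        exact Halts.of_step (Step.check_back hg ho)
          (ih _ _ ((potential_back_lt s).trans_le hle))
    · refine Halts.of_step (Step.check hg ho) ?_
      by_cases hr' : ∃ u b, IsRestricted G f u b
      · exact Halts.of_step (Step.loop_back hr') (ih _ _ (hr hr'))
      · exact Halts.of_step (Step.loop hr') (halts_choose fun f' s' h => ih _ _ (h.trans_le hle))
  · exact ⟨f, s, .single (Step.check_done hg)⟩

theorem halts_force (f : BW V) (s : List (V × BW V)) : Halts G ⟨.force, f, s⟩ := by
  induction hN : potential f s using Nat.strong_induction_on generalizing f s with
  | _ N ih =>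
    have ih' : ∀ f' s', potential f' s' < N → Halts G ⟨.force, f', s'⟩ :=
      fun f' s' h => ih _ h f' s' rfl
    by_cases hr : ∃ u b, IsRestricted G f u b
    · obtain ⟨u, b, hr⟩ := hr
      have hlt := potential_lt_of_greyCount_lt (greyCount_extend_lt (G := G) hr.1 b) s
      rw [hN] at hlt
      exact Halts.of_step (Step.force hr) (halts_check ih' hlt.le fun _ => hlt)
    · exact Halts.of_step (Step.force_none hr) (halts_check ih' hN.le fun h => absurd h hr)

theorem halts_forceFirst (f : BW V) (s : List (V × BW V)) : Halts G ⟨.forceFirst, f, s⟩ := by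
  induction hN : greyCount f using Nat.strong_induction_on generalizing f with
  | _ N ih =>
    have hcheck : ∀ f' : BW V, ((∃ u b, IsRestricted G f' u b) → greyCount f' < N) →
        Halts G ⟨.checkFirst, f', s⟩ := by
      intro f' hf'
      by_cases ho : Obstructed G f'
      · exact ⟨f', s, .single (Step.checkFirst_stop ho)⟩
      · refine Halts.of_step (Step.checkFirst ho) ?_
        by_cases hr' : ∃ u b, IsRestricted G f' u b
        · exact Halts.of_step (Step.loopFirst_back hr') (ih _ (hf' hr') f' rfl)
        · exact Halts.of_step (Step.loopFirst hr') (halts_choose fun f' s' _ => halts_force f' s')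
    by_cases hr : ∃ u b, IsRestricted G f u b
    · obtain ⟨u, b, hr⟩ := hr
      refine Halts.of_step (Step.forceFirst hr) (hcheck _ fun _ => ?_)
      rw [← hN]
      exact greyCount_extend_lt hr.1 b
    · exact Halts.of_step (Step.forceFirst_none hr) (hcheck f fun h => absurd h hr)

theorem exists_outcome {n : ℕ} (c : ZMod n → V) : ∃ g, Outcome G c g := by
  by_cases hc : Conflict G (base G c)
  · obtain ⟨b, v, p, hp, hodd, hsub⟩ := hc
    exact ⟨_, Outcome.odd hp hodd hsub⟩
  · by_cases hg : HasGrey (base G c)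
    · obtain ⟨g, l, hrun⟩ := halts_forceFirst (G := G) (base G c) []
      exact ⟨g, Outcome.run hc hg hrun⟩
    · exact ⟨_, Outcome.full hc hg⟩

end BW

/-! ### The two sides of a cycle -/

namespace IsLongCycle

variable {V : Type*} {G : SimpleGraph V} {n : ℕ} {c : ZMod n → V}

theorem edges_arc_subset (hc : IsLongCycle G c) (i : ZMod n) (k : ℕ) :
    ∀ e ∈ (hc.arc i k).edges, e ∈ (cycleSubgraph G c).edgeSet := by
  induction k with
  | zero => simp [arc]
  | succ k ih =>
    intro e he
    rw [arc, Walk.edges_copy, Walk.edges_concat, List.concat_eq_append,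
      List.mem_append, List.mem_singleton] at he
    rcases he with he | rfl
    · exact ih e he
    · exact hc.cycleSubgraph_adj.2 (Or.inl rfl)

theorem dart_edge_mem (hc : IsLongCycle G c) (i : ZMod n) :
    (hc.dart i).edge ∈ (cycleSubgraph G c).edgeSet := hc.cycleSubgraph_adj.2 (Or.inl rfl)

/-- The complementary arc has length n - 1 > 1, and a path of length above one does not use an edge
joining its ends. -/
theorem reachable_sdiff (hc : IsLongCycle G c) (i : ZMod n) :
    (fromEdgeSet ((cycleSubgraph G c).edgeSet \ {(hc.dart i).edge})).Reachable
      (hc.dart i).fst (hc.dart i).snd := by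
  have h4 := hc.four_le
  have hend : c (i + 1 + ((n - 1 : ℕ) : ZMod n)) = c i := by
    rw [Nat.cast_sub (by omega), Nat.cast_one, ZMod.natCast_self]
    simp
  set p : G.Walk (c (i + 1)) (c i) := (hc.arc (i + 1) (n - 1)).copy rfl hend with hp
  have hpath : p.IsPath := by
    rw [hp, Walk.isPath_copy]
    exact hc.isPath_arc _ (by omega)
  have hlen : p.length = n - 1 := by
    rw [hp, Walk.length_copy, hc.length_arc]
  have hedges : ∀ e ∈ p.edges, e ∈ (cycleSubgraph G c).edgeSet := by
    intro e he
    rw [hp, Walk.edges_copy] at he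
    exact hc.edges_arc_subset _ _ e he
  refine Reachable.symm ⟨p.transfer _ fun e he => ?_⟩
  rw [edgeSet_fromEdgeSet]
  refine ⟨⟨hedges e he, fun hei => ?_⟩, G.not_isDiag_of_mem_edgeSet (p.edges_subset_edgeSet he)⟩
  have hei : e = s(c i, c (i + 1)) := hei
  rw [hei, Sym2.eq_swap] at he
  have := hpath.length_eq_one_of_mem_edges he
  omega

end IsLongCycle

namespace PlaneEmbedding

variable {V : Type*} [Fintype V] {G : SimpleGraph V} {E : PlaneEmbedding G} {n : ℕ}
  {c : ZMod n → V}

theorem not_sameFace_dart_symm (hc : IsLongCycle G c) (i : ZMod n) :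
    ¬ E.SameFace (cycleSubgraph G c).edgeSet (hc.dart i) (hc.dart i).symm :=
  not_sameFace_symm (cycleSubgraph G c).edgeSet_subset (hc.dart_edge_mem i) (hc.reachable_sdiff i)

/-- The face walk after `c i → c (i + 1)` rotates about `c (i + 1)` until it meets an edge of C.
That edge is not the one it came by, by the Jordan curve theorem, hence the next one; otherwise the
walk would never return to its start. -/
theorem sameFace_dart_succ (hc : IsLongCycle G c) (i : ZMod n) :
    E.SameFace (cycleSubgraph G c).edgeSet (hc.dart i) (hc.dart (i + 1)) := by
  by_contra hcon
  set K := (cycleSubgraph G c).edgeSet with hK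
  have key : ∀ k, ((⇑(E.walkPerm K))^[k + 1] (hc.dart i)).fst = c (i + 1) := by
    intro k
    induction k with
    | zero =>
      rw [zero_add, Function.iterate_one, walkPerm_of_mem (hc.dart_edge_mem i), E.next_fst]
      rfl
    | succ k ih =>
      rw [Function.iterate_succ_apply']
      have hsf := sameFace_walkPerm_iterate (E := E) K (hc.dart i) (k + 1)
      generalize (⇑(E.walkPerm K))^[k + 1] (hc.dart i) = z at ih hsf
      by_cases hz : z.edge ∈ K
      · exfalso
        have hadj : (cycleSubgraph G c).Adj z.fst z.snd := hz
        obtain ⟨j, hj⟩ : z.snd ∈ range c := (cycleSubgraph G c).edge_vert hadj.symm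
        rw [ih, ← hj, hc.cycleSubgraph_adj] at hadj
        rcases hadj with rfl | hadj
        · have : z = hc.dart (i + 1) := Dart.ext _ _ (Prod.ext ih hj.symm)
          exact hcon (this ▸ hsf)
        · obtain rfl := add_right_cancel hadj
          have : z = (hc.dart i).symm := Dart.ext _ _ (Prod.ext ih hj.symm)
          exact not_sameFace_dart_symm hc i (this ▸ hsf)
      · rw [walkPerm_of_notMem hz, rot_fst, ih]
  obtain ⟨k, hk⟩ := exists_walkPerm_iterate_eq (E := E) K (hc.dart i)
  have h := key k
  rw [hk] at h
  exact (hc.adj i).ne h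

theorem sameFace_dart (hc : IsLongCycle G c) (i j : ZMod n) :
    E.SameFace (cycleSubgraph G c).edgeSet (hc.dart i) (hc.dart j) := by
  have := hc.neZero
  have key : ∀ i, E.SameFace (cycleSubgraph G c).edgeSet (hc.dart 0) (hc.dart i) :=
    ZMod.induction_succ (SameFace.refl _ _) fun i hi => hi.trans (sameFace_dart_succ hc i)
  exact (key i).symm.trans (key j)

theorem OnSide.of_sameFace {b : Bool} {x y : G.Dart} (h : E.OnSide c b x)
    (hxy : E.SameFace (cycleSubgraph G c).edgeSet x y) : E.OnSide c b y := by
  obtain ⟨e, i, he, hex⟩ := h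
  exact ⟨e, i, he, hex.trans hxy⟩

theorem exists_onSide_of_mem {x : G.Dart} (hx : x.edge ∈ (cycleSubgraph G c).edgeSet) :
    ∃ b, E.OnSide c b x := by
  obtain ⟨-, i, hi⟩ := (hx : (cycleSubgraph G c).Adj x.fst x.snd)
  rcases Sym2.eq_iff.1 hi with ⟨h1, h2⟩ | ⟨h1, h2⟩
  · exact ⟨true, x, i, Prod.ext h1 h2, SameFace.refl _ _⟩
  · exact ⟨false, x, i, Prod.ext h1 h2, SameFace.refl _ _⟩

theorem exists_onSide (hc : IsLongCycle G c) (x : G.Dart) : ∃ b, E.OnSide c b x := by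
  have hsymm : ∀ x, (∃ b, E.OnSide c b x) → ∃ b, E.OnSide c b x.symm := by
    rintro x ⟨b, hx⟩
    by_cases hK : x.edge ∈ (cycleSubgraph G c).edgeSet
    · exact exists_onSide_of_mem (by rwa [Dart.edge_symm])
    · exact ⟨b, hx.of_sameFace (E.sameFace_symm_of_notMem hK)⟩
  refine (SameFace.iff_of (E := E) (P := fun x => ∃ b, E.OnSide c b x) (fun x => ?_) (fun x _ => ?_)
    (sameFace_empty (hc.dart 0) x)).1 (exists_onSide_of_mem (hc.dart_edge_mem 0))
  · exact ⟨fun ⟨b, h⟩ => ⟨b, h.of_sameFace (E.sameFace_next _ x)⟩,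
      fun ⟨b, h⟩ => ⟨b, h.of_sameFace (E.sameFace_next _ x).symm⟩⟩
  · exact ⟨hsymm x, fun h => by simpa using hsymm _ h⟩

theorem exists_onSide_fst {b : Bool} {v : V} (hv : v ∉ range c) (h : v ∈ (E.side c b).verts) :
    ∃ x : G.Dart, x.fst = v ∧ E.OnSide c b x := by
  rcases h with h | ⟨x, hx, rfl | rfl⟩
  · exact absurd h hv
  · exact ⟨x, rfl, hx⟩
  · refine ⟨x.symm, rfl, hx.of_sameFace (E.sameFace_symm_of_notMem fun hK => hv ?_)⟩
    exact Subgraph.Adj.snd_mem (H := cycleSubgraph G c) hK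

/-- The two sides have only the vertices of the cycle in common. -/
theorem mem_range_of_mem_sides (hc : IsLongCycle G c) {v : V}
    (h : ∀ b, v ∈ (E.side c b).verts) : v ∈ range c := by
  by_contra hv
  obtain ⟨x, hxv, e, i, he, hex⟩ := exists_onSide_fst hv (h true)
  obtain ⟨y, hyv, e', j, he', hey⟩ := exists_onSide_fst hv (h false)
  obtain rfl : e = hc.dart i := Dart.ext _ _ he
  obtain rfl : e' = (hc.dart j).symm := Dart.ext _ _ he'
  -- No edge of C ends at `v`, so all darts leaving it are on one face.
  have hxy : E.SameFace (cycleSubgraph G c).edgeSet x y := by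
    refine sameFace_of_fst_eq (hxv.trans hyv.symm) fun a ha hxa => hv ?_
    rw [← hxv]
    exact Subgraph.mem_verts_of_mem_edge ha hxa
  exact not_sameFace_dart_symm hc j
    ((sameFace_dart hc j i).trans ((hex.trans hxy).trans hey.symm))

theorem isLongCycle_sideCycle (hc : IsLongCycle G c) (b : Bool) :
    IsLongCycle (E.side c b).coe (E.sideCycle c b) where
  four_le := hc.four_le
  injective i j h := hc.injective (congrArg Subtype.val h)
  adj i := by
    refine ⟨hc.dart i, rfl, ?_⟩
    cases b
    · exact Or.inr ⟨_, i, rfl, SameFace.refl _ _⟩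
    · exact Or.inl ⟨_, i, rfl, SameFace.refl _ _⟩

/-- Both side colorings are normalized to the parity coloring on C, which is all that the sides
share; every edge of G belongs to a side, so the glued coloring is proper. -/
theorem twoColorable_iff_sides {m : ℕ} {c : ZMod (2 * m) → V} (hc : IsLongCycle G c) :
    TwoColorable G (range c) ↔
      ∀ b, TwoColorable (E.side c b).coe (range (E.sideCycle c b)) := by
  classical
  simp only [twoColorable_iff_exists_coloring hc,
    twoColorable_iff_exists_coloring (isLongCycle_sideCycle hc _)]
  constructor
  · rintro ⟨f, hf⟩ b
    exact ⟨f.comp (E.side c b).hom, hf⟩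
  · intro h
    choose f hf using h
    set g : V → Fin 4 := fun v =>
      if hv : v ∈ (E.side c true).verts then f true ⟨v, hv⟩
      else if hv : v ∈ (E.side c false).verts then f false ⟨v, hv⟩ else 0 with hg
    have hgb : ∀ b v, ∀ hv : v ∈ (E.side c b).verts, g v = f b ⟨v, hv⟩ := by
      intro b v hv
      cases b
      · by_cases ht : v ∈ (E.side c true).verts
        · obtain ⟨i, rfl⟩ := mem_range_of_mem_sides hc (Bool.forall_bool.2 ⟨hv, ht⟩)
          exact (dif_pos ht).trans ((hf true i).trans (hf false i).symm)
        · exact (dif_neg ht).trans (dif_pos hv)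
      · exact dif_pos hv
    refine ⟨Coloring.mk g ?_, fun i => (hgb true _ (Or.inl ⟨i, rfl⟩)).trans (hf true i)⟩
    intro x y hxy
    obtain ⟨b, hb⟩ := exists_onSide (E := E) hc ⟨(x, y), hxy⟩
    rw [hgb b x (Or.inr ⟨_, hb, Or.inl rfl⟩), hgb b y (Or.inr ⟨_, hb, Or.inr rfl⟩)]
    exact (f b).valid (show (E.side c b).coe.Adj _ _ from ⟨_, rfl, Or.inl hb⟩)

end PlaneEmbedding

end

theorem theorem6p16 {V : Type*} [Fintype V] (G : SimpleGraph V) (E : PlaneEmbedding G)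
    (m : ℕ) (c : ZMod (2 * m) → V) :
    (E.IsSemiMaximal c →
      (TwoColorable G (Set.range c) ↔
        ClosedCycleCycle G c ∨ ClosedCycleTree G c ∨ ClosedCycleFence E c ∨
        FenceTree E c ∨ FenceCycle E c ∨ ScyclesForest G c ∨ ScyclesScycles G c ∨
        IntersectedForest G c ∨ IntersectedCycles G c)) ∧
    (E.IsTriangulation → (∀ v, 4 ≤ (G.neighborSet v).ncard) → IsLongCycle G c →
      (∀ b, ∃ g, BW.Outcome (E.side c b).coe (E.sideCycle c b) g) ∧
      ∀ g₁ g₂, BW.Outcome (E.side c true).coe (E.sideCycle c true) g₁ →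
        BW.Outcome (E.side c false).coe (E.sideCycle c false) g₂ →
        (TwoColorable G (Set.range c) ↔ ¬ BW.HasGrey g₁ ∧ ¬ BW.HasGrey g₂)) := by
  refine ⟨fun hE => hE.twoColorable_iff, fun _ _ hc => ⟨fun b => BW.exists_outcome _, ?_⟩⟩
  intro g₁ g₂ h₁ h₂
  rw [PlaneEmbedding.twoColorable_iff_sides (E := E) hc, Bool.forall_bool, and_comm,
    h₁.not_hasGrey_iff (PlaneEmbedding.isLongCycle_sideCycle hc true),
    h₂.not_hasGrey_iff (PlaneEmbedding.isLongCycle_sideCycle hc false)]
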